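/- For $n\ge 1$ let $B_n(z)=\sum_{k=0}^n\binom nk^2\binom{n+k}k^2z^k$ be the Apéry polynomials and let $\tilde B_n(z)=(z+1)^nB_n\left(\frac{z-1}{z+1}\right)=\sum_{k=0}^n\binom nk^2\binom{n+k}k^2(z-1)^k(z+1)^{n-k}$. Let $\mu_n$ and $\nu_n$ be the normalized zero-counting measures of $B_n$ and $\tilde B_n$ (mass $1/n$ at each complex zero, counted with multiplicity). All roots $\sqrt z$ are principal: $\sqrt z=\exp\left(\frac12(\log|z|+i\arg z)\right)$ with $\arg z\in(-\pi,\pi]$, and $\sqrt 0=0$. The logarithmic potential of a measure $\rho$ is $\mathcal U^\rho(z)=\int\log\frac1{|z-t|}\,d\rho(t)$, and weak-star convergence is tested against bounded continuous functions on $\mathbb C$. Put $$\phi(z)=\left|\sqrt{z+1}+2\sqrt{z-1}+2\sqrt{z-1+\sqrt{z-1}\sqrt{z+1}}\right|,\qquad w(x)=\phi(x)^{-2}.$$ (i) The sequence $(\nu_n)$ converges in the weak-star sense to a unit measure $\nu$ supported on $[-1,1]$. The measure $\nu$ is the unique solution of the weighted equilibrium problem on $[-1,1]$ with respect to $w$,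 that is, the unique minimizer of the weighted energy $$I_w(\sigma)=\iint\log\frac{1}{|z-t|\,w(z)\,w(t)}\,d\sigma(z)\,d\sigma(t)$$ among all Borel probability measures $\sigma$ supported on $[-1,1]$. Its logarithmic potential is $$\mathcal U^\nu(z)=\log(1+\sqrt2)^4-2\log\phi(z),\qquad z\in\mathbb C.$$ Moreover, $\nu$ is absolutely continuous with respect to the Lebesgue measure on $[-1,1]$, with $$d\nu=\frac{1}{\pi\sqrt{1+x}\,(1-x)^{3/4}\,(\sqrt2+\sqrt{1-x})^{1/2}}\,dx.$$ (ii) The sequence $(\mu_n)$ converges in the weak-star sense to a unit measure $\mu$ supported on $(-\infty,0]$, with logarithmic potential $$\mathcal U^\mu(z)=4\log2-2\log\left|1+2\left(\sqrt z+\sqrt{z+\sqrt z}\right)\right|,\qquad z\in\mathbb C.$$ Moreover, $\mu$ is absolutely continuous with respect to the Lebesgue measure on $(-\infty,0]$, with $$d\mu=\frac{1}{\sqrt2\,\pi\,|x|^{3/4}(1+|x|)^{1/2}(\sqrt{|x|}+\sqrt{1+|x|})^{1/2}}\,dx.$$ -/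

import Mathlib

open MeasureTheory Filter Topology Polynomial
open scoped ENNReal BoundedContinuousFunction

noncomputable section

namespace Apery

/-- The Apéry polynomial `B_n(z) = ∑_{k=0}^n (n choose k)² (n+k choose k)² z^k`. -/
def B (n : ℕ) : ℂ[X] :=
  ∑ k ∈ Finset.range (n + 1), C ((n.choose k : ℂ) ^ 2 * ((n + k).choose k : ℂ) ^ 2) * X ^ k

/-- The transformed polynomial
`∑_{k=0}^n (n choose k)² (n+k choose k)² (z-1)^k (z+1)^(n-k)`, that is, the polynomial
`(z+1)^n B_n((z-1)/(z+1))` (see `eval_Btilde`). -/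
def Btilde (n : ℕ) : ℂ[X] :=
  ∑ k ∈ Finset.range (n + 1),
    C ((n.choose k : ℂ) ^ 2 * ((n + k).choose k : ℂ) ^ 2) * (X - 1) ^ k * (X + 1) ^ (n - k)

theorem eval_Btilde (n : ℕ) (z : ℂ) (hz : z ≠ -1) :
    (Btilde n).eval z = (z + 1) ^ n * (B n).eval ((z - 1) / (z + 1)) := by
  have h : z + 1 ≠ 0 := fun h => hz (eq_neg_of_add_eq_zero_left h)
  simp only [Btilde, B, eval_finsetSum, Finset.mul_sum]
  refine Finset.sum_congr rfl fun k hk => ?_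
  have hkn : k ≤ n := by simpa [Nat.lt_succ_iff] using hk
  have e : (z + 1) ^ n = (z + 1) ^ (n - k) * (z + 1) ^ k := by
    rw [← pow_add, Nat.sub_add_cancel hkn]
  simp only [eval_mul, eval_C, eval_pow, eval_sub, eval_add, eval_X, eval_one, div_pow]
  rw [e]
  field_simp

/-- The normalized zero-counting measure of a polynomial `p`: mass `1 / deg p` at each complex
zero of `p`, zeros being repeated according to multiplicity. -/
def zeroCountingMeasure (p : ℂ[X]) : Measure ℂ :=
  (p.natDegree : ℝ≥0∞)⁻¹ • (p.roots.map fun z => Measure.dirac z).sum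

/-- Weak-star convergence, tested against all bounded continuous functions. -/
def WeakStarTendsto (ρ : ℕ → Measure ℂ) (ρlim : Measure ℂ) : Prop :=
  ∀ f : ℂ →ᵇ ℝ, Tendsto (fun n => ∫ z, f z ∂(ρ n)) atTop (𝓝 (∫ z, f z ∂ρlim))

/-- The Lebesgue integral of an extended real valued function, `∫ k⁺ - ∫ k⁻`. By the conventions
for subtraction in `EReal`, its value is a real number only if both parts are finite. -/
def extIntegral {α : Type*} [MeasurableSpace α] (ρ : Measure α) (k : α → EReal) : EReal :=
  ((∫⁻ x, (k x).toENNReal ∂ρ : ℝ≥0∞) : EReal) - ((∫⁻ x, (-k x).toENNReal ∂ρ : ℝ≥0∞) : EReal)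

/-- The logarithmic potential `U^ρ(z) = ∫ log (1 / |z - t|) dρ(t)`, the integrand being `+∞`
at `t = z`. -/
def logPotential (ρ : Measure ℂ) (z : ℂ) : EReal :=
  extIntegral ρ fun t => ENNReal.log ((ENNReal.ofReal ‖z - t‖)⁻¹)

/-- The weighted logarithmic energy `I_w(ρ) = ∬ log (1 / (|z - t| w(z) w(t))) dρ(z) dρ(t)`. -/
def weightedEnergy (w : ℂ → ℝ) (ρ : Measure ℂ) : EReal :=
  extIntegral (ρ.prod ρ) fun p =>
    ENNReal.log ((ENNReal.ofReal (‖p.1 - p.2‖ * w p.1 * w p.2))⁻¹)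

/-- `ρ` is a unit measure supported on the set `K`. -/
def IsUnitMeasureOn (K : Set ℂ) (ρ : Measure ℂ) : Prop :=
  IsProbabilityMeasure ρ ∧ ρ Kᶜ = 0

/-- `ρ` solves the weighted equilibrium problem on `K` with respect to the weight `w`: it minimizes
the weighted energy among all unit measures supported on `K`. -/
def IsWeightedEquilibrium (K : Set ℂ) (w : ℂ → ℝ) (ρ : Measure ℂ) : Prop :=
  IsUnitMeasureOn K ρ ∧ ∀ σ : Measure ℂ, IsUnitMeasureOn K σ →
    weightedEnergy w ρ ≤ weightedEnergy w σ

/-- The interval `[-1, 1]` in the complex plane. -/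
def unitSegment : Set ℂ := (fun x : ℝ => (x : ℂ)) '' Set.Icc (-1) 1

/-- The half-line `(-∞, 0]` in the complex plane. -/
def negHalfLine : Set ℂ := (fun x : ℝ => (x : ℂ)) '' Set.Iic 0

/-- `|√(z+1) + 2√(z-1) + 2√(z-1+√(z-1)√(z+1))|`. The root `Complex.sqrt` is the principal one,
`exp ((log |z| + i arg z) / 2)` with `arg z ∈ (-π, π]` for `z ≠ 0`, and `0` at `0`. -/
def phi (z : ℂ) : ℝ :=
  ‖Complex.sqrt (z + 1) + 2 * Complex.sqrt (z - 1)
    + 2 * Complex.sqrt (z - 1 + Complex.sqrt (z - 1) * Complex.sqrt (z + 1))‖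

/-- The weight function of the equilibrium problem. -/
def weight (z : ℂ) : ℝ := (phi z ^ 2)⁻¹

/-- The density of the limit measure on `[-1, 1]`. -/
def nuDensity (x : ℝ) : ℝ :=
  1 / (Real.pi * √(1 + x) * (1 - x) ^ (3 / 4 : ℝ) * (√2 + √(1 - x)) ^ (1 / 2 : ℝ))

/-- The density of the limit measure on `(-∞, 0]`. -/
def muDensity (x : ℝ) : ℝ :=
  1 / (√2 * Real.pi * |x| ^ (3 / 4 : ℝ) * (1 + |x|) ^ (1 / 2 : ℝ)
    * (√|x| + √(1 + |x|)) ^ (1 / 2 : ℝ))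

/-- `ρ` lives on the subset `S` of the real line and is absolutely continuous with respect to the
one-dimensional Lebesgue measure on `S`, with Radon-Nikodym derivative `g`. -/
def HasRealDensity (ρ : Measure ℂ) (S : Set ℝ) (g : ℝ → ℝ) : Prop :=
  ρ = ((volume.restrict S).withDensity fun x => ENNReal.ofReal (g x)).map fun x : ℝ => (x : ℂ)

end Apery

end

noncomputable section

namespace Apery

/-! ### Real-rootedness -/

/-! All zeros of `B n` lie on `(-∞, 0]`: up to a Möbius substitution, `∑ (n choose k)² z^k` is a
Legendre polynomial, real-rooted by Gauss–Lucas applied to Rodrigues' formula, and multiplying the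
coefficients twice by `(n+k choose k)` keeps the zeros on the half-line (`B_roots_mem`). Asymptotics
at positive points alone then determine the zero distribution. For `a ≥ 0`, `B n` at `a` is the sum
of the squares of the terms of a Legendre sum at `√a`, which is itself a sum of squares of binomial
terms. Two Cauchy–Schwarz comparisons give the `n`-th root limit `(√√a + √(1+√a))^4`
(`norm_eval_B_bounds`).

The limit law is that of `-(S T)²`, with `S` arcsine on `[0, 1]` and `T` half-Cauchy, independent.
Given `S`, Jensen's formula integrates `log |s² + (S T)²|` to `2 log |s + S|`; Jensen's formula for
a quadratic with reciprocal roots then integrates out `S`. This gives the potential at every point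
(`log_norm_sub_limitLaw`), while Cauchy's formula gives the density (`limitLaw_eq`).

The map `t ↦ (1+t)/(1-t)` carries `(-∞, 0]` to `(-1, 1]` and zeros of `B n` to zeros of `Btilde n`.
Differences of potentials at two positive points become integrals of `log (1 - c x)`, `0 < c < 1`;
their limits determine all moments (`tendsto_integral_of_tendsto_log`). No mass escapes to `-∞`,
that is, to `-1`, because the limit has no atoms.

For the equilibrium problem, the potential of `ν` plus `2 log φ` is constant, so for `σ` of finite
energy the excess `I_w(σ) - I_w(ν)` is the logarithmic energy of `σ - ν`. The expansion `-log (2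
|cos a - cos b|) = ∑ (2/n) cos (n a) cos (n b)` bounds that energy below by each `2/n` times a
squared difference of Chebyshev moments (`logEnergy_lower_bound`). Hence `ν` minimizes, and a
minimizer has the moments of `ν`. -/

lemma mem_negHalfLine_iff {z : ℂ} : z ∈ negHalfLine ↔ z.re ≤ 0 ∧ z.im = 0 := by
  constructor
  · rintro ⟨x, hx, rfl⟩
    exact ⟨by simpa using hx, by simp⟩
  · rintro ⟨h, h'⟩
    exact ⟨z.re, h, by apply Complex.ext <;> simp [h']⟩

lemma convex_ofReal_image {s : Set ℝ} (hs : Convex ℝ s) :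
    Convex ℝ ((fun x : ℝ => (x : ℂ)) '' s) :=
  hs.linear_image Complex.ofRealCLM.toLinearMap

/-- Gauss–Lucas. For constant `f` the derivative is `0`, whose multiset of roots is empty by
convention. -/
lemma roots_derivative_mem {K : Set ℂ} (hK : Convex ℝ K) {f : ℂ[X]}
    (hf : ∀ z ∈ f.roots, z ∈ K) : ∀ z ∈ (derivative f).roots, z ∈ K := by
  intro z hz
  have h0 : 0 < f.degree := by
    by_contra h
    rw [eq_C_of_degree_le_zero (not_lt.mp h)] at hz
    simp at hz
  refine convexHull_min ?_ hK (rootSet_derivative_subset_convexHull_rootSet h0 ?_)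
  · intro w hw
    rw [mem_rootSet] at hw
    exact hf w ((mem_roots hw.1).mpr (by simpa using hw.2))
  · rw [mem_rootSet]
    rw [mem_roots'] at hz
    exact ⟨hz.1, by simpa using hz.2⟩

lemma roots_iterate_derivative_mem {K : Set ℂ} (hK : Convex ℝ K) {f : ℂ[X]}
    (hf : ∀ z ∈ f.roots, z ∈ K) (n : ℕ) : ∀ z ∈ (derivative^[n] f).roots, z ∈ K := by
  induction n with
  | zero => exact hf
  | succ n ih =>
    rw [Function.iterate_succ_apply']
    exact roots_derivative_mem hK ih

/-- Multiplying the `k`-th coefficient by `k + j` for some fixed `j ≥ 1` does not move the zeros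
out of the negative half line. -/
lemma roots_euler_mem {f : ℂ[X]} (hf : ∀ z ∈ f.roots, z ∈ negHalfLine) (j : ℕ) :
    ∀ z ∈ (C ((j : ℂ) + 1) * f + X * derivative f).roots, z ∈ negHalfLine := by
  intro z hz
  -- The operator is `X^(-j) ∘ d/dX ∘ X^(j+1)`: the power of `X` only adds the zero `0`, which is in
  -- the half-line, and Gauss–Lucas applies.
  have hd : derivative (X ^ (j + 1) * f) = X ^ j * (C ((j : ℂ) + 1) * f + X * derivative f) := by
    simp only [derivative_mul, derivative_X_pow, Nat.add_sub_cancel, Nat.cast_add, Nat.cast_one]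
    ring
  have hK : Convex ℝ negHalfLine := convex_ofReal_image (convex_Iic 0)
  refine roots_derivative_mem (f := X ^ (j + 1) * f) hK ?_ z ?_
  · intro w hw
    rw [mem_roots'] at hw
    rcases mul_eq_zero.mp (show (X ^ (j + 1)).eval w * f.eval w = 0 by
      simpa [IsRoot.def] using hw.2) with h | h
    · have : w = 0 := by simpa using h
      subst this
      exact ⟨0, by simp⟩
    · exact hf w ((mem_roots (right_ne_zero_of_mul hw.1)).mpr h)
  · rw [mem_roots'] at hz ⊢
    rw [hd]
    refine ⟨mul_ne_zero (pow_ne_zero _ X_ne_zero) hz.1, ?_⟩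
    have := hz.2
    rw [IsRoot.def] at this ⊢
    rw [eval_mul, this, mul_zero]

/-- The Euler step with `j = 0, …, m - 1` multiplies the `k`-th coefficient by `(k+1)⋯(k+m)`. For `m
= n` this is `n! (n+k choose k)`. -/
lemma exists_ascFactorial_multiplier {f : ℂ[X]} (hf : ∀ z ∈ f.roots, z ∈ negHalfLine) (m : ℕ) :
    ∃ g : ℂ[X], (∀ k, g.coeff k = ((k + 1).ascFactorial m : ℂ) * f.coeff k) ∧
      ∀ z ∈ g.roots, z ∈ negHalfLine := by
  induction m with
  | zero => exact ⟨f, by simp, hf⟩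
  | succ m ih =>
    obtain ⟨g, hg, hr⟩ := ih
    refine ⟨_, ?_, roots_euler_mem hr m⟩
    intro k
    rw [Nat.ascFactorial_succ]
    cases k with
    | zero => simp [hg]; ring
    | succ k =>
      rw [coeff_add, coeff_C_mul, coeff_X_mul, coeff_derivative, hg]
      push_cast
      ring

/-- The Leibniz expansion of Rodrigues' formula. -/
lemma rodrigues_expansion (n : ℕ) :
    derivative^[n] (X ^ n * (1 - X) ^ n : ℂ[X]) = C (n.factorial : ℂ) *
      ∑ k ∈ Finset.range (n + 1),
        C ((-1) ^ k * (n.choose k : ℂ) ^ 2) * X ^ k * (1 - X) ^ (n - k) := by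
  rw [iterate_derivative_mul, Finset.mul_sum]
  refine Finset.sum_congr rfl fun k hk => ?_
  have hkn : k ≤ n := by simpa [Nat.lt_succ_iff] using hk
  have h1 : (1 - X : ℂ[X]) ^ n = (X ^ n : ℂ[X]).comp (1 - X) := by simp
  rw [h1, iterate_derivative_comp_one_sub_X, iterate_derivative_X_pow_eq_C_mul,
    iterate_derivative_X_pow_eq_C_mul, Nat.sub_sub_self hkn]
  have h2 : (n.factorial : ℂ) * (n.choose k : ℂ) =
      (n.descFactorial (n - k) : ℂ) * (n.descFactorial k : ℂ) := by
    rw [← Nat.choose_symm hkn]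
    have e1 := Nat.descFactorial_eq_factorial_mul_choose n (n - k)
    have e2 := Nat.factorial_mul_descFactorial hkn
    rw [e1, ← e2]
    push_cast
    ring
  simp only [mul_comp, C_comp, X_pow_comp, nsmul_eq_mul]
  have h3 : (C (n.factorial : ℂ) * C (n.choose k : ℂ) : ℂ[X]) =
      C (n.descFactorial (n - k) : ℂ) * C (n.descFactorial k : ℂ) := by
    rw [← C_mul, h2, C_mul]
  simp only [C_mul, C_pow, C_neg, C_1] at h3 ⊢
  rw [← C_eq_natCast]
  linear_combination (-(C (n.choose k : ℂ)) * X ^ k * (-1) ^ k * (1 - X) ^ (n - k)) * h3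

lemma rodrigues_roots_mem (n : ℕ) :
    ∀ z ∈ (derivative^[n] (X ^ n * (1 - X) ^ n : ℂ[X])).roots,
      z ∈ (fun x : ℝ => (x : ℂ)) '' Set.Icc 0 1 := by
  refine roots_iterate_derivative_mem (convex_ofReal_image (convex_Icc 0 1)) ?_ n
  intro w hw
  rw [mem_roots'] at hw
  have h := hw.2
  simp only [IsRoot.def, eval_mul, eval_pow, eval_X, eval_sub, eval_one, mul_eq_zero] at h
  rcases h with h | h
  · exact ⟨0, by simp, by simpa using (eq_zero_of_pow_eq_zero h).symm⟩
  · exact ⟨1, by simp, by simpa using (sub_eq_zero.mp (eq_zero_of_pow_eq_zero h))⟩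

/-- Under `x = -z/(1-z)` the sum becomes, up to the factor `n! / (1-z)^n`, the Rodrigues polynomial
at `x`, whose zeros lie in `[0, 1]`. The inverse `z = -x/(1-x)` sends `[0, 1)` into the half-line.
The pole `z = 1` is no zero, since there the sum is positive. -/
lemma sum_choose_sq_roots_mem (n : ℕ) :
    ∀ z ∈ (∑ k ∈ Finset.range (n + 1), C ((n.choose k : ℂ) ^ 2) * X ^ k).roots,
      z ∈ negHalfLine := by
  intro z hz
  rw [mem_roots', IsRoot.def, eval_finsetSum] at hz
  have hz0 := hz.2
  simp only [eval_mul, eval_C, eval_pow, eval_X] at hz0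
  have hz1 : z ≠ 1 := by
    rintro rfl
    have : ((∑ k ∈ Finset.range (n + 1), n.choose k ^ 2 : ℕ) : ℂ) = 0 := by
      push_cast
      simpa using hz0
    rw [Nat.cast_eq_zero, Finset.sum_eq_zero_iff] at this
    simpa using this 0 (by simp)
  have hd : 1 - z ≠ 0 := sub_ne_zero.mpr (Ne.symm hz1)
  set x : ℂ := -z / (1 - z) with hx
  have hx1 : 1 - x = 1 / (1 - z) := by rw [hx]; field_simp; ring
  have hroot : (derivative^[n] (X ^ n * (1 - X) ^ n : ℂ[X])).eval x = 0 := by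
    rw [rodrigues_expansion, eval_mul, eval_finsetSum]
    simp only [eval_mul, eval_C, eval_pow, eval_X, eval_sub, eval_one]
    have : ∑ k ∈ Finset.range (n + 1),
        (-1) ^ k * (n.choose k : ℂ) ^ 2 * x ^ k * (1 - x) ^ (n - k) =
        (1 / (1 - z)) ^ n * ∑ k ∈ Finset.range (n + 1), (n.choose k : ℂ) ^ 2 * z ^ k := by
      rw [Finset.mul_sum]
      refine Finset.sum_congr rfl fun k hk => ?_
      have hkn : k ≤ n := by simpa [Nat.lt_succ_iff] using hk
      have hxz : x = -1 * z * (1 / (1 - z)) := by rw [hx]; ring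
      rw [hx1, hxz, ← Nat.sub_add_cancel hkn, pow_add (1 / (1 - z)) (n - k) k,
        Nat.sub_add_cancel hkn, mul_pow, mul_pow]
      have : ((-1 : ℂ) ^ k) * (-1) ^ k = 1 := by rw [← mul_pow]; simp
      linear_combination ((n.choose k : ℂ) ^ 2 * z ^ k * (1 / (1 - z)) ^ k *
        (1 / (1 - z)) ^ (n - k)) * this
    rw [this, hz0, mul_zero, mul_zero]
  -- At `0` only the term `k = 0` survives and equals `n!`.
  have hne : derivative^[n] (X ^ n * (1 - X) ^ n : ℂ[X]) ≠ 0 := by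
    intro h
    have : (derivative^[n] (X ^ n * (1 - X) ^ n : ℂ[X])).eval 0 = 0 := by rw [h]; simp
    rw [rodrigues_expansion, eval_mul, eval_finsetSum, Finset.sum_eq_single 0] at this
    · simp [Nat.factorial_ne_zero] at this
    · intro k _ hk
      simp [hk]
    · simp
  obtain ⟨y, hy, hyx⟩ := rodrigues_roots_mem n x ((mem_roots hne).mpr hroot)
  have hy1 : (1 : ℂ) - y ≠ 0 := by
    rw [show (y : ℂ) = x from hyx, hx1]
    exact one_div_ne_zero hd
  have hzy : z = ((-y / (1 - y) : ℝ) : ℂ) := by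
    push_cast
    rw [show (y : ℂ) = x from hyx, hx1, hx]
    field_simp
  have : y < 1 := lt_of_le_of_ne hy.2 (by rintro rfl; simp at hy1)
  rw [hzy]
  refine ⟨_, ?_, rfl⟩
  exact div_nonpos_of_nonpos_of_nonneg (neg_nonpos.mpr hy.1) (sub_nonneg.mpr this.le)

lemma coeff_B (n k : ℕ) :
    (B n).coeff k = (n.choose k : ℂ) ^ 2 * ((n + k).choose k : ℂ) ^ 2 := by
  rw [B, finsetSum_coeff]
  simp_rw [coeff_C_mul_X_pow]
  simp +contextual [Nat.choose_eq_zero_of_lt]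

lemma B_ne_zero (n : ℕ) : B n ≠ 0 := by
  intro h
  have := coeff_B n 0
  simp [h] at this

lemma natDegree_B (n : ℕ) : (B n).natDegree = n := by
  apply natDegree_eq_of_le_of_coeff_ne_zero
  · rw [natDegree_le_iff_coeff_eq_zero]
    intro k hk
    simp [coeff_B, Nat.choose_eq_zero_of_lt hk]
  · rw [coeff_B]
    have := (Nat.choose_pos (show n ≤ n + n by simp)).ne'
    simp [this]

lemma B_roots_mem (n : ℕ) : ∀ z ∈ (B n).roots, z ∈ negHalfLine := by
  -- Two multipliers turn `∑ (n choose k)² z^k` into `(n!)²` times `B n`.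
  obtain ⟨g, hg, hgr⟩ := exists_ascFactorial_multiplier (sum_choose_sq_roots_mem n) n
  obtain ⟨f, hf, hfr⟩ := exists_ascFactorial_multiplier hgr n
  have : f = C ((n.factorial : ℂ) ^ 2) * B n := by
    ext k
    rw [coeff_C_mul, coeff_B, hf, hg, Nat.ascFactorial_eq_factorial_mul_choose, finsetSum_coeff]
    simp_rw [coeff_C_mul_X_pow]
    have : (k + n).choose n = (n + k).choose k := by
      rw [Nat.add_comm n k, Nat.choose_symm_add]
    rw [this]
    by_cases hk : k < n + 1
    · simp [hk]
      ring
    · simp [hk, Nat.choose_eq_zero_of_lt (show n < k by omega)]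
  intro z hz
  apply hfr
  rw [this, roots_C_mul _ (by simp [Nat.factorial_ne_zero])]
  exact hz

/-! ### Exponential growth on the positive half-line -/

/-- Both sides are the shifted Legendre polynomial at `-y`: on the left by its coefficients, on the
right by Rodrigues' formula. -/
lemma legendre_sum_eq (n : ℕ) (y : ℝ) :
    ∑ k ∈ Finset.range (n + 1), (n.choose k : ℝ) * ((n + k).choose k : ℝ) * y ^ k =
      ∑ k ∈ Finset.range (n + 1), (n.choose k : ℝ) ^ 2 * (y ^ k * (1 + y) ^ (n - k)) := by
  have h := congrArg (Polynomial.map (Int.castRingHom ℂ)) (factorial_mul_shiftedLegendre_eq n)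
  rw [← iterate_derivative_map] at h
  simp only [Polynomial.map_mul, Polynomial.map_pow, Polynomial.map_sub, map_X,
    Polynomial.map_one, Polynomial.map_natCast, shiftedLegendre, Polynomial.map_sum,
    map_C] at h
  rw [rodrigues_expansion, ← C_eq_natCast] at h
  have h' := mul_left_cancel₀ (by simp [Nat.factorial_ne_zero]) h
  have e := congrArg (Polynomial.eval (-(y : ℂ))) h'
  simp only [eval_finsetSum, eval_mul, eval_C, eval_pow, eval_X, eval_sub, eval_one,
    sub_neg_eq_add] at e
  have key : ((∑ k ∈ Finset.range (n + 1), (n.choose k : ℝ) * ((n + k).choose k : ℝ) * y ^ k : ℝ)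
      : ℂ) = ((∑ k ∈ Finset.range (n + 1), (n.choose k : ℝ) ^ 2 * (y ^ k * (1 + y) ^ (n - k)) : ℝ)
      : ℂ) := by
    push_cast
    convert e using 1
    · refine Finset.sum_congr rfl fun k _ => ?_
      have hs : (n + k).choose k = (n + k).choose n := Nat.choose_symm_add.symm
      have : ((-1 : ℂ) ^ k) * (-1) ^ k = 1 := by rw [← mul_pow]; simp
      rw [hs, neg_pow]
      simp only [map_mul, map_pow, map_neg, map_one, map_natCast]
      linear_combination (-(n.choose k : ℂ) * ((n + k).choose n : ℂ) * (y : ℂ) ^ k) * this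
    · refine Finset.sum_congr rfl fun k _ => ?_
      have : ((-1 : ℂ) ^ k) * (-1) ^ k = 1 := by rw [← mul_pow]; simp
      rw [neg_pow]
      linear_combination (-(n.choose k : ℂ) ^ 2 * (y : ℂ) ^ k * (1 + (y : ℂ)) ^ (n - k)) * this
  exact_mod_cast key

lemma sq_sum_range_le (n : ℕ) (f : ℕ → ℝ) :
    (∑ k ∈ Finset.range (n + 1), f k) ^ 2 ≤
      ((n : ℝ) + 1) * ∑ k ∈ Finset.range (n + 1), f k ^ 2 := by
  simpa using sq_sum_le_card_mul_sum_sq (s := Finset.range (n + 1)) (f := f)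

/-- By `legendre_sum_eq` the sum consists of the squares of the `n + 1` terms in the binomial
expansion of `(√y + √(1+y))^n`. For nonnegative terms, the square of the sum lies between the sum of
squares and `n + 1` times it. -/
lemma legendre_sum_bounds (n : ℕ) {y : ℝ} (hy : 0 ≤ y) :
    (√y + √(1 + y)) ^ (2 * n) ≤ ((n : ℝ) + 1) *
      ∑ k ∈ Finset.range (n + 1), (n.choose k : ℝ) * ((n + k).choose k : ℝ) * y ^ k ∧
    ∑ k ∈ Finset.range (n + 1), (n.choose k : ℝ) * ((n + k).choose k : ℝ) * y ^ k ≤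
      (√y + √(1 + y)) ^ (2 * n) := by
  have e1 : (√y + √(1 + y)) ^ (2 * n) = (∑ k ∈ Finset.range (n + 1),
      (n.choose k : ℝ) * (√y ^ k * √(1 + y) ^ (n - k))) ^ 2 := by
    rw [mul_comm, pow_mul, add_pow]
    congr 1
    exact Finset.sum_congr rfl fun k _ => by ring
  have e2 : ∑ k ∈ Finset.range (n + 1), (n.choose k : ℝ) * ((n + k).choose k : ℝ) * y ^ k =
      ∑ k ∈ Finset.range (n + 1),
        ((n.choose k : ℝ) * (√y ^ k * √(1 + y) ^ (n - k))) ^ 2 := by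
    rw [legendre_sum_eq]
    refine Finset.sum_congr rfl fun k _ => ?_
    rw [mul_pow, mul_pow, ← pow_mul, ← pow_mul, mul_comm k 2, mul_comm (n - k) 2, pow_mul,
      pow_mul, Real.sq_sqrt hy, Real.sq_sqrt (by positivity)]
  rw [e1, e2]
  exact ⟨sq_sum_range_le n _, Finset.sum_sq_le_sq_sum_of_nonneg fun k _ => by positivity⟩

lemma eval_B_ofReal (n : ℕ) (a : ℝ) :
    (B n).eval (a : ℂ) = ((∑ k ∈ Finset.range (n + 1),
      (n.choose k : ℝ) ^ 2 * ((n + k).choose k : ℝ) ^ 2 * a ^ k : ℝ) : ℂ) := by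
  simp [B, eval_finsetSum]

/-- The same comparison once more, for the terms of the Legendre sum at `√a`. The factor `(n+1)^3`
is `(n+1)²` from squaring the first bound times `n + 1` from the second. -/
lemma norm_eval_B_bounds (n : ℕ) {a : ℝ} (ha : 0 ≤ a) :
    (√√a + √(1 + √a)) ^ (4 * n) ≤ ((n : ℝ) + 1) ^ 3 * ‖(B n).eval (a : ℂ)‖ ∧
    ‖(B n).eval (a : ℂ)‖ ≤ (√√a + √(1 + √a)) ^ (4 * n) := by
  set E := (√√a + √(1 + √a)) ^ (2 * n) with hE
  set S := ∑ k ∈ Finset.range (n + 1), (n.choose k : ℝ) * ((n + k).choose k : ℝ) * √a ^ k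
  obtain ⟨h1, h2⟩ := legendre_sum_bounds n (Real.sqrt_nonneg a)
  have e : ∑ k ∈ Finset.range (n + 1), (n.choose k : ℝ) ^ 2 * ((n + k).choose k : ℝ) ^ 2 * a ^ k =
      ∑ k ∈ Finset.range (n + 1), ((n.choose k : ℝ) * ((n + k).choose k : ℝ) * √a ^ k) ^ 2 := by
    refine Finset.sum_congr rfl fun k _ => ?_
    rw [mul_pow, mul_pow, ← pow_mul, mul_comm k 2, pow_mul, Real.sq_sqrt ha]
  have hE4 : (√√a + √(1 + √a)) ^ (4 * n) = E ^ 2 := by rw [hE, ← pow_mul]; congr 1; ring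
  have hE0 : 0 ≤ E := by positivity
  have hS0 : 0 ≤ S := Finset.sum_nonneg fun k _ => by positivity
  rw [eval_B_ofReal, Complex.norm_real, Real.norm_of_nonneg
    (Finset.sum_nonneg fun k _ => by positivity), e, hE4]
  constructor
  · have h3 : S ^ 2 ≤ _ := sq_sum_range_le n
      (fun k => (n.choose k : ℝ) * ((n + k).choose k : ℝ) * √a ^ k)
    calc E ^ 2 ≤ (((n : ℝ) + 1) * S) ^ 2 := pow_le_pow_left₀ hE0 h1 2
      _ = ((n : ℝ) + 1) ^ 2 * S ^ 2 := by ring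
      _ ≤ ((n : ℝ) + 1) ^ 2 * (((n : ℝ) + 1) * _) := by gcongr
      _ = _ := by ring
  · calc _ ≤ S ^ 2 := Finset.sum_sq_le_sq_sum_of_nonneg fun k _ => by positivity
      _ ≤ E ^ 2 := pow_le_pow_left₀ hS0 h2 2

/-- A sequence that agrees with `E ^ n` up to a polynomial factor has `n`-th root limit `E`. -/
lemma tendsto_log_div_of_bounds {u : ℕ → ℝ} {E : ℝ} {m d : ℕ} (hE : 0 < E)
    (h1 : ∀ n, E ^ (m * n) ≤ ((n : ℝ) + 1) ^ d * u n) (h2 : ∀ n, u n ≤ E ^ (m * n)) :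
    Tendsto (fun n : ℕ => Real.log (u n) / n) atTop (𝓝 (m * Real.log E)) := by
  have hlim : Tendsto (fun n : ℕ => (d : ℝ) * (Real.log ((n : ℝ) + 1) / n)) atTop (𝓝 0) := by
    have h : Tendsto (fun n : ℕ => Real.log ((n : ℝ) + 1) / ((n : ℝ) + 1)) atTop (𝓝 0) := by
      have := (Real.isLittleO_log_id_atTop.tendsto_div_nhds_zero).comp
        (tendsto_natCast_atTop_atTop.comp (tendsto_add_atTop_nat 1) :
          Tendsto (fun n : ℕ => ((n + 1 : ℕ) : ℝ)) atTop atTop)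
      refine this.congr fun n => ?_
      simp
    have h' : Tendsto (fun n : ℕ => (1 : ℝ) + 1 / (n : ℝ)) atTop (𝓝 (1 + 0)) :=
      tendsto_const_nhds.add tendsto_one_div_atTop_nhds_zero_nat
    have := (h.mul h').const_mul (d : ℝ)
    rw [zero_mul, mul_zero] at this
    refine this.congr' ?_
    filter_upwards [eventually_gt_atTop 0] with n hn
    have : (0 : ℝ) < n := by exact_mod_cast hn
    field_simp
  have hpos : ∀ n, 0 < u n := fun n => by
    have h := (pow_pos hE (m * n)).trans_le (h1 n)
    exact pos_of_mul_pos_right h (by positivity)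
  refine tendsto_of_tendsto_of_tendsto_of_le_of_le' (g := fun n : ℕ =>
    m * Real.log E - (d : ℝ) * (Real.log ((n : ℝ) + 1) / n)) (h := fun _ => m * Real.log E)
    (by simpa using tendsto_const_nhds.sub hlim) tendsto_const_nhds ?_ ?_
  · filter_upwards [eventually_gt_atTop 0] with n hn
    have hn' : (0 : ℝ) < n := by exact_mod_cast hn
    have := Real.log_le_log (pow_pos hE _) (h1 n)
    rw [Real.log_pow, Real.log_mul (by positivity) (hpos n).ne', Real.log_pow] at this
    push_cast at this
    rw [le_div_iff₀ hn', sub_mul]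
    have e : (d : ℝ) * (Real.log ((n : ℝ) + 1) / n) * n = d * Real.log ((n : ℝ) + 1) := by
      field_simp
    rw [e]
    linarith
  · filter_upwards [eventually_gt_atTop 0] with n hn
    have hn' : (0 : ℝ) < n := by exact_mod_cast hn
    have := Real.log_le_log (hpos n) (h2 n)
    rw [Real.log_pow] at this
    push_cast at this
    rw [div_le_iff₀ hn']
    linarith

lemma tendsto_log_norm_eval_B {a : ℝ} (ha : 0 ≤ a) :
    Tendsto (fun n : ℕ => Real.log ‖(B n).eval (a : ℂ)‖ / n) atTop
      (𝓝 (4 * Real.log (√√a + √(1 + √a)))) := by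
  have hE : 0 < √√a + √(1 + √a) := by
    have := Real.sqrt_nonneg a
    positivity
  exact_mod_cast tendsto_log_div_of_bounds (m := 4) (d := 3) hE
    (fun n => (norm_eval_B_bounds n ha).1) (fun n => (norm_eval_B_bounds n ha).2)

/-! ### Circle averages of logarithms -/

open Real in
-- Jensen's formula for a linear factor, over an interval symmetric about `0` so that `θ` and `-θ`
-- can be paired.
lemma log_norm_circleMap_sub (a : ℂ) :
    IntervalIntegrable (fun θ => log ‖circleMap 0 1 θ - a‖) volume (-π) π ∧
      ∫ θ in (-π)..π, log ‖circleMap 0 1 θ - a‖ = 2 * π * log⁺ ‖a‖ := by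
  have hper : (fun θ => log ‖circleMap 0 1 θ - a‖).Periodic (2 * π) :=
    fun x => by simp [periodic_circleMap 0 1 x]
  have hint : IntervalIntegrable (fun θ => log ‖circleMap 0 1 θ - a‖) volume 0 (2 * π) :=
    circleIntegrable_log_norm_sub_const (a := a) (c := 0) 1
  refine ⟨hper.intervalIntegrable₀ (by positivity) hint _ _, ?_⟩
  have h := hper.intervalIntegral_add_eq (-π) 0
  rw [show -π + 2 * π = π by ring, zero_add] at h
  rw [h]
  have h' := circleAverage_log_norm_sub_const_eq_posLog (a := a)
  rw [circleAverage_def, smul_eq_mul] at h'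
  rw [← h']
  field_simp

open Real in
lemma ae_circleMap_ne (a : ℂ) : ∀ᵐ θ : ℝ, circleMap 0 1 θ ≠ a :=
  ((Set.countable_singleton a).preimage_circleMap 0 one_ne_zero).ae_notMem volume

open Real in
lemma log_norm_circleMap_affine {c : ℂ} (hc : c ≠ 0) (d : ℂ) :
    IntervalIntegrable (fun θ => log ‖c * circleMap 0 1 θ + d‖) volume (-π) π ∧
      ∫ θ in (-π)..π, log ‖c * circleMap 0 1 θ + d‖ = 2 * π * (log ‖c‖ + log⁺ ‖d / c‖) := by
  obtain ⟨h1, h2⟩ := log_norm_circleMap_sub (-(d / c))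
  have hae : ∀ᵐ θ : ℝ, log ‖c‖ + log ‖circleMap 0 1 θ - -(d / c)‖ =
      log ‖c * circleMap 0 1 θ + d‖ := by
    filter_upwards [ae_circleMap_ne (-(d / c))] with θ hθ
    rw [← Real.log_mul (norm_ne_zero_iff.mpr hc) (norm_ne_zero_iff.mpr (sub_ne_zero.mpr hθ)),
      ← norm_mul]
    congr 2
    field_simp
    ring
  have hi := (intervalIntegrable_const (c := log ‖c‖) (a := -π) (b := π) (μ := volume)).add h1
  refine ⟨hi.congr_ae (ae_restrict_of_ae hae), ?_⟩
  rw [← intervalIntegral.integral_congr_ae (hae.mono fun θ h _ => h),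
    intervalIntegral.integral_add intervalIntegrable_const h1, h2, norm_neg]
  simp
  ring

open Real in
lemma integral_symm_add {L : ℝ → ℝ} (hL : IntervalIntegrable L volume (-π) π) :
    IntervalIntegrable (fun θ => L θ + L (-θ)) volume 0 π ∧
      ∫ θ in (0 : ℝ)..π, (L θ + L (-θ)) = ∫ θ in (-π)..π, L θ := by
  have hpi := pi_pos
  have h1 : IntervalIntegrable L volume 0 π := hL.mono_set (by
    rw [Set.uIcc_of_le hpi.le, Set.uIcc_of_le (by linarith)]
    exact Set.Icc_subset_Icc (by linarith) le_rfl)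
  have h2 : IntervalIntegrable L volume (-π) 0 := hL.mono_set (by
    rw [Set.uIcc_of_le (by linarith), Set.uIcc_of_le (by linarith)]
    exact Set.Icc_subset_Icc le_rfl (by linarith))
  have h3 : IntervalIntegrable (fun θ => L (-θ)) volume 0 π := by
    have := (h2.comp_sub_left 0).symm
    simpa using this
  refine ⟨h1.add h3, ?_⟩
  rw [intervalIntegral.integral_add h1 h3, intervalIntegral.integral_comp_neg, neg_zero, add_comm,
    intervalIntegral.integral_add_adjacent_intervals h2 h1]

/-- The uniform probability measure on `(0, π]`. -/
def uniformAngle : Measure ℝ := ENNReal.ofReal (Real.pi⁻¹) • volume.restrict (Set.Ioc 0 Real.pi)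

instance : IsProbabilityMeasure uniformAngle := ⟨by
  have := Real.pi_pos
  rw [uniformAngle, Measure.smul_apply, Measure.restrict_apply_univ, Real.volume_Ioc, sub_zero,
    smul_eq_mul, ← ENNReal.ofReal_mul (by positivity), inv_mul_cancel₀ this.ne',
    ENNReal.ofReal_one]⟩

lemma integrable_uniformAngle {f : ℝ → ℝ} (hf : IntervalIntegrable f volume 0 Real.pi) :
    Integrable f uniformAngle :=
  Integrable.smul_measure ((intervalIntegrable_iff_integrableOn_Ioc_of_le Real.pi_pos.le).mp hf)
    ENNReal.ofReal_ne_top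

lemma integral_uniformAngle (f : ℝ → ℝ) :
    ∫ θ, f θ ∂uniformAngle = Real.pi⁻¹ * ∫ θ in (0 : ℝ)..Real.pi, f θ := by
  rw [uniformAngle, integral_smul_measure, intervalIntegral.integral_of_le Real.pi_pos.le,
    ENNReal.toReal_ofReal (by have := Real.pi_pos; positivity), smul_eq_mul]

lemma ae_uniformAngle_of_ae {p : ℝ → Prop} (h : ∀ᵐ θ : ℝ, θ ∈ Set.Ioc 0 Real.pi → p θ) :
    ∀ᵐ θ ∂uniformAngle, p θ :=
  Measure.ae_smul_measure ((ae_restrict_iff' measurableSet_Ioc).mpr h) _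

lemma circleMap_eq (θ : ℝ) :
    circleMap 0 1 θ = (Real.cos θ : ℂ) + (Real.sin θ : ℂ) * Complex.I := by
  rw [circleMap_zero, Complex.ofReal_one, one_mul, Complex.exp_mul_I, ← Complex.ofReal_cos,
    ← Complex.ofReal_sin]

/-- On the unit circle `s + sin² (θ/2)` is, up to a factor of modulus `4`, a quadratic with
reciprocal roots `1 + 2s ± 2r`, where `r² = s² + s`. Jensen's and Cauchy's formulas then apply to
its factors. -/
lemma circleMap_quadratic (s : ℂ) (θ : ℝ) :
    circleMap 0 1 θ ^ 2 - (2 + 4 * s) * circleMap 0 1 θ + 1 =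
      -4 * circleMap 0 1 θ * (s + (Real.sin (θ / 2) ^ 2 : ℝ)) := by
  have e1 : Real.sin (θ / 2) ^ 2 = (1 - Real.cos θ) / 2 := by
    rw [Real.sin_sq, Real.cos_sq]
    ring_nf
  have e3 : (Real.sin θ : ℂ) ^ 2 + (Real.cos θ : ℂ) ^ 2 = 1 := by
    exact_mod_cast Real.sin_sq_add_cos_sq θ
  rw [e1, circleMap_eq]
  push_cast
  push_cast at e3
  linear_combination (-1 : ℂ) * e3 + (Complex.sin θ) ^ 2 * Complex.I_sq

/-- The Poisson integral of `log ‖s + ·‖` for the right half-plane, in angular coordinates. -/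
lemma log_norm_add_tan {s : ℂ} (hs : 0 ≤ s.re) {τ : ℝ} (hτ : 0 < τ) :
    Integrable (fun θ => Real.log ‖s ^ 2 + ((τ * Real.tan (θ / 2)) ^ 2 : ℝ)‖) uniformAngle ∧
      ∫ θ, Real.log ‖s ^ 2 + ((τ * Real.tan (θ / 2)) ^ 2 : ℝ)‖ ∂uniformAngle =
        2 * Real.log ‖s + τ‖ := by
  have hc : s + τ ≠ 0 := fun h => by
    have := congrArg Complex.re h
    simp at this
    linarith
  obtain ⟨h1, h2⟩ := log_norm_circleMap_affine hc (s - τ)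
  obtain ⟨h3, h4⟩ := log_norm_circleMap_affine one_ne_zero 1
  -- As `Re s ≥ 0` and `τ > 0`, the zero of the numerator lies in the closed unit disc and its
  -- `log⁺` term vanishes.
  have hle : ‖(s - τ) / (s + τ)‖ ≤ 1 := by
    rw [norm_div]
    refine div_le_one_of_le₀ ?_ (norm_nonneg _)
    rw [← sq_le_sq₀ (norm_nonneg _) (norm_nonneg _), Complex.sq_norm, Complex.sq_norm,
      Complex.normSq_apply, Complex.normSq_apply]
    simp
    nlinarith
  rw [Real.posLog_eq_zero_iff _ |>.mpr (by rwa [abs_norm]), add_zero] at h2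
  have h40 : Real.log ‖(1 : ℂ)‖ + Real.posLog ‖(1 : ℂ) / 1‖ = 0 := by
    simp [Real.posLog]
  rw [h40, mul_zero] at h4
  -- With `ζ = e^{iθ}` the quotient `((s+τ)ζ + (s-τ))/(ζ+1)` is `s + iτ tan (θ/2)`, so `L θ + L
  -- (-θ)` is the logarithm to be integrated.
  set L : ℝ → ℝ := fun θ => Real.log ‖(s + τ) * circleMap 0 1 θ + (s - τ)‖ -
    Real.log ‖1 * circleMap 0 1 θ + 1‖ with hL
  have hLi : IntervalIntegrable L volume (-Real.pi) Real.pi := h1.sub h3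
  have hLv : ∫ θ in (-Real.pi)..Real.pi, L θ = 2 * Real.pi * Real.log ‖s + τ‖ := by
    rw [hL, intervalIntegral.integral_sub h1 h3, h2, h4, sub_zero]
  obtain ⟨h5, h6⟩ := integral_symm_add hLi
  rw [hLv] at h6
  have hneg : ∀ θ, circleMap 0 1 (-θ) = (circleMap 0 1 θ)⁻¹ := fun θ => by
    rw [circleMap_zero_inv, inv_one]
  have hae : ∀ᵐ θ : ℝ, θ ∈ Set.Ioc 0 Real.pi →
      L θ + L (-θ) = Real.log ‖s ^ 2 + ((τ * Real.tan (θ / 2)) ^ 2 : ℝ)‖ := by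
    filter_upwards [ae_circleMap_ne (-1), ae_circleMap_ne (-((s - τ) / (s + τ))),
      ((Set.countable_singleton (-((s - τ) / (s + τ)))⁻¹).preimage_circleMap 0
        one_ne_zero).ae_notMem volume] with θ hθ1 hθ2 hθ3 hθ
    have hz0 : circleMap 0 1 θ ≠ 0 := circleMap_ne_center one_ne_zero
    have hcos : Real.cos (θ / 2) ≠ 0 := by
      intro h
      apply hθ1
      rw [circleMap_eq]
      have e1 : Real.cos θ = -1 := by
        rw [show θ = 2 * (θ / 2) by ring, Real.cos_two_mul, h]; norm_num
      have e2 : Real.sin θ = 0 := by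
        rw [show θ = 2 * (θ / 2) by ring, Real.sin_two_mul, h]; norm_num
      rw [e1, e2]; simp
    have htan : Complex.I * (Real.tan (θ / 2) : ℝ) * (circleMap 0 1 θ + 1) =
        circleMap 0 1 θ - 1 := by
      rw [circleMap_eq, Real.tan_eq_sin_div_cos]
      have e1 : Real.cos θ = 2 * Real.cos (θ / 2) ^ 2 - 1 := by
        rw [← Real.cos_two_mul]; congr 1; ring
      have e2 : Real.sin θ = 2 * Real.sin (θ / 2) * Real.cos (θ / 2) := by
        rw [← Real.sin_two_mul]; congr 1; ring
      have e3 : (Real.sin (θ / 2) : ℂ) ^ 2 + (Real.cos (θ / 2) : ℂ) ^ 2 = 1 := by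
        exact_mod_cast Real.sin_sq_add_cos_sq (θ / 2)
      have hcos' : (Real.cos (θ / 2) : ℂ) ≠ 0 := by exact_mod_cast hcos
      rw [e1, e2]
      simp only [Complex.ofReal_div, Complex.ofReal_mul, Complex.ofReal_sub, Complex.ofReal_pow,
        Complex.ofReal_one, Complex.ofReal_ofNat]
      generalize (Real.cos (θ / 2) : ℂ) = c at *
      generalize (Real.sin (θ / 2) : ℂ) = t at *
      field_simp
      ring_nf
      rw [Complex.I_sq]
      linear_combination (-2 * c) * e3
    rw [hL]
    simp only [hneg, one_mul]
    have hden : circleMap 0 1 θ + 1 ≠ 0 := fun h => hθ1 (eq_neg_of_add_eq_zero_left h)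
    set ζ := circleMap 0 1 θ with hζ
    have hden' : ζ⁻¹ + 1 ≠ 0 := by
      intro h
      apply hden
      field_simp at h
      linear_combination h
    have hn1 : (s + τ) * ζ + (s - τ) ≠ 0 := by
      intro h
      apply hθ2
      rw [eq_neg_iff_add_eq_zero]
      field_simp
      linear_combination h
    have hn2 : (s + τ) * ζ⁻¹ + (s - τ) ≠ 0 := by
      intro h
      have hw : ζ⁻¹ = -((s - τ) / (s + τ)) := by
        rw [eq_neg_iff_add_eq_zero]
        field_simp
        field_simp at h
        linear_combination h
      apply hθ3
      rw [Set.mem_preimage, Set.mem_singleton_iff, ← hζ, ← hw, inv_inv]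
    rw [← Real.log_div (by simpa using hn1) (by simpa using hden),
      ← Real.log_div (by simpa using hn2) (by simpa using hden'), ← norm_div, ← norm_div,
      ← Real.log_mul (norm_ne_zero_iff.mpr (div_ne_zero hn1 hden))
        (norm_ne_zero_iff.mpr (div_ne_zero hn2 hden')), ← norm_mul]
    congr 2
    have e1 : ((s + τ) * ζ + (s - τ)) / (ζ + 1) = s + Complex.I * (τ * (Real.tan (θ / 2) : ℝ)) := by
      rw [div_eq_iff hden]
      linear_combination (-(τ : ℂ)) * htan
    have e2 : ((s + τ) * ζ⁻¹ + (s - τ)) / (ζ⁻¹ + 1) =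
        s - Complex.I * (τ * (Real.tan (θ / 2) : ℝ)) := by
      rw [div_eq_iff hden']
      field_simp
      linear_combination (τ : ℂ) * htan
    rw [e1, e2]
    push_cast
    ring_nf
    rw [Complex.I_sq]
    ring
  constructor
  · refine (integrable_uniformAngle h5).congr (ae_uniformAngle_of_ae hae)
  · rw [← integral_congr_ae (ae_uniformAngle_of_ae hae), integral_uniformAngle, h6]
    have := Real.pi_pos
    field_simp

/-- The logarithmic potential of the arcsine distribution, in angular coordinates. -/
lemma log_norm_add_sin_sq {s r : ℂ} (hr : r ^ 2 = s ^ 2 + s)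
    (hle : ‖1 + 2 * s - 2 * r‖ ≤ ‖1 + 2 * s + 2 * r‖) :
    Integrable (fun θ => Real.log ‖s + (Real.sin (θ / 2) ^ 2 : ℝ)‖) uniformAngle ∧
      ∫ θ, Real.log ‖s + (Real.sin (θ / 2) ^ 2 : ℝ)‖ ∂uniformAngle =
        Real.log ‖1 + 2 * s + 2 * r‖ - 2 * Real.log 2 := by
  -- The roots `a`, `b` are reciprocal and `hle` makes `a` the outer one, so only `a` contributes to
  -- Jensen's formula.
  set a := 1 + 2 * s + 2 * r with ha
  set b := 1 + 2 * s - 2 * r with hb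
  have hab : a * b = 1 := by
    rw [ha, hb]
    linear_combination (-4 : ℂ) * hr
  have hnab : ‖a‖ * ‖b‖ = 1 := by rw [← norm_mul, hab, norm_one]
  have ha1 : 1 ≤ ‖a‖ := by nlinarith [norm_nonneg a, norm_nonneg b]
  have hb1 : ‖b‖ ≤ 1 := by nlinarith [norm_nonneg a, norm_nonneg b]
  obtain ⟨h1, h2⟩ := log_norm_circleMap_sub a
  obtain ⟨h3, h4⟩ := log_norm_circleMap_sub b
  rw [Real.posLog_eq_log (by simpa using ha1)] at h2
  rw [Real.posLog_eq_zero_iff _ |>.mpr (by rwa [abs_norm]), mul_zero] at h4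
  set L : ℝ → ℝ := fun θ => Real.log ‖circleMap 0 1 θ - a‖ + Real.log ‖circleMap 0 1 θ - b‖ -
    Real.log 4 with hL
  have hLi : IntervalIntegrable L volume (-Real.pi) Real.pi :=
    (h1.add h3).sub intervalIntegrable_const
  have hLv : ∫ θ in (-Real.pi)..Real.pi, L θ = 2 * Real.pi * (Real.log ‖a‖ - Real.log 4) := by
    rw [hL, intervalIntegral.integral_sub (h1.add h3) intervalIntegrable_const,
      intervalIntegral.integral_add h1 h3, h2, h4]
    simp
    ring
  obtain ⟨h5, h6⟩ := integral_symm_add hLi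
  rw [hLv] at h6
  have key : ∀ θ : ℝ, circleMap 0 1 θ ≠ a → circleMap 0 1 θ ≠ b →
      L θ = Real.log ‖s + (Real.sin (θ / 2) ^ 2 : ℝ)‖ := by
    intro θ ha' hb'
    have hz0 : circleMap 0 1 θ ≠ 0 := circleMap_ne_center one_ne_zero
    have e : (circleMap 0 1 θ - a) * (circleMap 0 1 θ - b) =
        -4 * circleMap 0 1 θ * (s + (Real.sin (θ / 2) ^ 2 : ℝ)) := by
      linear_combination circleMap_quadratic s θ + hab - circleMap 0 1 θ * ha -
        circleMap 0 1 θ * hb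
    have e' := congrArg (fun z : ℂ => Real.log ‖z‖) e
    have hne : s + (Real.sin (θ / 2) ^ 2 : ℝ) ≠ 0 := by
      intro h
      rw [h, mul_zero] at e
      exact mul_ne_zero (sub_ne_zero.mpr ha') (sub_ne_zero.mpr hb') e
    simp only [norm_mul, norm_circleMap_zero, norm_neg, abs_one, mul_one] at e'
    rw [Real.log_mul (by simpa [sub_eq_zero] using ha') (by simpa [sub_eq_zero] using hb'),
      Real.log_mul (by simp) (norm_ne_zero_iff.mpr hne), Complex.norm_ofNat] at e'
    rw [hL]
    simp only
    linarith
  have hae : ∀ᵐ θ : ℝ, θ ∈ Set.Ioc 0 Real.pi →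
      2⁻¹ * (L θ + L (-θ)) = Real.log ‖s + (Real.sin (θ / 2) ^ 2 : ℝ)‖ := by
    have hneg : ∀ θ, circleMap 0 1 (-θ) = (circleMap 0 1 θ)⁻¹ := fun θ => by
      rw [circleMap_zero_inv, inv_one]
    have hainv : b = a⁻¹ := eq_inv_of_mul_eq_one_right hab
    filter_upwards [ae_circleMap_ne a, ae_circleMap_ne b] with θ hθa hθb _
    rw [key θ hθa hθb, key (-θ)]
    · rw [neg_div, Real.sin_neg, neg_sq]
      ring
    · rw [hneg]
      intro h
      apply hθb
      rw [hainv, ← h, inv_inv]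
    · rw [hneg, hainv]
      intro h
      exact hθa (inv_injective h)
  constructor
  · refine (integrable_uniformAngle (h5.const_mul 2⁻¹)).congr (ae_uniformAngle_of_ae hae)
  · rw [← integral_congr_ae (ae_uniformAngle_of_ae hae), integral_uniformAngle,
      intervalIntegral.integral_const_mul, h6, show (4 : ℝ) = 2 ^ 2 by norm_num, Real.log_pow]
    have := Real.pi_pos
    field_simp
    norm_num

/-! ### The limit law and its potential -/

/-- A nonpositive random variable on the square `(0, π]²`. If `α`, `β` are uniform, then
`sin² (α / 2)` has the arcsine law and `tan (β / 2)` has the half-Cauchy law. -/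
def cauchyArcsine (p : ℝ × ℝ) : ℝ := -(Real.sin (p.1 / 2) ^ 2 * Real.tan (p.2 / 2)) ^ 2

lemma measurable_real_tan : Measurable Real.tan := by
  have : Real.tan = fun x => Real.sin x / Real.cos x := funext Real.tan_eq_sin_div_cos
  rw [this]
  exact Real.measurable_sin.div Real.measurable_cos

lemma measurable_cauchyArcsine : Measurable cauchyArcsine := by
  have h1 : Measurable fun p : ℝ × ℝ => Real.sin (p.1 / 2) :=
    Real.measurable_sin.comp (measurable_fst.div_const 2)
  have h2 : Measurable fun p : ℝ × ℝ => Real.tan (p.2 / 2) :=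
    measurable_real_tan.comp (measurable_snd.div_const 2)
  exact (((h1.pow_const 2).mul h2).pow_const 2).neg

lemma cauchyArcsine_nonpos (p : ℝ × ℝ) : cauchyArcsine p ≤ 0 := neg_nonpos.mpr (sq_nonneg _)

/-- The limit law of the zeros of the polynomials `B n`. -/
def limitLaw : Measure ℝ := (uniformAngle.prod uniformAngle).map cauchyArcsine

instance : IsProbabilityMeasure limitLaw :=
  Measure.isProbabilityMeasure_map measurable_cauchyArcsine.aemeasurable

lemma ae_uniformAngle_sin_pos : ∀ᵐ θ ∂uniformAngle, 0 < Real.sin (θ / 2) ^ 2 :=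
  ae_uniformAngle_of_ae (.of_forall fun θ hθ => by
    have := Real.sin_pos_of_pos_of_lt_pi (x := θ / 2) (by linarith [hθ.1])
      (by linarith [hθ.2, Real.pi_pos])
    positivity)

lemma measurable_log_norm_sub (z : ℂ) : Measurable fun t : ℝ => Real.log ‖z - t‖ := by
  have : Measurable fun t : ℝ => z - (t : ℂ) := measurable_const.sub Complex.measurable_ofReal
  exact Real.measurable_log.comp this.norm

/-- A bound of `|log x|` that is linear in `log x`: known values of logarithmic integrals thereby
bound the absolute integrals. -/
lemma abs_log_le (x M : ℝ) (hx : 0 ≤ x) (hM : 1 ≤ M) (hxM : x ≤ M) :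
    |Real.log x| ≤ 2 * Real.log M - Real.log x := by
  have hM0 := Real.log_nonneg hM
  rcases hx.eq_or_lt with rfl | hx
  · simpa using hM0
  · have := Real.log_le_log hx hxM
    rw [abs_le]
    constructor <;> linarith

/-- For fixed first angle, `log_norm_add_tan` with `τ = sin² (a/2)` evaluates the inner integral as
`2 log |s + sin² (a/2)|`; `log_norm_add_sin_sq` evaluates the outer one. -/
lemma log_norm_sub_limitLaw {s r : ℂ} (hs : 0 ≤ s.re) (hr : r ^ 2 = s ^ 2 + s)
    (hle : ‖1 + 2 * s - 2 * r‖ ≤ ‖1 + 2 * s + 2 * r‖) :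
    Integrable (fun t : ℝ => Real.log ‖s ^ 2 - t‖) limitLaw ∧
      ∫ t : ℝ, Real.log ‖s ^ 2 - t‖ ∂limitLaw =
        2 * Real.log ‖1 + 2 * s + 2 * r‖ - 4 * Real.log 2 := by
  set F : ℝ × ℝ → ℝ := fun p =>
    Real.log ‖s ^ 2 + ((Real.sin (p.1 / 2) ^ 2 * Real.tan (p.2 / 2)) ^ 2 : ℝ)‖ with hF
  have hcomp : (fun t : ℝ => Real.log ‖s ^ 2 - t‖) ∘ cauchyArcsine = F := by
    ext p
    simp only [Function.comp, hF, cauchyArcsine, Complex.ofReal_neg, sub_neg_eq_add]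
  have hFm : Measurable F := hcomp ▸ (measurable_log_norm_sub _).comp measurable_cauchyArcsine
  obtain ⟨hα, hαv⟩ := log_norm_add_sin_sq hr hle
  have hN : (0 : ℝ) ≤ 1 + ‖s ^ 2‖ := by positivity
  -- The majorant `log (1 + ‖s²‖ + tan² (b/2))` does not depend on the first angle and is integrable
  -- by the same formula with `τ = 1`.
  obtain ⟨hM, -⟩ := log_norm_add_tan (s := (√(1 + ‖s ^ 2‖) : ℝ)) (by simp) one_pos
  set M : ℝ → ℝ := fun θ => Real.log
    ‖((√(1 + ‖s ^ 2‖) : ℝ) : ℂ) ^ 2 + ((1 * Real.tan (θ / 2)) ^ 2 : ℝ)‖ with hMdef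
  have hMbound : ∀ a b : ℝ, |F (a, b)| ≤ 2 * M b - F (a, b) := by
    intro a b
    refine abs_log_le _ _ (norm_nonneg _) ?_ ?_
    all_goals
      rw [← Complex.ofReal_pow, Real.sq_sqrt hN, ← Complex.ofReal_add, Complex.norm_real,
        Real.norm_of_nonneg (by positivity), one_mul]
    · nlinarith [norm_nonneg (s ^ 2), sq_nonneg (Real.tan (b / 2))]
    · refine (norm_add_le _ _).trans ?_
      rw [Complex.norm_real, Real.norm_of_nonneg (by positivity)]
      have h1 : Real.sin (a / 2) ^ 2 ≤ 1 := Real.sin_sq_le_one _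
      have : (Real.sin (a / 2) ^ 2 * Real.tan (b / 2)) ^ 2 ≤ Real.tan (b / 2) ^ 2 := by
        rw [mul_pow]
        have h2 : (Real.sin (a / 2) ^ 2) ^ 2 ≤ 1 := pow_le_one₀ (sq_nonneg _) h1
        nlinarith [sq_nonneg (Real.tan (b / 2))]
      linarith
  have hin : ∀ᵐ a ∂uniformAngle, Integrable (fun b => F (a, b)) uniformAngle ∧
      ∫ b, F (a, b) ∂uniformAngle = 2 * Real.log ‖s + (Real.sin (a / 2) ^ 2 : ℝ)‖ := by
    filter_upwards [ae_uniformAngle_sin_pos] with a ha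
    simpa only [hF] using log_norm_add_tan hs ha
  have hint : Integrable F (uniformAngle.prod uniformAngle) := by
    rw [integrable_prod_iff hFm.aestronglyMeasurable]
    refine ⟨hin.mono fun a h => h.1, ?_⟩
    refine Integrable.mono' (g := fun a => 2 * ∫ b, M b ∂uniformAngle -
      2 * Real.log ‖s + (Real.sin (a / 2) ^ 2 : ℝ)‖) ((integrable_const _).sub (hα.const_mul 2))
      (hFm.stronglyMeasurable.norm.integral_prod_right').aestronglyMeasurable ?_
    filter_upwards [hin] with a ha
    rw [Real.norm_of_nonneg (integral_nonneg fun _ => norm_nonneg _), ← ha.2,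
      ← integral_const_mul, ← integral_sub (hM.const_mul 2) ha.1]
    exact integral_mono ha.1.norm ((hM.const_mul 2).sub ha.1) fun b => hMbound a b
  constructor
  · rw [limitLaw, integrable_map_measure (measurable_log_norm_sub _).aestronglyMeasurable
      measurable_cauchyArcsine.aemeasurable, hcomp]
    exact hint
  · rw [limitLaw, integral_map measurable_cauchyArcsine.aemeasurable
      (measurable_log_norm_sub _).aestronglyMeasurable]
    change ∫ p, ((fun t : ℝ => Real.log ‖s ^ 2 - t‖) ∘ cauchyArcsine) p ∂_ = _
    rw [hcomp, integral_prod _ hint, integral_congr_ae (hin.mono fun a h => h.2),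
      integral_const_mul, hαv]
    ring

/-! ### The density of the limit law -/

/-- Cauchy's formula: on the circle the integrand is the real part of `-4ζ/((ζ-a)(ζ-b))`, where `|b|
< 1 < |a|`, and the mean of this is `-4/(b-a) = 1/r`. The strict inequality keeps the poles off the
circle. -/
lemma integral_re_inv_add_sin_sq {s r : ℂ} (hr : r ^ 2 = s ^ 2 + s)
    (hlt : ‖1 + 2 * s - 2 * r‖ < ‖1 + 2 * s + 2 * r‖) :
    IntervalIntegrable (fun θ : ℝ => (1 / (s + (Real.sin (θ / 2) ^ 2 : ℝ))).re)
      volume 0 Real.pi ∧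
    ∫ θ, (1 / (s + (Real.sin (θ / 2) ^ 2 : ℝ))).re ∂uniformAngle = (1 / r).re := by
  set a := 1 + 2 * s + 2 * r with ha
  set b := 1 + 2 * s - 2 * r with hb
  have hab : a * b = 1 := by
    rw [ha, hb]
    linear_combination (-4 : ℂ) * hr
  have hnab : ‖a‖ * ‖b‖ = 1 := by rw [← norm_mul, hab, norm_one]
  have ha1 : 1 < ‖a‖ := by nlinarith [norm_nonneg a, norm_nonneg b]
  have hb1 : ‖b‖ < 1 := by nlinarith [norm_nonneg a, norm_nonneg b]
  have hr0 : r ≠ 0 := by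
    rintro rfl
    simp [ha, hb] at hlt
  have hna : ∀ z ∈ Metric.closedBall (0 : ℂ) |1|, z - a ≠ 0 := by
    intro z hz h
    rw [sub_eq_zero] at h
    subst h
    simp at hz
    linarith
  have hnb : ∀ z ∈ Metric.sphere (0 : ℂ) |1|, z - b ≠ 0 := by
    intro z hz h
    rw [sub_eq_zero] at h
    subst h
    simp at hz
    linarith
  have havg : Real.circleAverage (fun z : ℂ => ((z - 0) / (z - b)) • (-4 / (z - a))) 0 1 =
      -4 / (b - a) := by
    refine circleAverage_sub_sub_inv_smul_of_differentiable_on_off_countable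
      (f := fun z : ℂ => -4 / (z - a)) Set.countable_empty ?_ ?_ ?_
    · exact continuousOn_const.div (continuousOn_id.sub continuousOn_const) hna
    · intro z hz
      exact (differentiableAt_const _).div (differentiableAt_id.sub_const _)
        (hna z (Metric.ball_subset_closedBall hz.1))
    · simpa using hb1
  have hci : CircleIntegrable (fun z : ℂ => ((z - 0) / (z - b)) • (-4 / (z - a))) 0 1 := by
    refine ContinuousOn.circleIntegrable' ?_
    simp only [smul_eq_mul]
    refine ContinuousOn.mul ?_ ?_
    · exact (continuousOn_id.sub continuousOn_const).div
        (continuousOn_id.sub continuousOn_const) hnb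
    · exact continuousOn_const.div (continuousOn_id.sub continuousOn_const)
        fun z hz => hna z (Metric.sphere_subset_closedBall hz)
  have hval : ∀ θ : ℝ, ((circleMap 0 1 θ - 0) / (circleMap 0 1 θ - b)) •
      (-4 / (circleMap 0 1 θ - a)) = 1 / (s + (Real.sin (θ / 2) ^ 2 : ℝ)) := by
    intro θ
    have h1 := hna _ (Metric.sphere_subset_closedBall (circleMap_mem_sphere' 0 1 θ))
    have h2 := hnb _ (circleMap_mem_sphere' 0 1 θ)
    have hz0 : circleMap 0 1 θ ≠ 0 := circleMap_ne_center one_ne_zero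
    have e : (circleMap 0 1 θ - a) * (circleMap 0 1 θ - b) =
        -4 * circleMap 0 1 θ * (s + (Real.sin (θ / 2) ^ 2 : ℝ)) := by
      linear_combination circleMap_quadratic s θ + hab - circleMap 0 1 θ * ha -
        circleMap 0 1 θ * hb
    have h3 : s + (Real.sin (θ / 2) ^ 2 : ℝ) ≠ 0 := by
      intro h
      rw [h, mul_zero] at e
      exact mul_ne_zero h1 h2 e
    rw [smul_eq_mul, sub_zero, div_mul_div_comm, div_eq_div_iff (mul_ne_zero h2 h1) h3]
    linear_combination -e
  have hre := Complex.reCLM.circleAverage_comp_comm hci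
  rw [havg, Real.circleAverage_def] at hre
  have hL : ∀ θ : ℝ, (Complex.reCLM ∘ fun z : ℂ => ((z - 0) / (z - b)) • (-4 / (z - a)))
      (circleMap 0 1 θ) = (1 / (s + (Real.sin (θ / 2) ^ 2 : ℝ))).re := by
    intro θ
    rw [Function.comp_apply, hval θ, Complex.reCLM_apply]
  simp only [hL] at hre
  have hba : -4 / (b - a) = 1 / r := by
    rw [ha, hb]
    field_simp
    ring_nf
    field_simp
  rw [hba, Complex.reCLM_apply, smul_eq_mul] at hre
  set L : ℝ → ℝ := fun θ => (1 / (s + (Real.sin (θ / 2) ^ 2 : ℝ))).re with hLdef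
  have hper : L.Periodic (2 * Real.pi) := fun x => by
    rw [hLdef]
    dsimp only
    rw [show (x + 2 * Real.pi) / 2 = x / 2 + Real.pi by ring, Real.sin_add_pi, neg_sq]
  have hLint : IntervalIntegrable L volume 0 (2 * Real.pi) := by
    have hci' : IntervalIntegrable (fun θ : ℝ => ((circleMap 0 1 θ - 0) / (circleMap 0 1 θ - b)) •
      (-4 / (circleMap 0 1 θ - a))) volume 0 (2 * Real.pi) := hci
    simp only [hval] at hci'
    rw [intervalIntegrable_iff] at hci' ⊢
    exact hci'.re
  have hLint' := hper.intervalIntegrable₀ (by have := Real.pi_pos; positivity) hLint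
    (-Real.pi) Real.pi
  have hsymm := (integral_symm_add hLint').2
  have hshift := hper.intervalIntegral_add_eq (-Real.pi) 0
  rw [show -Real.pi + 2 * Real.pi = Real.pi by ring, zero_add] at hshift
  have heven : ∀ θ, L θ + L (-θ) = 2 * L θ := fun θ => by
    rw [hLdef]
    dsimp only
    rw [neg_div, Real.sin_neg, neg_sq]
    ring
  simp only [heven] at hsymm
  rw [intervalIntegral.integral_const_mul, hshift] at hsymm
  refine ⟨hper.intervalIntegrable₀ (by have := Real.pi_pos; positivity) hLint _ _, ?_⟩
  rw [integral_uniformAngle, ← hre, ← hsymm]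
  field_simp
  rfl

/-- The integrand is the real part of `1/(iρ + sin² (θ/2))`, so the previous lemma applies with `s =
iρ`. -/
lemma integral_sin_sq_div {ρ : ℝ} (hρ : 0 < ρ) :
    Integrable (fun θ => Real.sin (θ / 2) ^ 2 / (ρ ^ 2 + (Real.sin (θ / 2) ^ 2) ^ 2))
      uniformAngle ∧
    ∫ θ, Real.sin (θ / 2) ^ 2 / (ρ ^ 2 + (Real.sin (θ / 2) ^ 2) ^ 2) ∂uniformAngle =
      1 / (√2 * √ρ * √(1 + ρ ^ 2) * √(ρ + √(1 + ρ ^ 2))) := by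
  set w := √(1 + ρ ^ 2) with hw
  have hw2 : w ^ 2 = 1 + ρ ^ 2 := Real.sq_sqrt (by positivity)
  have hw0 : 0 < w := Real.sqrt_pos.mpr (by positivity)
  set g := √(ρ + w) with hg
  have hg2 : g ^ 2 = ρ + w := Real.sq_sqrt (by positivity)
  have hg0 : 0 < g := Real.sqrt_pos.mpr (by positivity)
  set h := √ρ with hh
  have hh2 : h ^ 2 = ρ := Real.sq_sqrt hρ.le
  have hh0 : 0 < h := Real.sqrt_pos.mpr hρ
  set c := √(2 : ℝ) with hc
  have hc2 : c ^ 2 = 2 := Real.sq_sqrt (by norm_num)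
  have hc0 : 0 < c := Real.sqrt_pos.mpr (by norm_num)
  -- `u + iv` is the square root of `-ρ² + iρ` in the first quadrant; its squared modulus is `ρ
  -- √(1+ρ²)`.
  set u := h / (c * g) with hu
  set v := h * g / c with hv
  have hu0 : 0 < u := by positivity
  have hv0 : 0 < v := by positivity
  have huv : 2 * (u * v) = ρ := by
    rw [hu, hv]
    field_simp
    rw [hh2, hc2]
  have hv2 : v ^ 2 = ρ * (ρ + w) / 2 := by rw [hv, div_pow, mul_pow, hh2, hg2, hc2]
  have hu2 : u ^ 2 = ρ * (w - ρ) / 2 := by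
    rw [hu, div_pow, mul_pow, hh2, hg2, hc2]
    field_simp
    linear_combination -hw2
  have hr : (⟨u, v⟩ : ℂ) ^ 2 = (⟨0, ρ⟩ : ℂ) ^ 2 + ⟨0, ρ⟩ := by
    apply Complex.ext
    · simp [sq]
      nlinarith
    · simp [sq]
      linarith
  have hlt : ‖(1 : ℂ) + 2 * ⟨0, ρ⟩ - 2 * ⟨u, v⟩‖ < ‖(1 : ℂ) + 2 * ⟨0, ρ⟩ + 2 * ⟨u, v⟩‖ := by
    rw [← sq_lt_sq₀ (norm_nonneg _) (norm_nonneg _), Complex.sq_norm, Complex.sq_norm,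
      Complex.normSq_apply, Complex.normSq_apply]
    simp
    nlinarith [mul_pos hρ hv0]
  obtain ⟨h1, h2⟩ := integral_re_inv_add_sin_sq hr hlt
  have e : ∀ θ : ℝ, (1 / ((⟨0, ρ⟩ : ℂ) + (Real.sin (θ / 2) ^ 2 : ℝ))).re =
      Real.sin (θ / 2) ^ 2 / (ρ ^ 2 + (Real.sin (θ / 2) ^ 2) ^ 2) := by
    intro θ
    rw [one_div, Complex.inv_re, Complex.normSq_apply, Complex.add_re, Complex.add_im,
      Complex.ofReal_re, Complex.ofReal_im]
    simp only [zero_add, add_zero]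
    congr 1
    ring
  simp only [e] at h1 h2
  refine ⟨integrable_uniformAngle h1, ?_⟩
  rw [h2, one_div, Complex.inv_re, Complex.normSq_apply]
  have hsum : u * u + v * v = ρ * w := by nlinarith
  change u / (u * u + v * v) = _
  rw [hsum, hu, ← hh2]
  field_simp

/-- The density, on the negative half-line, of `-(τ * tan (β / 2)) ^ 2` for `β` uniform. -/
def halfCauchyDensity (τ t : ℝ) : ℝ := Real.pi⁻¹ * (√(-t))⁻¹ * (τ / (-t + τ ^ 2))

/-- Change of variables `t = -(τ tan (θ/2))²`, on the open interval only: at `θ = π` the tangent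
takes the default value `0`, but a point is null. -/
lemma uniformAngle_preimage {τ : ℝ} (hτ : 0 < τ) {A : Set ℝ} (hA : MeasurableSet A) :
    uniformAngle {θ | -(τ * Real.tan (θ / 2)) ^ 2 ∈ A} =
      ∫⁻ t in Set.Iio 0, A.indicator 1 t * ENNReal.ofReal (halfCauchyDensity τ t) := by
  set g : ℝ → ℝ := fun θ => -(τ * Real.tan (θ / 2)) ^ 2 with hg
  have hgm : Measurable g :=
    ((measurable_const.mul (measurable_real_tan.comp (measurable_id.div_const 2))).pow_const 2).neg
  have hmem : ∀ θ ∈ Set.Ioo 0 Real.pi, θ / 2 ∈ Set.Ioo (-(Real.pi / 2)) (Real.pi / 2) :=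
    fun θ hθ => ⟨by linarith [hθ.1, hθ.2], by linarith [hθ.2]⟩
  have htan : ∀ θ ∈ Set.Ioo 0 Real.pi, 0 < Real.tan (θ / 2) := fun θ hθ =>
    Real.tan_pos_of_pos_of_lt_pi_div_two (by linarith [hθ.1]) (by linarith [hθ.2])
  have himg : g '' Set.Ioo 0 Real.pi = Set.Iio 0 := by
    ext t
    constructor
    · rintro ⟨θ, hθ, rfl⟩
      have := htan θ hθ
      simp only [hg, Set.mem_Iio, neg_neg_iff_pos]
      positivity
    · intro ht
      have ht' : 0 < -t := neg_pos.mpr ht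
      refine ⟨2 * Real.arctan (√(-t) / τ), ⟨?_, ?_⟩, ?_⟩
      · have : 0 < Real.arctan (√(-t) / τ) := Real.arctan_pos.mpr (by positivity)
        linarith
      · linarith [Real.arctan_lt_pi_div_two (√(-t) / τ)]
      · simp only [hg]
        rw [mul_div_cancel_left₀ _ two_ne_zero, Real.tan_arctan, mul_div_cancel₀ _ hτ.ne',
          Real.sq_sqrt ht'.le, neg_neg]
  have hinj : Set.InjOn g (Set.Ioo 0 Real.pi) := by
    intro x hx y hy hxy
    have h1 : (τ * Real.tan (x / 2)) ^ 2 = (τ * Real.tan (y / 2)) ^ 2 := neg_injective hxy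
    have hx' := htan x hx
    have hy' := htan y hy
    rw [sq_eq_sq₀ (by positivity) (by positivity)] at h1
    have h2 := Real.injOn_tan (hmem x hx) (hmem y hy) (mul_left_cancel₀ hτ.ne' h1)
    linarith
  have hderiv : ∀ θ ∈ Set.Ioo 0 Real.pi, HasDerivWithinAt g
      (-(τ ^ 2 * Real.tan (θ / 2) * (1 + Real.tan (θ / 2) ^ 2))) (Set.Ioo 0 Real.pi) θ := by
    intro θ hθ
    have hc := Real.cos_pos_of_mem_Ioo (hmem θ hθ)
    have h1 := (Real.hasDerivAt_tan hc.ne').comp θ ((hasDerivAt_id θ).div_const 2)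
    have h2 := ((h1.const_mul τ).pow 2).neg
    refine (h2.congr_deriv ?_).hasDerivWithinAt
    have hk : 1 + Real.tan (θ / 2) ^ 2 = 1 / Real.cos (θ / 2) ^ 2 := by
      rw [← Real.inv_one_add_tan_sq hc.ne', one_div, inv_inv]
    simp only [Function.comp, id]
    rw [hk]
    norm_num
    ring
  have hcov := lintegral_image_eq_lintegral_abs_deriv_mul measurableSet_Ioo hderiv hinj
    (fun t => A.indicator 1 t * ENNReal.ofReal (halfCauchyDensity τ t))
  rw [himg] at hcov
  rw [hcov]
  have hpt : ∀ θ ∈ Set.Ioo 0 Real.pi,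
      ENNReal.ofReal |-(τ ^ 2 * Real.tan (θ / 2) * (1 + Real.tan (θ / 2) ^ 2))| *
        (A.indicator 1 (g θ) * ENNReal.ofReal (halfCauchyDensity τ (g θ))) =
      ENNReal.ofReal Real.pi⁻¹ * (g ⁻¹' A).indicator 1 θ := by
    intro θ hθ
    have ht := htan θ hθ
    have hpi := Real.pi_pos
    have hind : A.indicator (1 : ℝ → ℝ≥0∞) (g θ) = (g ⁻¹' A).indicator 1 θ := rfl
    rw [hind, abs_neg, abs_of_pos (by positivity), mul_left_comm, ← ENNReal.ofReal_mul (by positivity),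
      mul_comm]
    congr 2
    simp only [hg, halfCauchyDensity, neg_neg]
    rw [Real.sqrt_sq (by positivity)]
    field_simp
    ring
  rw [setLIntegral_congr_fun measurableSet_Ioo hpt, lintegral_const_mul _
    (measurable_one.indicator (hgm hA)), lintegral_indicator_one (hgm hA), uniformAngle,
    Measure.smul_apply, smul_eq_mul, Measure.restrict_congr_set Ioo_ae_eq_Ioc]
  rfl

lemma measurable_halfCauchyDensity : Measurable fun p : ℝ × ℝ => halfCauchyDensity p.1 p.2 := by
  unfold halfCauchyDensity
  fun_prop

lemma integral_halfCauchyDensity {t : ℝ} (ht : t < 0) :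
    Integrable (fun θ => halfCauchyDensity (Real.sin (θ / 2) ^ 2) t) uniformAngle ∧
    ∫ θ, halfCauchyDensity (Real.sin (θ / 2) ^ 2) t ∂uniformAngle = muDensity t := by
  have ht' : 0 < -t := neg_pos.mpr ht
  have hρ : 0 < √(-t) := Real.sqrt_pos.mpr ht'
  obtain ⟨h1, h2⟩ := integral_sin_sq_div hρ
  rw [Real.sq_sqrt ht'.le] at h1 h2
  refine ⟨h1.const_mul _, ?_⟩
  unfold halfCauchyDensity
  rw [integral_const_mul, h2, muDensity, abs_of_neg ht,
    show (3 / 4 : ℝ) = 1 / 2 + 1 / 4 by norm_num, Real.rpow_add ht', ← Real.sqrt_eq_rpow,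
    ← Real.sqrt_eq_rpow, ← Real.sqrt_eq_rpow, show (1 / 4 : ℝ) = 1 / 2 * (1 / 2) by norm_num,
    Real.rpow_mul ht'.le, ← Real.sqrt_eq_rpow, ← Real.sqrt_eq_rpow]
  have := Real.pi_pos
  field_simp

/-- Conditionally on the first angle the law has a half-Cauchy type density; Tonelli averages these
densities, and `integral_halfCauchyDensity` evaluates the average. -/
lemma limitLaw_eq : limitLaw =
    (volume.restrict (Set.Iic 0)).withDensity fun x => ENNReal.ofReal (muDensity x) := by
  ext A hA
  have hA' : Measurable (A.indicator (1 : ℝ → ℝ≥0∞)) := measurable_one.indicator hA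
  rw [limitLaw, Measure.map_apply measurable_cauchyArcsine hA,
    Measure.prod_apply (measurable_cauchyArcsine hA)]
  have h1 : ∀ᵐ a ∂uniformAngle, uniformAngle (Prod.mk a ⁻¹' (cauchyArcsine ⁻¹' A)) =
      ∫⁻ t in Set.Iio 0, A.indicator 1 t *
        ENNReal.ofReal (halfCauchyDensity (Real.sin (a / 2) ^ 2) t) := by
    filter_upwards [ae_uniformAngle_sin_pos] with a ha
    exact uniformAngle_preimage ha hA
  rw [lintegral_congr_ae h1, lintegral_lintegral_swap]
  · have h2 : ∀ t ∈ Set.Iio (0 : ℝ), ∫⁻ a, A.indicator 1 t *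
        ENNReal.ofReal (halfCauchyDensity (Real.sin (a / 2) ^ 2) t) ∂uniformAngle =
        A.indicator (fun x => ENNReal.ofReal (muDensity x)) t := by
      intro t ht
      obtain ⟨hi, hv⟩ := integral_halfCauchyDensity ht
      rw [lintegral_const_mul' _ _ (by by_cases h : t ∈ A <;> simp [h]),
        ← ofReal_integral_eq_lintegral_ofReal hi, hv]
      · by_cases h : t ∈ A <;> simp [h]
      · refine .of_forall fun a => ?_
        have := Real.pi_pos
        have : 0 < -t := neg_pos.mpr ht
        unfold halfCauchyDensity
        positivity
    rw [setLIntegral_congr_fun measurableSet_Iio h2, lintegral_indicator hA,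
      Measure.restrict_congr_set Iio_ae_eq_Iic, withDensity_apply _ hA]
  · refine Measurable.aemeasurable ?_
    refine (hA'.comp measurable_snd).mul (ENNReal.measurable_ofReal.comp ?_)
    have hsin : Measurable fun p : ℝ × ℝ => Real.sin (p.1 / 2) ^ 2 :=
      (Real.measurable_sin.comp (measurable_fst.div_const 2)).pow_const 2
    exact measurable_halfCauchyDensity.comp (hsin.prodMk measurable_snd)

/-! ### Weak convergence on `[-1, 1]` from convergence of logarithmic integrals -/

lemma integrable_of_continuousOn_Icc {ρ : Measure ℝ} [IsFiniteMeasure ρ] {a b : ℝ}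
    (hρ : ρ (Set.Icc a b)ᶜ = 0) {g : ℝ → ℝ} (hg : ContinuousOn g (Set.Icc a b)) :
    Integrable g ρ := by
  have h := hg.integrableOn_compact (μ := ρ) isCompact_Icc
  rwa [IntegrableOn, Measure.restrict_eq_self_of_ae_mem (by rwa [ae_iff])] at h

lemma abs_integral_sub_le {ρ : Measure ℝ} [IsProbabilityMeasure ρ] {a b ε : ℝ}
    (hρ : ρ (Set.Icc a b)ᶜ = 0) {g g' : ℝ → ℝ} (hg : ContinuousOn g (Set.Icc a b))
    (hg' : ContinuousOn g' (Set.Icc a b)) (h : ∀ x ∈ Set.Icc a b, |g x - g' x| ≤ ε) :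
    |∫ x, g x ∂ρ - ∫ x, g' x ∂ρ| ≤ ε := by
  rw [← integral_sub (integrable_of_continuousOn_Icc hρ hg) (integrable_of_continuousOn_Icc hρ hg')]
  have hae : ∀ᵐ x ∂ρ, ‖g x - g' x‖ ≤ ε := by
    have : ∀ᵐ x ∂ρ, x ∈ Set.Icc a b := by rwa [ae_iff]
    filter_upwards [this] with x hx
    exact h x hx
  simpa using norm_integral_le_of_norm_le_const hae

lemma tendsto_integral_of_approx {ρ : ℕ → Measure ℝ} {ρ' : Measure ℝ}
    [∀ n, IsProbabilityMeasure (ρ n)] [IsProbabilityMeasure ρ'] {a b : ℝ}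
    (hρ : ∀ n, ρ n (Set.Icc a b)ᶜ = 0) (hρ' : ρ' (Set.Icc a b)ᶜ = 0) {g : ℝ → ℝ}
    (hg : ContinuousOn g (Set.Icc a b))
    (h : ∀ ε > 0, ∃ g' : ℝ → ℝ, ContinuousOn g' (Set.Icc a b) ∧
      Tendsto (fun n => ∫ x, g' x ∂(ρ n)) atTop (𝓝 (∫ x, g' x ∂ρ')) ∧
      ∀ x ∈ Set.Icc a b, |g x - g' x| ≤ ε) :
    Tendsto (fun n => ∫ x, g x ∂(ρ n)) atTop (𝓝 (∫ x, g x ∂ρ')) := by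
  rw [Metric.tendsto_atTop]
  intro ε hε
  obtain ⟨g', hg', ht, hgg⟩ := h (ε / 4) (by positivity)
  obtain ⟨N, hN⟩ := Metric.tendsto_atTop.mp ht (ε / 4) (by positivity)
  refine ⟨N, fun n hn => ?_⟩
  have h1 := abs_integral_sub_le (hρ n) hg hg' hgg
  have h2 := abs_integral_sub_le hρ' hg hg' hgg
  have h3 := hN n hn
  rw [Real.dist_eq] at h3 ⊢
  rw [abs_le] at h1 h2
  rw [abs_lt] at h3 ⊢
  constructor <;> linarith [h1.1, h1.2, h2.1, h2.2, h3.1, h3.2]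

lemma tendsto_integral_of_tendsto_moments {ρ : ℕ → Measure ℝ} {ρ' : Measure ℝ}
    [∀ n, IsProbabilityMeasure (ρ n)] [IsProbabilityMeasure ρ']
    (hρ : ∀ n, ρ n (Set.Icc (-1) 1)ᶜ = 0) (hρ' : ρ' (Set.Icc (-1) 1)ᶜ = 0)
    (hmom : ∀ k : ℕ, Tendsto (fun n => ∫ x, x ^ k ∂(ρ n)) atTop (𝓝 (∫ x, x ^ k ∂ρ')))
    {g : ℝ → ℝ} (hg : ContinuousOn g (Set.Icc (-1) 1)) :
    Tendsto (fun n => ∫ x, g x ∂(ρ n)) atTop (𝓝 (∫ x, g x ∂ρ')) := by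
  have hint : ∀ k : ℕ, (∀ n, Integrable (fun x : ℝ => x ^ k) (ρ n)) ∧
      Integrable (fun x : ℝ => x ^ k) ρ' := fun k =>
    ⟨fun n => integrable_of_continuousOn_Icc (hρ n) (continuousOn_pow k),
      integrable_of_continuousOn_Icc hρ' (continuousOn_pow k)⟩
  refine tendsto_integral_of_approx hρ hρ' hg fun ε hε => ?_
  obtain ⟨p, hp⟩ := exists_polynomial_near_of_continuousOn (-1) 1 g hg ε hε
  refine ⟨fun x => p.eval x, p.continuousOn, ?_, fun x hx => ?_⟩
  · have e : ∀ (σ : Measure ℝ), (∀ k : ℕ, Integrable (fun x : ℝ => x ^ k) σ) →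
        ∫ x, p.eval x ∂σ = ∑ i ∈ Finset.range (p.natDegree + 1), p.coeff i * ∫ x, x ^ i ∂σ := by
      intro σ hσ
      simp only [eval_eq_sum_range]
      rw [integral_finsetSum _ fun i _ => (hσ i).const_mul _]
      simp only [integral_const_mul]
    rw [e ρ' fun k => (hint k).2]
    simp only [fun n => e (ρ n) fun k => (hint k).1 n]
    exact tendsto_finsetSum _ fun i _ => (hmom i).const_mul _
  · rw [abs_sub_comm]
    exact (hp x hx).le

lemma mul_mem_Ioo_of_mem_Icc {c x : ℝ} (hc0 : 0 < c) (hc : c < 1) (hx : x ∈ Set.Icc (-1 : ℝ) 1) :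
    |c * x| ≤ c ∧ 0 < 1 - c * x := by
  have h : |c * x| ≤ c := by
    rw [abs_mul, abs_of_pos hc0]
    exact mul_le_of_le_one_right hc0.le (abs_le.mpr hx)
  exact ⟨h, by linarith [le_abs_self (c * x)]⟩

lemma continuousOn_log_one_sub {c : ℝ} (hc0 : 0 < c) (hc : c < 1) :
    ContinuousOn (fun x => Real.log (1 - c * x)) (Set.Icc (-1) 1) :=
  ContinuousOn.log (by fun_prop) fun x hx => (mul_mem_Ioo_of_mem_Icc hc0 hc hx).2.ne'

/-- In the Taylor series of `log (1 - c x)`, once the first `m` moments converge, the next one is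
isolated by dividing by `c^(m+1)`, with an error `O(c)` uniform in the measure. Strong induction
gives all moments. -/
lemma tendsto_integral_of_tendsto_log {ρ : ℕ → Measure ℝ} {ρ' : Measure ℝ}
    [∀ n, IsProbabilityMeasure (ρ n)] [IsProbabilityMeasure ρ']
    (hρ : ∀ n, ρ n (Set.Icc (-1) 1)ᶜ = 0) (hρ' : ρ' (Set.Icc (-1) 1)ᶜ = 0)
    (hlog : ∀ c : ℝ, 0 < c → c < 1 → Tendsto (fun n => ∫ x, Real.log (1 - c * x) ∂(ρ n)) atTop
      (𝓝 (∫ x, Real.log (1 - c * x) ∂ρ')))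
    {g : ℝ → ℝ} (hg : ContinuousOn g (Set.Icc (-1) 1)) :
    Tendsto (fun n => ∫ x, g x ∂(ρ n)) atTop (𝓝 (∫ x, g x ∂ρ')) := by
  have hmom : ∀ k : ℕ, Tendsto (fun n => ∫ x, x ^ k ∂(ρ n)) atTop (𝓝 (∫ x, x ^ k ∂ρ')) := by
    intro k
    induction k using Nat.strong_induction_on with
    | _ k ih =>
      rcases k with _ | m
      · simp
      refine tendsto_integral_of_approx hρ hρ' (continuousOn_pow _) fun ε hε => ?_
      -- The Taylor remainder is at most `c^(m+2)/(1-c)`; with `c ≤ 1/2`, after multiplication by `A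
      -- = (m+1)/c^(m+1)` the error is at most `2(m+1)c ≤ ε`.
      set c : ℝ := min (1 / 2) (ε / (2 * (m + 1))) with hc
      have hc0 : 0 < c := lt_min (by norm_num) (by positivity)
      have hc2 : c ≤ 1 / 2 := min_le_left _ _
      have hcε : c * (2 * (m + 1)) ≤ ε := (le_div_iff₀ (by positivity)).mp (min_le_right _ _)
      have hc1 : c < 1 := by linarith
      set A : ℝ := (m + 1) / c ^ (m + 1) with hA
      have hA0 : 0 < A := by positivity
      refine ⟨fun x => -A * (Real.log (1 - c * x) +
        ∑ i ∈ Finset.range m, c ^ (i + 1) / (i + 1) * x ^ (i + 1)), ?_, ?_, ?_⟩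
      · exact continuousOn_const.mul ((continuousOn_log_one_sub hc0 hc1).add (by fun_prop))
      · have e : ∀ (σ : Measure ℝ) [IsProbabilityMeasure σ], σ (Set.Icc (-1) 1)ᶜ = 0 →
            ∫ x, -A * (Real.log (1 - c * x) +
              ∑ i ∈ Finset.range m, c ^ (i + 1) / (i + 1) * x ^ (i + 1)) ∂σ =
            -A * (∫ x, Real.log (1 - c * x) ∂σ +
              ∑ i ∈ Finset.range m, c ^ (i + 1) / (i + 1) * ∫ x, x ^ (i + 1) ∂σ) := by
          intro σ _ hσ
          have hi : ∀ i ∈ Finset.range m,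
              Integrable (fun x : ℝ => c ^ (i + 1) / (i + 1) * x ^ (i + 1)) σ := fun i _ =>
            integrable_of_continuousOn_Icc hσ (by fun_prop)
          rw [integral_const_mul, integral_add
            (integrable_of_continuousOn_Icc hσ (continuousOn_log_one_sub hc0 hc1))
            (integrable_finsetSum _ hi), integral_finsetSum _ hi]
          simp only [integral_const_mul]
        rw [e ρ' hρ']
        simp only [fun n => e (ρ n) (hρ n)]
        refine ((hlog c hc0 hc1).add (tendsto_finsetSum _ fun i hi => ?_)).const_mul _
        exact (ih (i + 1) (by simpa using hi)).const_mul _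
      · intro x hx
        obtain ⟨h1, h2⟩ := mul_mem_Ioo_of_mem_Icc hc0 hc1 hx
        have hT := Real.abs_log_sub_add_sum_range_le (x := c * x) (by linarith) (m + 1)
        rw [Finset.sum_range_succ] at hT
        have e : x ^ (m + 1) - -A * (Real.log (1 - c * x) +
            ∑ i ∈ Finset.range m, c ^ (i + 1) / (i + 1) * x ^ (i + 1)) =
            A * (∑ i ∈ Finset.range m, (c * x) ^ (i + 1) / (i + 1) +
              (c * x) ^ (m + 1) / (m + 1) + Real.log (1 - c * x)) := by
          have e1 : A * ((c * x) ^ (m + 1) / (m + 1)) = x ^ (m + 1) := by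
            rw [hA, mul_pow]
            field_simp
          have e2 : ∑ i ∈ Finset.range m, (c * x) ^ (i + 1) / (i + 1) =
              ∑ i ∈ Finset.range m, c ^ (i + 1) / (i + 1) * x ^ (i + 1) :=
            Finset.sum_congr rfl fun i _ => by rw [mul_pow]; ring
          rw [e2, ← e1]
          ring
        rw [e, abs_mul, abs_of_pos hA0]
        calc A * _ ≤ A * (|c * x| ^ (m + 1 + 1) / (1 - |c * x|)) :=
              mul_le_mul_of_nonneg_left hT hA0.le
          _ ≤ A * (c ^ (m + 1 + 1) / (1 / 2)) := by
              gcongr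
              linarith
          _ = c * (2 * (m + 1)) := by
              rw [hA]
              field_simp
              ring
          _ ≤ ε := hcε
  exact tendsto_integral_of_tendsto_moments hρ hρ' hmom hg

/-! ### Test functions that are only continuous on `(-1, 1]` -/

/-- A continuous cutoff that vanishes on `(-∞, -1 + 1 / (k + 1)]`. -/
def cutoff (k : ℕ) (x : ℝ) : ℝ := max 0 (min 1 ((x + 1) * (k + 1) - 1))

lemma continuous_cutoff (k : ℕ) : Continuous (cutoff k) := by
  unfold cutoff
  fun_prop

lemma cutoff_mem (k : ℕ) (x : ℝ) : 0 ≤ cutoff k x ∧ cutoff k x ≤ 1 :=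
  ⟨le_max_left _ _, max_le zero_le_one (min_le_left _ _)⟩

lemma tendsto_cutoff {x : ℝ} (hx : -1 < x) : Tendsto (fun k => cutoff k x) atTop (𝓝 1) := by
  refine tendsto_const_nhds.congr' ?_
  obtain ⟨N, hN⟩ := exists_nat_gt (2 / (x + 1))
  have hx' : 0 < x + 1 := by linarith
  filter_upwards [eventually_ge_atTop N] with k hk
  have hk' : (N : ℝ) ≤ k := by exact_mod_cast hk
  have : 2 ≤ (x + 1) * (k + 1) := by
    rw [div_lt_iff₀ hx'] at hN
    nlinarith
  rw [cutoff, min_eq_left (by linarith), max_eq_right zero_le_one]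

/-- Where the maximum changes `x` the cutoff vanishes. On the left `F` is evaluated away from `-1`,
which makes the product continuous on the closed segment. -/
lemma mul_cutoff_eq (F : ℝ → ℝ) (k : ℕ) (x : ℝ) :
    F (max x (-1 + 1 / (k + 1))) * cutoff k x = F x * cutoff k x := by
  rcases le_total (-1 + 1 / ((k : ℝ) + 1)) x with h | h
  · rw [max_eq_left h]
  · have h1 : (x + 1) * ((k : ℝ) + 1) ≤ 1 :=
      (le_div_iff₀ (by positivity)).mp (by linarith)
    have : cutoff k x = 0 := by
      rw [cutoff, max_eq_left]
      exact (min_le_right _ _).trans (by linarith)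
    rw [this, mul_zero, mul_zero]

lemma continuousOn_mul_cutoff {F : ℝ → ℝ} (hF : ContinuousOn F (Set.Ioc (-1) 1)) (k : ℕ) :
    ContinuousOn (fun x => F x * cutoff k x) (Set.Icc (-1) 1) := by
  simp only [← mul_cutoff_eq F k]
  refine ContinuousOn.mul (hF.comp (by fun_prop) fun x hx => ?_)
    (continuous_cutoff k).continuousOn
  have h1 : (0 : ℝ) < 1 / (k + 1) := by positivity
  have h2 : 1 / ((k : ℝ) + 1) ≤ 1 := (div_le_one (by positivity)).mpr (by simp)
  exact ⟨(by linarith : (-1 : ℝ) < -1 + 1 / (k + 1)).trans_le (le_max_right _ _),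
    max_le hx.2 (by linarith)⟩

/-- The error from cutting off near `-1` is at most `C (1 - ∫ cutoff)`. This is the integral of a
continuous function, so it converges to its value for the limit measure, which is small because `-1`
is no atom. -/
lemma tendsto_integral_of_continuousOn_Ioc {ρ : ℕ → Measure ℝ} {ρ' : Measure ℝ}
    [∀ n, IsProbabilityMeasure (ρ n)] [IsProbabilityMeasure ρ']
    (hconv : ∀ g : ℝ → ℝ, ContinuousOn g (Set.Icc (-1) 1) →
      Tendsto (fun n => ∫ x, g x ∂(ρ n)) atTop (𝓝 (∫ x, g x ∂ρ')))
    (h0 : ∀ᵐ x ∂ρ', -1 < x) {F : ℝ → ℝ} (hFm : Measurable F)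
    (hF : ContinuousOn F (Set.Ioc (-1) 1)) {C : ℝ} (hC : ∀ x, |F x| ≤ C) :
    Tendsto (fun n => ∫ x, F x ∂(ρ n)) atTop (𝓝 (∫ x, F x ∂ρ')) := by
  have hC0 : 0 ≤ C := (abs_nonneg _).trans (hC 0)
  have hmeas : ∀ k, Measurable (cutoff k) := fun k => (continuous_cutoff k).measurable
  have hcut : ∀ (σ : Measure ℝ) [IsProbabilityMeasure σ] (k : ℕ), Integrable (cutoff k) σ :=
    fun σ _ k => Integrable.of_bound (hmeas k).aestronglyMeasurable 1 (.of_forall fun x => by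
      rw [Real.norm_of_nonneg (cutoff_mem k x).1]; exact (cutoff_mem k x).2)
  have hFi : ∀ (σ : Measure ℝ) [IsProbabilityMeasure σ], Integrable F σ :=
    fun σ _ => Integrable.of_bound hFm.aestronglyMeasurable C (.of_forall hC)
  have hFci : ∀ (σ : Measure ℝ) [IsProbabilityMeasure σ] (k : ℕ),
      Integrable (fun x => F x * cutoff k x) σ := fun σ _ k =>
    (hcut σ k).bdd_mul hFm.aestronglyMeasurable (.of_forall hC)
  have hdiff : ∀ (σ : Measure ℝ) [IsProbabilityMeasure σ] (k : ℕ),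
      |∫ x, F x ∂σ - ∫ x, F x * cutoff k x ∂σ| ≤ C * (1 - ∫ x, cutoff k x ∂σ) := by
    intro σ _ k
    rw [← integral_sub (hFi σ) (hFci σ k)]
    have e : C * (1 - ∫ x, cutoff k x ∂σ) = ∫ x, C * (1 - cutoff k x) ∂σ := by
      rw [integral_const_mul, integral_sub (integrable_const _) (hcut σ k)]
      simp
    rw [e]
    rw [← Real.norm_eq_abs]
    refine norm_integral_le_of_norm_le (((integrable_const _).sub (hcut σ k)).const_mul C)
      (.of_forall fun x => ?_)
    obtain ⟨h1, h2⟩ := cutoff_mem k x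
    rw [Real.norm_eq_abs, ← mul_one_sub, abs_mul, abs_of_nonneg (sub_nonneg.mpr h2)]
    exact mul_le_mul_of_nonneg_right (hC x) (sub_nonneg.mpr h2)
  have hlim : Tendsto (fun k => C * (1 - ∫ x, cutoff k x ∂ρ')) atTop (𝓝 0) := by
    have : Tendsto (fun k => ∫ x, cutoff k x ∂ρ') atTop (𝓝 (∫ _, (1 : ℝ) ∂ρ')) := by
      refine tendsto_integral_of_dominated_convergence (fun _ => 1)
        (fun k => (hmeas k).aestronglyMeasurable) (integrable_const _) (fun k => .of_forall
        fun x => ?_) (h0.mono fun x hx => tendsto_cutoff hx)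
      rw [Real.norm_of_nonneg (cutoff_mem k x).1]
      exact (cutoff_mem k x).2
    have h2 := (tendsto_const_nhds (x := (1 : ℝ))).sub this |>.const_mul C
    simpa using h2
  rw [Metric.tendsto_atTop]
  intro ε hε
  obtain ⟨k, hk⟩ := (hlim.eventually_lt_const (show (0 : ℝ) < ε / 4 by positivity)).exists
  have h1 := ((hconv (cutoff k) (continuous_cutoff k).continuousOn).const_sub 1).const_mul C
  have h2 := hconv _ (continuousOn_mul_cutoff hF k)
  obtain ⟨N1, hN1⟩ := eventually_atTop.mp (h1.eventually_lt_const hk)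
  obtain ⟨N2, hN2⟩ := Metric.tendsto_atTop.mp h2 (ε / 4) (by positivity)
  refine ⟨max N1 N2, fun n hn => ?_⟩
  have a1 := hN1 n ((le_max_left _ _).trans hn)
  have a2 := hN2 n ((le_max_right _ _).trans hn)
  have a3 := hdiff (ρ n) k
  have a4 := hdiff ρ' k
  rw [Real.dist_eq] at a2 ⊢
  rw [abs_lt] at a2 ⊢
  rw [abs_le] at a3 a4
  constructor <;> linarith [a2.1, a2.2, a3.1, a3.2, a4.1, a4.2]

/-! ### Zero counting measures -/

lemma integral_zeroCountingMeasure (p : ℂ[X]) (f : ℂ → ℝ) :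
    ∫ z, f z ∂(zeroCountingMeasure p) = (p.natDegree : ℝ)⁻¹ * (p.roots.map f).sum := by
  have h : ∀ s : Multiset ℂ, Integrable f (s.map fun z => Measure.dirac z).sum ∧
      ∫ z, f z ∂(s.map fun z => Measure.dirac z).sum = (s.map f).sum := by
    intro s
    induction s using Multiset.induction with
    | empty => simp
    | cons a s ih =>
      have ha : Integrable f (Measure.dirac a) := integrable_dirac (by simp)
      simp only [Multiset.map_cons, Multiset.sum_cons]
      exact ⟨ha.add_measure ih.1, by rw [integral_add_measure ha ih.1, integral_dirac, ih.2]⟩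
  rw [zeroCountingMeasure, integral_smul_measure, (h _).2, smul_eq_mul]
  simp

lemma zeroCountingMeasure_apply (p : ℂ[X]) {s : Set ℂ} (hs : ∀ z ∈ p.roots, z ∉ s) :
    zeroCountingMeasure p s = 0 := by
  have h : ∀ r : Multiset ℂ, (∀ z ∈ r, z ∉ s) → (r.map fun z => Measure.dirac z).sum s = 0 := by
    intro r
    induction r using Multiset.induction with
    | empty => simp
    | cons a r ih =>
      intro hr
      simp only [Multiset.map_cons, Multiset.sum_cons, Measure.coe_add, Pi.add_apply]
      rw [ih fun z hz => hr z (Multiset.mem_cons_of_mem hz), add_zero, Measure.dirac_apply]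
      simp [hr a (Multiset.mem_cons_self a r)]
  rw [zeroCountingMeasure, Measure.smul_apply, h _ hs, smul_zero]

lemma isProbabilityMeasure_zeroCountingMeasure {p : ℂ[X]} (hp : p.natDegree ≠ 0) :
    IsProbabilityMeasure (zeroCountingMeasure p) := by
  have h : ∀ r : Multiset ℂ,
      (r.map fun z => Measure.dirac z).sum Set.univ = (Multiset.card r : ℝ≥0∞) := by
    intro r
    induction r using Multiset.induction with
    | empty => simp
    | cons a r ih =>
      simp only [Multiset.map_cons, Multiset.sum_cons, Measure.coe_add, Pi.add_apply, ih,
        measure_univ, Multiset.card_cons]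
      push_cast
      ring
  constructor
  rw [zeroCountingMeasure, Measure.smul_apply, h, (IsAlgClosed.splits p).natDegree_eq_card_roots,
    smul_eq_mul]
  rw [(IsAlgClosed.splits p).natDegree_eq_card_roots] at hp
  exact ENNReal.inv_mul_cancel (by exact_mod_cast hp) (ENNReal.natCast_ne_top _)

/-- The Möbius map that carries the zeros of `B n` to those of `Btilde n`. -/
def mobius (t : ℝ) : ℝ := (1 + t) / (1 - t)

lemma measurable_mobius : Measurable mobius := by
  unfold mobius
  fun_prop

lemma mobius_mem {t : ℝ} (ht : t ≤ 0) : mobius t ∈ Set.Ioc (-1) 1 := by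
  have : 0 < 1 - t := by linarith
  refine ⟨?_, ?_⟩
  · rw [mobius, lt_div_iff₀ this]
    linarith
  · rw [mobius, div_le_iff₀ this]
    linarith

lemma inverse_mobius {t : ℝ} (ht : t ≤ 0) : (mobius t - 1) / (mobius t + 1) = t := by
  have : 1 - t ≠ 0 := by linarith
  rw [mobius]
  have e1 : (1 + t) / (1 - t) - 1 = 2 * t / (1 - t) := by field_simp; ring
  have e2 : (1 + t) / (1 - t) + 1 = 2 / (1 - t) := by field_simp; ring
  rw [e1, e2]
  field_simp

/-- `1 - c (1+t)/(1-t) = (1+c)(a-t)/(1-t)` with `a = (1-c)/(1+c) > 0`: the logarithmic test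
functions become differences of potentials at the positive points `a` and `1`. -/
lemma log_one_sub_mul_mobius {c t : ℝ} (hc0 : 0 < c) (hc : c < 1) (ht : t ≤ 0) :
    Real.log (1 - c * mobius t) =
      Real.log (1 + c) + (Real.log ‖(((1 - c) / (1 + c) : ℝ) : ℂ) - t‖ - Real.log ‖(1 : ℂ) - t‖) := by
  have h1 : 0 < 1 - t := by linarith
  have h2 : 0 < (1 - c) / (1 + c) - t := by
    have : 0 < (1 - c) / (1 + c) := div_pos (by linarith) (by linarith)
    linarith
  rw [← Complex.ofReal_one, ← Complex.ofReal_sub, ← Complex.ofReal_sub,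
    Complex.norm_of_nonneg h2.le, Complex.norm_of_nonneg h1.le, ← Real.log_div h2.ne' h1.ne',
    ← Real.log_mul (by linarith) (by positivity)]
  congr 1
  rw [mobius]
  field_simp
  ring

lemma sum_log_norm_sub_roots {p : ℂ[X]} (hp : p ≠ 0) {a : ℂ} (ha : p.eval a ≠ 0) :
    (p.roots.map fun z => Real.log ‖a - z‖).sum =
      Real.log ‖p.eval a‖ - Real.log ‖p.leadingCoeff‖ := by
  have h := (IsAlgClosed.splits p).eq_prod_roots
  have h' := congrArg (Polynomial.eval a) h
  rw [eval_mul, eval_C, eval_multiset_prod, Multiset.map_map] at h'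
  simp only [Function.comp_def, eval_sub, eval_X, eval_C] at h'
  have hprod : ∀ r : Multiset ℂ, (r.map fun z => a - z).prod ≠ 0 →
      Real.log ‖(r.map fun z => a - z).prod‖ = (r.map fun z => Real.log ‖a - z‖).sum := by
    intro r
    induction r using Multiset.induction with
    | empty => simp
    | cons b r ih =>
      intro hr
      simp only [Multiset.map_cons, Multiset.prod_cons, Multiset.sum_cons] at hr ⊢
      rw [norm_mul, Real.log_mul (norm_ne_zero_iff.mpr (left_ne_zero_of_mul hr))
        (norm_ne_zero_iff.mpr (right_ne_zero_of_mul hr)), ih (right_ne_zero_of_mul hr)]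
  have hne : (p.roots.map fun z => a - z).prod ≠ 0 := fun h0 => ha (by rw [h', h0, mul_zero])
  rw [h', norm_mul, Real.log_mul (by simpa using hp) (norm_ne_zero_iff.mpr hne), hprod _ hne]
  ring

lemma eval_B_ne_zero (n : ℕ) {a : ℝ} (ha : 0 < a) : (B n).eval (a : ℂ) ≠ 0 := by
  intro h
  have := (mem_negHalfLine_iff.mp (B_roots_mem n a ((mem_roots (B_ne_zero n)).mpr h))).1
  rw [Complex.ofReal_re] at this
  linarith

/-- In the difference of the two potentials the leading coefficient of `B n` cancels. -/
lemma integral_log_B {n : ℕ} (hn : n ≠ 0) {c : ℝ} (hc0 : 0 < c) (hc : c < 1) :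
    ∫ z : ℂ, Real.log (1 - c * mobius z.re) ∂(zeroCountingMeasure (B n)) = Real.log (1 + c) +
      (Real.log ‖(B n).eval (((1 - c) / (1 + c) : ℝ) : ℂ)‖ / n -
        Real.log ‖(B n).eval ((1 : ℝ) : ℂ)‖ / n) := by
  have ha : 0 < (1 - c) / (1 + c) := div_pos (by linarith) (by linarith)
  have e : (B n).roots.map (fun z : ℂ => Real.log (1 - c * mobius z.re)) =
      (B n).roots.map fun z : ℂ => Real.log (1 + c) +
        (Real.log ‖(((1 - c) / (1 + c) : ℝ) : ℂ) - z‖ - Real.log ‖((1 : ℝ) : ℂ) - z‖) := by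
    refine Multiset.map_congr rfl fun z hz => ?_
    obtain ⟨t, ht, rfl⟩ := B_roots_mem n z hz
    rw [Complex.ofReal_re, log_one_sub_mul_mobius hc0 hc ht, Complex.ofReal_one]
  rw [integral_zeroCountingMeasure, e, Multiset.sum_map_add, Multiset.sum_map_sub,
    sum_log_norm_sub_roots (B_ne_zero n) (eval_B_ne_zero n ha),
    sum_log_norm_sub_roots (B_ne_zero n) (eval_B_ne_zero n one_pos), Multiset.map_const',
    Multiset.sum_replicate, ← (IsAlgClosed.splits (B n)).natDegree_eq_card_roots, natDegree_B]
  have : (n : ℝ) ≠ 0 := by exact_mod_cast hn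
  simp only [nsmul_eq_mul]
  field_simp
  ring

/-- For `s = √a` the root is `r = √√a √(1+√a)` and `1 + 2s ± 2r = (√√a ± √(1+√a))²`. Up to the
constant `4 log 2` this is the growth rate of `B n` at `a`. -/
lemma log_norm_ofReal_sub_limitLaw {a : ℝ} (ha : 0 ≤ a) :
    Integrable (fun t : ℝ => Real.log ‖(a : ℂ) - t‖) limitLaw ∧
      ∫ t : ℝ, Real.log ‖(a : ℂ) - t‖ ∂limitLaw =
        4 * Real.log (√√a + √(1 + √a)) - 4 * Real.log 2 := by
  set x := √√a with hx
  set y := √(1 + √a) with hy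
  have hx2 : x ^ 2 = √a := Real.sq_sqrt (Real.sqrt_nonneg _)
  have hy2 : y ^ 2 = 1 + √a := Real.sq_sqrt (by positivity)
  have ha2 : √a ^ 2 = a := Real.sq_sqrt ha
  have hx0 : 0 ≤ x := Real.sqrt_nonneg _
  have hy0 : 0 < y := Real.sqrt_pos.mpr (by positivity)
  have hr : ((x * y : ℝ) : ℂ) ^ 2 = ((√a : ℝ) : ℂ) ^ 2 + ((√a : ℝ) : ℂ) := by
    norm_cast
    rw [mul_pow, hx2, hy2]
    ring
  have e1 : (1 : ℂ) + 2 * ((√a : ℝ) : ℂ) + 2 * ((x * y : ℝ) : ℂ) = (((x + y) ^ 2 : ℝ) : ℂ) := by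
    rw [add_sq, hx2, hy2]
    push_cast
    ring
  have e2 : (1 : ℂ) + 2 * ((√a : ℝ) : ℂ) - 2 * ((x * y : ℝ) : ℂ) = (((x - y) ^ 2 : ℝ) : ℂ) := by
    rw [sub_sq, hx2, hy2]
    push_cast
    ring
  obtain ⟨h1, h2⟩ := log_norm_sub_limitLaw (s := ((√a : ℝ) : ℂ)) (by simp) hr (by
    rw [e1, e2, Complex.norm_of_nonneg (sq_nonneg _), Complex.norm_of_nonneg (sq_nonneg _)]
    nlinarith)
  rw [e1, Complex.norm_of_nonneg (sq_nonneg _), Real.log_pow] at h2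
  have e3 : ((√a : ℝ) : ℂ) ^ 2 = a := by exact_mod_cast ha2
  rw [e3] at h1 h2
  refine ⟨h1, h2.trans ?_⟩
  push_cast
  ring

lemma ae_limitLaw_nonpos : ∀ᵐ t ∂limitLaw, t ≤ 0 := by
  rw [limitLaw, ae_map_iff measurable_cauchyArcsine.aemeasurable measurableSet_Iic]
  exact .of_forall cauchyArcsine_nonpos

lemma integral_log_limitLaw {c : ℝ} (hc0 : 0 < c) (hc : c < 1) :
    ∫ t, Real.log (1 - c * mobius t) ∂limitLaw = Real.log (1 + c) +
      (4 * Real.log (√√((1 - c) / (1 + c)) + √(1 + √((1 - c) / (1 + c)))) -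
        4 * Real.log (√√1 + √(1 + √1))) := by
  obtain ⟨h1, h2⟩ := log_norm_ofReal_sub_limitLaw
    (div_pos (show 0 < 1 - c by linarith) (show 0 < 1 + c by linarith)).le
  obtain ⟨h3, h4⟩ := log_norm_ofReal_sub_limitLaw zero_le_one
  rw [integral_congr_ae (ae_limitLaw_nonpos.mono fun t ht =>
    log_one_sub_mul_mobius hc0 hc ht), integral_add (integrable_const _)]
  · rw [Complex.ofReal_one] at h3 h4
    rw [integral_sub h1 h3, h2, h4]
    simp
  · rw [Complex.ofReal_one] at h3
    exact h1.sub h3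

lemma measurable_mobius_re : Measurable fun z : ℂ => mobius z.re :=
  measurable_mobius.comp Complex.measurable_re

lemma ae_zeroCountingMeasure_B (n : ℕ) : ∀ᵐ z ∂(zeroCountingMeasure (B n)), z ∈ negHalfLine := by
  rw [ae_iff]
  exact zeroCountingMeasure_apply _ fun z hz h => h (B_roots_mem n z hz)

/-- The index starts at `1` because the counting measure of the constant `B 0` is zero rather than a
probability measure. -/
lemma tendsto_map_mobius {g : ℝ → ℝ} (hg : ContinuousOn g (Set.Icc (-1) 1)) :
    Tendsto (fun n => ∫ x, g x ∂((zeroCountingMeasure (B (n + 1))).map fun z => mobius z.re)) atTop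
      (𝓝 (∫ x, g x ∂(limitLaw.map mobius))) := by
  have : ∀ n, IsProbabilityMeasure (zeroCountingMeasure (B (n + 1))) := fun n =>
    isProbabilityMeasure_zeroCountingMeasure (by rw [natDegree_B]; omega)
  have : ∀ n, IsProbabilityMeasure ((zeroCountingMeasure (B (n + 1))).map fun z => mobius z.re) :=
    fun n => Measure.isProbabilityMeasure_map measurable_mobius_re.aemeasurable
  have : IsProbabilityMeasure (limitLaw.map mobius) :=
    Measure.isProbabilityMeasure_map measurable_mobius.aemeasurable
  refine tendsto_integral_of_tendsto_log (fun n => ?_) ?_ (fun c hc0 hc => ?_) hg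
  · rw [Measure.map_apply measurable_mobius_re measurableSet_Icc.compl]
    refine zeroCountingMeasure_apply _ fun z hz h => h ?_
    exact Set.Ioc_subset_Icc_self (mobius_mem (mem_negHalfLine_iff.mp (B_roots_mem _ z hz)).1)
  · rw [Measure.map_apply measurable_mobius measurableSet_Icc.compl]
    refine measure_mono_null (t := (Set.Iic 0)ᶜ) (Set.compl_subset_compl.mpr fun t ht =>
      Set.Ioc_subset_Icc_self (mobius_mem ht)) ?_
    exact ae_iff.mp ae_limitLaw_nonpos
  · have hm : Measurable fun x : ℝ => Real.log (1 - c * x) :=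
      Real.measurable_log.comp (by fun_prop)
    rw [integral_map measurable_mobius.aemeasurable hm.aestronglyMeasurable,
      integral_log_limitLaw hc0 hc]
    simp only [fun n => integral_map (μ := zeroCountingMeasure (B (n + 1)))
      measurable_mobius_re.aemeasurable hm.aestronglyMeasurable,
      fun n : ℕ => integral_log_B n.succ_ne_zero hc0 hc]
    have ha : 0 ≤ (1 - c) / (1 + c) := div_nonneg (by linarith) (by linarith)
    exact (((tendsto_log_norm_eval_B ha).comp (tendsto_add_atTop_nat 1)).sub
      ((tendsto_log_norm_eval_B zero_le_one).comp (tendsto_add_atTop_nat 1))).const_add _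

/-- The zeros of the polynomials `B n` are asymptotically distributed according to `limitLaw`. -/
lemma weakStarTendsto_B :
    WeakStarTendsto (fun n => zeroCountingMeasure (B n))
      (limitLaw.map fun x : ℝ => (x : ℂ)) := by
  intro f
  have : ∀ n, IsProbabilityMeasure (zeroCountingMeasure (B (n + 1))) := fun n =>
    isProbabilityMeasure_zeroCountingMeasure (by rw [natDegree_B]; omega)
  have : ∀ n, IsProbabilityMeasure ((zeroCountingMeasure (B (n + 1))).map fun z => mobius z.re) :=
    fun n => Measure.isProbabilityMeasure_map measurable_mobius_re.aemeasurable
  have : IsProbabilityMeasure (limitLaw.map mobius) :=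
    Measure.isProbabilityMeasure_map measurable_mobius.aemeasurable
  -- `F` is `f` pulled back by the inverse Möbius map. As `x → -1` the argument runs to `-∞`, so `F`
  -- need not be continuous at `-1`, where it takes the default value `f 0`.
  set F : ℝ → ℝ := fun x => f (((x - 1) / (x + 1) : ℝ) : ℂ) with hF
  have hFm : Measurable F := f.continuous.measurable.comp
    (Complex.measurable_ofReal.comp (by fun_prop))
  rw [← tendsto_add_atTop_iff_nat 1]
  have key := tendsto_integral_of_continuousOn_Ioc (fun g hg => tendsto_map_mobius hg)
    (ρ' := limitLaw.map mobius) ?_ hFm ?_ (C := ‖f‖) (fun x => f.norm_coe_le_norm _)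
  · rw [integral_map measurable_mobius.aemeasurable hFm.aestronglyMeasurable] at key
    rw [integral_map Complex.measurable_ofReal.aemeasurable
      f.continuous.measurable.aestronglyMeasurable]
    rw [integral_congr_ae (g := fun t : ℝ => f t) (ae_limitLaw_nonpos.mono fun t ht => by
      simp only [hF, inverse_mobius ht])] at key
    refine key.congr fun n => ?_
    rw [integral_map measurable_mobius_re.aemeasurable hFm.aestronglyMeasurable]
    refine integral_congr_ae ((ae_zeroCountingMeasure_B _).mono ?_)
    rintro _ ⟨t, ht, rfl⟩
    simp only [hF, Complex.ofReal_re, inverse_mobius ht]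
  · rw [ae_map_iff measurable_mobius.aemeasurable measurableSet_Ioi]
    exact ae_limitLaw_nonpos.mono fun t ht => (mobius_mem ht).1
  · refine f.continuous.comp_continuousOn (Complex.continuous_ofReal.comp_continuousOn ?_)
    refine ContinuousOn.div (by fun_prop) (by fun_prop) fun x hx => ?_
    linarith [hx.1]

/-! ### The transformed polynomials -/

/-- Each linear factor obeys `(w+1)((w-1)/(w+1) - z) = (1-z)(w - (1+z)/(1-z))`, and `z ≠ 1` for a
zero of `B n`, so no degree is lost. -/
lemma Btilde_eq (n : ℕ) : ∃ c : ℂ, c ≠ 0 ∧ Btilde n =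
    C c * (((B n).roots.map fun z => ((mobius z.re : ℝ) : ℂ)).map fun w => X - C w).prod := by
  have hB := (IsAlgClosed.splits (B n)).eq_prod_roots
  have hcard := (IsAlgClosed.splits (B n)).natDegree_eq_card_roots
  rw [natDegree_B] at hcard
  have hone : ∀ z ∈ (B n).roots, 1 - z ≠ 0 := by
    intro z hz h
    have := (mem_negHalfLine_iff.mp (B_roots_mem n z hz)).1
    rw [← sub_eq_zero.mp h] at this
    norm_num at this
  refine ⟨(B n).leadingCoeff * ((B n).roots.map fun z => 1 - z).prod, mul_ne_zero
    (by simpa using B_ne_zero n) ?_, ?_⟩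
  · rw [Ne, Multiset.prod_eq_zero_iff]
    intro h
    obtain ⟨z, hz, hz'⟩ := Multiset.mem_map.mp h
    exact hone z hz hz'
  · refine Polynomial.eq_of_infinite_eval_eq _ _ (Set.Infinite.mono (s := {-1}ᶜ) ?_
      (Set.finite_singleton _).infinite_compl)
    intro w hw
    rw [Set.mem_ofPred_eq, eval_Btilde n w hw]
    have hw' : w + 1 ≠ 0 := fun h => hw (eq_neg_of_add_eq_zero_left h)
    conv_lhs => rw [hB]
    rw [eval_mul, eval_mul, eval_C, eval_C, eval_multiset_prod, eval_multiset_prod,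
      Multiset.map_map, Multiset.map_map, Multiset.map_map]
    have hpow : (w + 1) ^ n = ((B n).roots.map fun _ => w + 1).prod := by
      rw [Multiset.map_const', Multiset.prod_replicate, ← hcard]
    rw [hpow, mul_left_comm, ← Multiset.prod_map_mul, mul_assoc, ← Multiset.prod_map_mul]
    congr 2
    refine Multiset.map_congr rfl fun z hz => ?_
    have h1 := hone z hz
    obtain ⟨t, ht, rfl⟩ := B_roots_mem n z hz
    simp only [Function.comp, eval_sub, eval_X, eval_C, Complex.ofReal_re, mobius] at h1 ⊢
    push_cast
    field_simp
    ring

lemma roots_Btilde (n : ℕ) :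
    (Btilde n).roots = (B n).roots.map fun z => ((mobius z.re : ℝ) : ℂ) := by
  obtain ⟨c, hc, h⟩ := Btilde_eq n
  rw [h, roots_C_mul _ hc, roots_multiset_prod_X_sub_C]

lemma natDegree_Btilde (n : ℕ) : (Btilde n).natDegree = n := by
  rw [(IsAlgClosed.splits (Btilde n)).natDegree_eq_card_roots, roots_Btilde, Multiset.card_map,
    ← (IsAlgClosed.splits (B n)).natDegree_eq_card_roots, natDegree_B]

/-- The zeros of the polynomials `Btilde n` are asymptotically distributed according to the image
of `limitLaw` under the Möbius map. -/
lemma weakStarTendsto_Btilde :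
    WeakStarTendsto (fun n => zeroCountingMeasure (Btilde n))
      ((limitLaw.map mobius).map fun x : ℝ => (x : ℂ)) := by
  intro f
  have hm : Continuous fun x : ℝ => f (x : ℂ) := f.continuous.comp Complex.continuous_ofReal
  rw [← tendsto_add_atTop_iff_nat 1]
  have key := tendsto_map_mobius hm.continuousOn
  rw [integral_map Complex.measurable_ofReal.aemeasurable
    f.continuous.measurable.aestronglyMeasurable]
  refine key.congr fun n => ?_
  rw [integral_map measurable_mobius_re.aemeasurable hm.measurable.aestronglyMeasurable,
    integral_zeroCountingMeasure, integral_zeroCountingMeasure, natDegree_B, natDegree_Btilde,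
    roots_Btilde, Multiset.map_map]
  rfl

/-! ### Principal square roots -/

lemma sq_sqrt_complex (z : ℂ) : Complex.sqrt z ^ 2 = z := by
  exact_mod_cast Complex.cpow_nat_inv_pow z two_ne_zero

lemma sqrt_quadrant_of_nonneg {z : ℂ} (hz : 0 ≤ z.im) :
    0 ≤ (Complex.sqrt z).re ∧ 0 ≤ (Complex.sqrt z).im := by
  rw [Complex.sqrt_eq_real_add_ite, if_pos hz]
  constructor
  all_goals
    simp
    positivity

lemma sqrt_quadrant_of_neg {z : ℂ} (hz : z.im < 0) :
    0 < (Complex.sqrt z).re ∧ (Complex.sqrt z).im < 0 := by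
  have h := Complex.abs_re_lt_norm.mpr hz.ne
  rw [abs_lt] at h
  rw [Complex.sqrt_eq_real_add_ite, if_neg (not_le.mpr hz)]
  constructor
  all_goals
    simp
    linarith

lemma norm_sub_le_norm_add {A r : ℂ} (h : 0 ≤ A.re * r.re + A.im * r.im) :
    ‖A - 2 * r‖ ≤ ‖A + 2 * r‖ ∧ ‖A‖ ≤ ‖A + 2 * r‖ := by
  constructor
  all_goals
    rw [← sq_le_sq₀ (norm_nonneg _) (norm_nonneg _), Complex.sq_norm, Complex.sq_norm,
      Complex.normSq_apply, Complex.normSq_apply]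
    simp
    nlinarith [sq_nonneg r.re, sq_nonneg r.im]

/-- The branch conditions of `log_norm_sub_limitLaw`. If `Im z ≥ 0` both roots lie in the closed
first quadrant, otherwise in the open fourth; in either case their real inner product is
nonnegative. -/
lemma potential_roots (z : ℂ) : 0 ≤ (Complex.sqrt z).re ∧
    ‖1 + 2 * Complex.sqrt z - 2 * Complex.sqrt (z + Complex.sqrt z)‖ ≤
      ‖1 + 2 * Complex.sqrt z + 2 * Complex.sqrt (z + Complex.sqrt z)‖ := by
  rcases le_or_gt 0 z.im with hz | hz
  · have h1 := sqrt_quadrant_of_nonneg hz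
    have h2 := sqrt_quadrant_of_nonneg (z := z + Complex.sqrt z) (by
      rw [Complex.add_im]; linarith [h1.2])
    refine ⟨h1.1, (norm_sub_le_norm_add ?_).1⟩
    simp
    nlinarith [mul_nonneg h1.1 h2.1, mul_nonneg h1.2 h2.2, h2.1]
  · have h1 := sqrt_quadrant_of_neg hz
    have h2 := sqrt_quadrant_of_neg (z := z + Complex.sqrt z) (by
      rw [Complex.add_im]; linarith [h1.2])
    refine ⟨h1.1.le, (norm_sub_le_norm_add ?_).1⟩
    simp
    nlinarith [mul_pos h1.1 h2.1, mul_pos_of_neg_of_neg h1.2 h2.2, h2.1]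

/-- The same quadrant argument. The two inequalities, divided by `q`, say that `s = p/q` and `r/q`
satisfy the branch conditions of `log_norm_sub_limitLaw`. -/
lemma phi_roots (z : ℂ) : ∃ p q r : ℂ, p ^ 2 = z - 1 ∧ q ^ 2 = z + 1 ∧ r ^ 2 = p ^ 2 + p * q ∧
    phi z = ‖q + 2 * p + 2 * r‖ ∧ 0 ≤ q.re * p.re + q.im * p.im ∧
    0 ≤ (q + 2 * p).re * r.re + (q + 2 * p).im * r.im := by
  refine ⟨Complex.sqrt (z - 1), Complex.sqrt (z + 1),
    Complex.sqrt (z - 1 + Complex.sqrt (z - 1) * Complex.sqrt (z + 1)), sq_sqrt_complex _,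
    sq_sqrt_complex _, by rw [sq_sqrt_complex, sq_sqrt_complex], rfl, ?_⟩
  set p := Complex.sqrt (z - 1)
  set q := Complex.sqrt (z + 1)
  rcases le_or_gt 0 z.im with hz | hz
  · have h1 : 0 ≤ p.re ∧ 0 ≤ p.im := sqrt_quadrant_of_nonneg (by simpa using hz)
    have h2 : 0 ≤ q.re ∧ 0 ≤ q.im := sqrt_quadrant_of_nonneg (by simpa using hz)
    have h3 := sqrt_quadrant_of_nonneg (z := z - 1 + p * q) (by
      simp only [Complex.add_im, Complex.sub_im, Complex.one_im, Complex.mul_im]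
      nlinarith [mul_nonneg h1.1 h2.2, mul_nonneg h1.2 h2.1])
    refine ⟨by nlinarith [mul_nonneg h1.1 h2.1, mul_nonneg h1.2 h2.2], ?_⟩
    simp
    nlinarith [mul_nonneg h1.1 h3.1, mul_nonneg h1.2 h3.2, mul_nonneg h2.1 h3.1,
      mul_nonneg h2.2 h3.2]
  · have h1 : 0 < p.re ∧ p.im < 0 := sqrt_quadrant_of_neg (by simpa using hz)
    have h2 : 0 < q.re ∧ q.im < 0 := sqrt_quadrant_of_neg (by simpa using hz)
    have h3 := sqrt_quadrant_of_neg (z := z - 1 + p * q) (by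
      simp only [Complex.add_im, Complex.sub_im, Complex.one_im, Complex.mul_im]
      nlinarith [mul_neg_of_pos_of_neg h1.1 h2.2, mul_neg_of_neg_of_pos h1.2 h2.1])
    refine ⟨by nlinarith [mul_pos h1.1 h2.1, mul_pos_of_neg_of_neg h1.2 h2.2], ?_⟩
    simp
    nlinarith [mul_pos h1.1 h3.1, mul_pos_of_neg_of_neg h1.2 h3.2, mul_pos h2.1 h3.1,
      mul_pos_of_neg_of_neg h2.2 h3.2]

/-- `|q+2p|² ≥ |q|² + |p|² ≥ |q² - p²| = 2`, and adding `2r` does not decrease the modulus. -/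
lemma two_le_phi_sq (z : ℂ) : 2 ≤ phi z ^ 2 := by
  obtain ⟨p, q, r, hp, hq, -, hphi, h1, h2⟩ := phi_roots z
  have h3 : 2 ≤ ‖q + 2 * p‖ ^ 2 := by
    have e : ‖q ^ 2 - p ^ 2‖ = 2 := by
      rw [hp, hq]
      ring_nf
      simp
    have h4 := norm_sub_le (q ^ 2) (p ^ 2)
    rw [e, norm_pow, norm_pow] at h4
    have h5 : ‖q‖ ^ 2 + ‖p‖ ^ 2 ≤ ‖q + 2 * p‖ ^ 2 := by
      rw [Complex.sq_norm, Complex.sq_norm, Complex.sq_norm, Complex.normSq_apply,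
        Complex.normSq_apply, Complex.normSq_apply]
      simp
      nlinarith [sq_nonneg p.re, sq_nonneg p.im]
    linarith
  rw [hphi]
  exact h3.trans (pow_le_pow_left₀ (norm_nonneg _) (norm_sub_le_norm_add h2).2 2)

lemma phi_pos (z : ℂ) : 0 < phi z := by
  have h := two_le_phi_sq z
  have h0 : 0 ≤ phi z := norm_nonneg _
  nlinarith

/-! ### The potential of the image law -/

/-- Absence of atoms: at `t = z` the kernel is `+∞` whereas `Real.log 0 = 0`, so the two agree only
almost everywhere. -/
lemma ae_limitLaw_ne (w : ℂ) : ∀ᵐ t : ℝ ∂limitLaw, (t : ℂ) ≠ w := by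
  rw [limitLaw_eq]
  refine (withDensity_absolutelyContinuous _ _).ae_le (ae_restrict_of_ae ?_)
  have h : Set.Countable {t : ℝ | (t : ℂ) = w} :=
    Set.Subsingleton.countable fun a ha b hb => Complex.ofReal_injective (ha.trans hb.symm)
  exact h.ae_notMem volume

lemma sqrt_sqrt_one_add : √√(1 : ℝ) + √(1 + √1) = 1 + √2 := by
  rw [Real.sqrt_one, Real.sqrt_one]
  norm_num

/-- `z - (1+t)/(1-t) = (z+1)(s²-t)/(1-t)` with `s = p/q`, so the potential is `log |z+1|` plus a
difference of two known ones. The term `log |z+1| = 2 log |q|` absorbs the division by `q`. -/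
lemma log_norm_sub_mobius (z : ℂ) :
    Integrable (fun t : ℝ => Real.log ‖z - (mobius t : ℝ)‖) limitLaw ∧
      ∫ t : ℝ, Real.log ‖z - (mobius t : ℝ)‖ ∂limitLaw =
        2 * Real.log (phi z) - 4 * Real.log (1 + √2) := by
  obtain ⟨p, q, r, hp, hq, hr, hphi, h1, h2⟩ := phi_roots z
  obtain ⟨i1, v1⟩ := log_norm_ofReal_sub_limitLaw zero_le_one
  rw [sqrt_sqrt_one_add, Complex.ofReal_one] at v1
  rw [Complex.ofReal_one] at i1
  by_cases hz : z + 1 = 0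
  -- Here `s` would be infinite; instead `z - (1+t)/(1-t) = -2/(1-t)`.
  · have hz' : z = -1 := eq_neg_of_add_eq_zero_left hz
    have hae : ∀ᵐ t : ℝ ∂limitLaw, Real.log 2 - Real.log ‖(1 : ℂ) - t‖ =
        Real.log ‖z - (mobius t : ℝ)‖ := by
      filter_upwards [ae_limitLaw_nonpos] with t ht
      have h3 : 1 - t ≠ 0 := by linarith
      have h4 : (1 : ℂ) - t ≠ 0 := by exact_mod_cast h3
      rw [show Real.log 2 = Real.log ‖(-2 : ℂ)‖ by simp,
        ← Real.log_div (by simp) (norm_ne_zero_iff.mpr h4), ← norm_div]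
      congr 2
      rw [hz', mobius]
      push_cast
      field_simp
      ring
    refine ⟨((integrable_const _).sub i1).congr hae, ?_⟩
    rw [← integral_congr_ae hae, integral_sub (integrable_const _) i1, v1]
    have hq0 : q = 0 := by
      rw [hz] at hq
      exact pow_eq_zero_iff two_ne_zero |>.mp hq
    have hrp : ‖r‖ = ‖p‖ := by
      rw [← sq_eq_sq₀ (norm_nonneg _) (norm_nonneg _), ← norm_pow, ← norm_pow, hr, hq0]
      simp
    have hp2 : ‖p‖ ^ 2 = 2 := by
      rw [← norm_pow, hp, hz']
      norm_num
    -- The root `r = -p` would give `phi z = 0`, against `two_le_phi_sq`.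
    have hrs : r = p ∨ r = -p := by
      rw [hq0, mul_zero, add_zero] at hr
      exact sq_eq_sq_iff_eq_or_eq_neg.mp hr
    have hphi2 : phi z ^ 2 = 2 ^ 5 := by
      rcases hrs with h | h
      · rw [hphi, hq0, h, show (0 : ℂ) + 2 * p + 2 * p = 4 * p by ring, norm_mul, mul_pow, hp2]
        norm_num
      · have := two_le_phi_sq z
        rw [hphi, hq0, h] at this
        norm_num at this
    have h5 : 2 * Real.log (phi z) = 5 * Real.log 2 := by
      have := congrArg Real.log hphi2
      rw [Real.log_pow, Real.log_pow] at this
      exact_mod_cast this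
    rw [h5]
    simp
    ring
  · have hq0 : q ≠ 0 := by
      rintro rfl
      rw [← hq] at hz
      simp at hz
    have hnq : 0 < ‖q‖ := norm_pos_iff.mpr hq0
    have hs : 0 ≤ (p / q).re := by
      rw [Complex.div_re, ← add_div]
      exact div_nonneg (by linarith) (Complex.normSq_nonneg _)
    have hr' : (r / q) ^ 2 = (p / q) ^ 2 + p / q := by
      field_simp
      linear_combination hr
    have e1 : 1 + 2 * (p / q) + 2 * (r / q) = (q + 2 * p + 2 * r) / q := by field_simp
    have e2 : 1 + 2 * (p / q) - 2 * (r / q) = (q + 2 * p - 2 * r) / q := by field_simp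
    obtain ⟨i2, v2⟩ := log_norm_sub_limitLaw hs hr' (by
      rw [e1, e2, norm_div, norm_div]
      exact div_le_div_of_nonneg_right (norm_sub_le_norm_add h2).1 (norm_nonneg _))
    have hae : ∀ᵐ t : ℝ ∂limitLaw, Real.log ‖z + 1‖ + (Real.log ‖(p / q) ^ 2 - t‖ -
        Real.log ‖(1 : ℂ) - t‖) = Real.log ‖z - (mobius t : ℝ)‖ := by
      filter_upwards [ae_limitLaw_nonpos, ae_limitLaw_ne ((p / q) ^ 2)] with t ht htn
      have h3 : 1 - t ≠ 0 := by linarith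
      have h4 : (1 : ℂ) - t ≠ 0 := by exact_mod_cast h3
      have h5 : (p / q) ^ 2 - t ≠ 0 := sub_ne_zero.mpr (Ne.symm htn)
      rw [← Real.log_div (norm_ne_zero_iff.mpr h5) (norm_ne_zero_iff.mpr h4), ← norm_div,
        ← Real.log_mul (norm_ne_zero_iff.mpr hz) (norm_ne_zero_iff.mpr (div_ne_zero h5 h4)),
        ← norm_mul]
      congr 2
      rw [div_pow, hp, hq, mobius]
      push_cast
      field_simp
      ring
    have i3 : Integrable (fun t : ℝ => Real.log ‖(p / q) ^ 2 - t‖ - Real.log ‖(1 : ℂ) - t‖)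
        limitLaw := i2.sub i1
    refine ⟨((integrable_const _).add i3).congr hae, ?_⟩
    rw [← integral_congr_ae hae, integral_add (integrable_const _) i3, integral_sub i2 i1, v1, v2,
      e1, norm_div, ← hphi, Real.log_div (phi_pos z).ne' hnq.ne', ← hq, norm_pow, Real.log_pow]
    simp
    ring

/-! ### Extended integrals -/

lemma extIntegral_of_integrable {α : Type*} [MeasurableSpace α] {ρ : Measure α} {k : α → EReal}
    {f : α → ℝ} (hf : Integrable f ρ) (h : k =ᵐ[ρ] fun x => (f x : EReal)) :
    extIntegral ρ k = ((∫ x, f x ∂ρ : ℝ) : EReal) := by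
  have h1 : ∫⁻ x, (k x).toENNReal ∂ρ = ∫⁻ x, ENNReal.ofReal (f x) ∂ρ :=
    lintegral_congr_ae (h.mono fun x hx => by simp only [hx, EReal.real_coe_toENNReal])
  have h2 : ∫⁻ x, (-k x).toENNReal ∂ρ = ∫⁻ x, ENNReal.ofReal (-f x) ∂ρ :=
    lintegral_congr_ae (h.mono fun x hx => by
      simp only [hx, ← EReal.coe_neg, EReal.real_coe_toENNReal])
  have hfin : ∀ {g : α → ℝ}, Integrable g ρ → ∫⁻ x, ENNReal.ofReal (g x) ∂ρ ≠ ⊤ := fun hg =>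
    hg.lintegral_lt_top.ne
  rw [extIntegral, h1, h2, integral_eq_lintegral_pos_part_sub_lintegral_neg_part hf,
    EReal.coe_sub, EReal.coe_ennreal_toReal (hfin hf), EReal.coe_ennreal_toReal (hfin (g := fun x => -f x) hf.neg)]

lemma log_inv_ofReal {x : ℝ} (hx : 0 < x) :
    ENNReal.log (ENNReal.ofReal x)⁻¹ = ((-Real.log x : ℝ) : EReal) := by
  rw [ENNReal.log_inv, ENNReal.log_ofReal_of_pos hx, EReal.coe_neg]

lemma logPotential_map_ofReal {ρ : Measure ℝ} {z : ℂ}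
    (hi : Integrable (fun x : ℝ => Real.log ‖z - x‖) ρ) (hz : ∀ᵐ x : ℝ ∂ρ, (x : ℂ) ≠ z) :
    logPotential (ρ.map fun x : ℝ => (x : ℂ)) z =
      ((-∫ x : ℝ, Real.log ‖z - x‖ ∂ρ : ℝ) : EReal) := by
  have hm : Measurable fun w : ℂ => -Real.log ‖z - w‖ :=
    (Real.measurable_log.comp (measurable_const.sub measurable_id).norm).neg
  have hi' : Integrable (fun w : ℂ => -Real.log ‖z - w‖) (ρ.map fun x : ℝ => (x : ℂ)) := by
    rw [integrable_map_measure hm.aestronglyMeasurable Complex.measurable_ofReal.aemeasurable]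
    exact hi.neg
  rw [logPotential, extIntegral_of_integrable hi', integral_map
    Complex.measurable_ofReal.aemeasurable hm.aestronglyMeasurable, integral_neg]
  have hs : MeasurableSet {w : ℂ | w ≠ z} := (measurableSet_singleton z).compl
  filter_upwards [(ae_map_iff Complex.measurable_ofReal.aemeasurable hs).mpr hz] with w hw
  exact log_inv_ofReal (norm_pos_iff.mpr (sub_ne_zero.mpr (Ne.symm hw)))

lemma logPotential_limitLaw (z : ℂ) :
    logPotential (limitLaw.map fun x : ℝ => (x : ℂ)) z =
      ((4 * Real.log 2 - 2 * Real.log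
          ‖1 + 2 * (Complex.sqrt z + Complex.sqrt (z + Complex.sqrt z))‖ : ℝ) : EReal) := by
  obtain ⟨h1, h2⟩ := potential_roots z
  obtain ⟨i, v⟩ := log_norm_sub_limitLaw h1 (r := Complex.sqrt (z + Complex.sqrt z))
    (by rw [sq_sqrt_complex, sq_sqrt_complex]) h2
  rw [sq_sqrt_complex] at i v
  rw [logPotential_map_ofReal i (ae_limitLaw_ne z), v, mul_add, ← add_assoc, neg_sub]

/-- The limit law of the zeros of the polynomials `Btilde n`. -/
def equilibriumLaw : Measure ℝ := limitLaw.map mobius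

instance : IsProbabilityMeasure equilibriumLaw :=
  Measure.isProbabilityMeasure_map measurable_mobius.aemeasurable

lemma log_norm_sub_equilibriumLaw (z : ℂ) :
    Integrable (fun x : ℝ => Real.log ‖z - x‖) equilibriumLaw ∧
      ∫ x : ℝ, Real.log ‖z - x‖ ∂equilibriumLaw =
        2 * Real.log (phi z) - 4 * Real.log (1 + √2) := by
  obtain ⟨i, v⟩ := log_norm_sub_mobius z
  rw [equilibriumLaw, integrable_map_measure (measurable_log_norm_sub z).aestronglyMeasurable
    measurable_mobius.aemeasurable, integral_map measurable_mobius.aemeasurable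
    (measurable_log_norm_sub z).aestronglyMeasurable]
  exact ⟨i, v⟩

lemma ae_equilibriumLaw_ne (w : ℂ) : ∀ᵐ x : ℝ ∂equilibriumLaw, (x : ℂ) ≠ w := by
  have hs : MeasurableSet {x : ℝ | (x : ℂ) ≠ w} :=
    Complex.measurable_ofReal (measurableSet_singleton w).compl
  rw [equilibriumLaw, ae_map_iff measurable_mobius.aemeasurable hs]
  filter_upwards [ae_limitLaw_nonpos, ae_limitLaw_ne ((w - 1) / (w + 1))] with t ht htn h
  apply htn
  rw [← h, ← Complex.ofReal_one, ← Complex.ofReal_sub, ← Complex.ofReal_add,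
    ← Complex.ofReal_div, inverse_mobius ht]

lemma logPotential_equilibriumLaw (z : ℂ) :
    logPotential (equilibriumLaw.map fun x : ℝ => (x : ℂ)) z =
      ((Real.log ((1 + √2) ^ 4) - 2 * Real.log (phi z) : ℝ) : EReal) := by
  obtain ⟨i, v⟩ := log_norm_sub_equilibriumLaw z
  rw [logPotential_map_ofReal i (ae_equilibriumLaw_ne z), v, neg_sub, Real.log_pow]
  norm_num

lemma ae_equilibriumLaw_mem : ∀ᵐ x ∂equilibriumLaw, x ∈ Set.Icc (-1 : ℝ) 1 := by
  refine (ae_map_iff measurable_mobius.aemeasurable measurableSet_Icc).mpr ?_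
  exact ae_limitLaw_nonpos.mono fun t ht => Set.Ioc_subset_Icc_self (mobius_mem ht)

/-! ### The density of the image law -/

/-- Change of variables under the Möbius map, whose derivative is `2/(1-t)²`, on the open half-line
and open segment; the endpoints are null. -/
lemma equilibriumLaw_eq : equilibriumLaw =
    (volume.restrict (Set.Icc (-1) 1)).withDensity fun x => ENNReal.ofReal (nuDensity x) := by
  ext A hA
  have himg : mobius '' Set.Iio 0 = Set.Ioo (-1) 1 := by
    ext x
    constructor
    · rintro ⟨t, ht, rfl⟩
      have ht' : t < 0 := ht
      refine ⟨(mobius_mem ht'.le).1, ?_⟩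
      rw [mobius, div_lt_one (by linarith)]
      linarith
    · intro hx
      have h1 : 0 < x + 1 := by linarith [hx.1]
      refine ⟨(x - 1) / (x + 1), div_neg_of_neg_of_pos (by linarith [hx.2]) h1, ?_⟩
      rw [mobius]
      have e1 : 1 + (x - 1) / (x + 1) = 2 * x / (x + 1) := by field_simp; ring
      have e2 : 1 - (x - 1) / (x + 1) = 2 / (x + 1) := by field_simp; ring
      rw [e1, e2]
      field_simp
  have hinj : Set.InjOn mobius (Set.Iio 0) := by
    intro x hx y hy hxy
    rw [← inverse_mobius (le_of_lt hx), hxy, inverse_mobius (le_of_lt hy)]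
  have hderiv : ∀ t ∈ Set.Iio (0 : ℝ),
      HasDerivWithinAt mobius (2 / (1 - t) ^ 2) (Set.Iio 0) t := by
    intro t ht
    have ht' : t < 0 := ht
    have h := ((hasDerivAt_id t).const_add 1).div ((hasDerivAt_id t).const_sub 1)
      (by simp only [id]; linarith)
    refine (h.congr_deriv ?_).hasDerivWithinAt
    simp only [id]
    ring
  have hcov := lintegral_image_eq_lintegral_abs_deriv_mul measurableSet_Iio hderiv hinj
    (A.indicator fun x => ENNReal.ofReal (nuDensity x))
  have hpt : ∀ t ∈ Set.Iio (0 : ℝ), ENNReal.ofReal |2 / (1 - t) ^ 2| *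
      A.indicator (fun x => ENNReal.ofReal (nuDensity x)) (mobius t) =
      (mobius ⁻¹' A).indicator (fun t => ENNReal.ofReal (muDensity t)) t := by
    intro t ht
    have ht' : t < 0 := ht
    have h1 : 0 < 1 - t := by linarith
    by_cases hA : mobius t ∈ A
    · rw [Set.indicator_of_mem hA, Set.indicator_of_mem (show t ∈ mobius ⁻¹' A from hA),
        ← ENNReal.ofReal_mul (abs_nonneg _), abs_of_pos (by positivity)]
      congr 1
      have e1 : 1 + mobius t = 2 / (1 - t) := by rw [mobius]; field_simp; ring
      have e2 : 1 - mobius t = 2 * -t / (1 - t) := by rw [mobius]; field_simp; ring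
      have hu : 0 < -t := by linarith
      set u := -t with hudef
      have h1u : 1 - t = 1 + u := by rw [hudef]; ring
      rw [nuDensity, muDensity, e1, e2, abs_of_neg ht', ← hudef, h1u]
      set a := √u with ha
      have ha0 : 0 < a := Real.sqrt_pos.mpr hu
      set b := √(1 + u) with hb
      have hb0 : 0 < b := Real.sqrt_pos.mpr (by positivity)
      have hb2 : b ^ 2 = 1 + u := Real.sq_sqrt (by positivity)
      set c := √(2 : ℝ) with hc
      have hc0 : 0 < c := Real.sqrt_pos.mpr (by norm_num)
      have hc2 : c ^ 2 = 2 := Real.sq_sqrt (by norm_num)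
      have s1 : √(2 / (1 + u)) = c / b := Real.sqrt_div (by norm_num) _
      have s2 : √(2 * u / (1 + u)) = c * a / b := by
        rw [Real.sqrt_div (by positivity), Real.sqrt_mul (by norm_num)]
      have s3 : c + c * a / b = c * (a + b) / b := by field_simp; ring
      rw [s1, s2, s3, show (3 / 4 : ℝ) = 1 / 2 + 1 / 2 * (1 / 2) by norm_num,
        Real.rpow_add (by positivity), Real.rpow_add hu, Real.rpow_mul (by positivity),
        Real.rpow_mul hu.le]
      simp only [← Real.sqrt_eq_rpow]
      rw [s2, ← ha, Real.sqrt_div (by positivity), Real.sqrt_div (by positivity),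
        Real.sqrt_mul hc0.le, Real.sqrt_mul hc0.le, ← hb, ← hb2]
      have q1 : √c ^ 2 = c := Real.sq_sqrt hc0.le
      have q2 : √b ^ 2 = b := Real.sq_sqrt hb0.le
      have q3 : 0 < √c := Real.sqrt_pos.mpr hc0
      have q4 : 0 < √b := Real.sqrt_pos.mpr hb0
      have := Real.pi_pos
      field_simp
      rw [q1, q2]
      linear_combination (-b) * hc2
    · rw [Set.indicator_of_notMem hA, Set.indicator_of_notMem
        (show t ∉ mobius ⁻¹' A from hA), mul_zero]
  rw [equilibriumLaw, Measure.map_apply measurable_mobius hA, limitLaw_eq,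
    withDensity_apply _ (measurable_mobius hA), withDensity_apply _ hA,
    ← lintegral_indicator (measurable_mobius hA), ← lintegral_indicator hA,
    ← Measure.restrict_congr_set Iio_ae_eq_Iic, ← Measure.restrict_congr_set Ioo_ae_eq_Icc,
    ← himg, hcov, setLIntegral_congr_fun measurableSet_Iio hpt]

/-! ### Positive definiteness of the logarithmic kernel -/

/-- `|1 - r e^{i(a+b)}| |1 - r e^{i(a-b)}|`, a regularization of `2 |cos a - cos b|`. -/
def chordProduct (r a b : ℝ) : ℝ := ‖1 - circleMap 0 r (a + b)‖ * ‖1 - circleMap 0 r (a - b)‖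

/-- `(1 - e^{i(a+b)})(1 - e^{i(a-b)}) = 2 e^{ia} (cos a - cos b)`. -/
lemma chordProduct_one (a b : ℝ) : chordProduct 1 a b = 2 * |Real.cos a - Real.cos b| := by
  have e : (1 - circleMap 0 1 (a + b)) * (1 - circleMap 0 1 (a - b)) =
      circleMap 0 1 a * ((2 * (Real.cos a - Real.cos b) : ℝ) : ℂ) := by
    have h1 : (Real.sin a : ℂ) ^ 2 + (Real.cos a : ℂ) ^ 2 = 1 := by
      exact_mod_cast Real.sin_sq_add_cos_sq a
    have h2 : (Real.sin b : ℂ) ^ 2 + (Real.cos b : ℂ) ^ 2 = 1 := by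
      exact_mod_cast Real.sin_sq_add_cos_sq b
    rw [circleMap_eq, circleMap_eq, circleMap_eq, Real.cos_add, Real.cos_sub, Real.sin_add,
      Real.sin_sub]
    push_cast
    push_cast at h1 h2
    generalize Complex.cos a = x at *
    generalize Complex.sin a = y at *
    generalize Complex.cos b = u at *
    generalize Complex.sin b = v at *
    have hI := Complex.I_sq
    have hu : u ^ 2 = 1 - v ^ 2 := by linear_combination h2
    have hx : x ^ 2 = 1 - y ^ 2 := by linear_combination h1
    ring_nf
    simp only [hI, hu, hx]
    ring_nf
  rw [chordProduct, ← norm_mul, e, norm_mul, norm_circleMap_zero, Complex.norm_real,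
    Real.norm_eq_abs, abs_mul]
  norm_num

lemma norm_one_sub_circleMap_bounds {r : ℝ} (hr0 : 0 < r) (hr : r < 1) (x : ℝ) :
    0 < ‖1 - circleMap 0 r x‖ ∧ ‖1 - circleMap 0 r x‖ ≤ 2 ∧
      ‖1 - circleMap 0 1 x‖ ≤ 2 * ‖1 - circleMap 0 r x‖ := by
  have hn : ‖circleMap 0 r x‖ = r := by rw [norm_circleMap_zero, abs_of_pos hr0]
  have h1 : 1 - r ≤ ‖1 - circleMap 0 r x‖ := by
    have := norm_sub_norm_le (1 : ℂ) (circleMap 0 r x)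
    rwa [norm_one, hn] at this
  have h2 : ‖1 - circleMap 0 r x‖ ≤ 1 + r := by
    have := norm_sub_le (1 : ℂ) (circleMap 0 r x)
    rwa [norm_one, hn] at this
  have h3 : ‖circleMap 0 r x - circleMap 0 1 x‖ = 1 - r := by
    have : circleMap 0 r x - circleMap 0 1 x = ((r - 1 : ℝ) : ℂ) * circleMap 0 1 x := by
      rw [circleMap_zero, circleMap_zero]
      push_cast
      ring
    rw [this, norm_mul, norm_circleMap_zero, Complex.norm_real, Real.norm_eq_abs, abs_one,
      mul_one, abs_sub_comm, abs_of_pos (by linarith)]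
  have h4 := norm_sub_le_norm_sub_add_norm_sub (1 : ℂ) (circleMap 0 r x) (circleMap 0 1 x)
  rw [h3] at h4
  exact ⟨by linarith, by linarith, by linarith⟩

/-- A majorant independent of `r`, for dominated convergence as `r → 1`: the regularized product is
at most `4` and at least a quarter of its value at `r = 1`, because `|1 - e^{ix}| ≤ 2 |1 - r
e^{ix}|`. -/
lemma abs_log_chordProduct_le {r : ℝ} (hr0 : 0 < r) (hr : r < 1) {a b : ℝ}
    (hab : Real.cos a ≠ Real.cos b) :
    |Real.log (chordProduct r a b)| ≤
      Real.log 4 + |Real.log (2 * |Real.cos a - Real.cos b|)| := by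
  obtain ⟨h1, h2, h3⟩ := norm_one_sub_circleMap_bounds hr0 hr (a + b)
  obtain ⟨h4, h5, h6⟩ := norm_one_sub_circleMap_bounds hr0 hr (a - b)
  have hpos : 0 < chordProduct r a b := mul_pos h1 h4
  have hle : chordProduct r a b ≤ 4 :=
    (mul_le_mul h2 h5 h4.le zero_le_two).trans (by norm_num)
  have hone : 0 < 2 * |Real.cos a - Real.cos b| :=
    mul_pos two_pos (abs_pos.mpr (sub_ne_zero.mpr hab))
  have hge : 2 * |Real.cos a - Real.cos b| ≤ 4 * chordProduct r a b := by
    rw [← chordProduct_one]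
    calc chordProduct 1 a b ≤ (2 * ‖1 - circleMap 0 r (a + b)‖) *
          (2 * ‖1 - circleMap 0 r (a - b)‖) :=
          mul_le_mul h3 h6 (norm_nonneg _) (by positivity)
      _ = 4 * chordProduct r a b := by rw [chordProduct]; ring
  have l1 := Real.log_le_log hpos hle
  have l2 := Real.log_le_log hone hge
  rw [Real.log_mul (by norm_num) hpos.ne'] at l2
  have l3 := neg_abs_le (Real.log (2 * |Real.cos a - Real.cos b|))
  have l4 := abs_nonneg (Real.log (2 * |Real.cos a - Real.cos b|))
  rw [abs_le]
  constructor <;> linarith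

lemma continuous_chordProduct : Continuous fun p : ℝ × ℝ × ℝ => chordProduct p.1 p.2.1 p.2.2 := by
  unfold chordProduct
  simp only [circleMap_zero]
  fun_prop

lemma hasSum_log_norm_one_sub_circleMap {r : ℝ} (hr0 : 0 < r) (hr : r < 1) (x : ℝ) :
    HasSum (fun n : ℕ => r ^ n / n * Real.cos (n * x)) (-Real.log ‖1 - circleMap 0 r x‖) := by
  have hn : ‖circleMap 0 r x‖ < 1 := by rwa [norm_circleMap_zero, abs_of_pos hr0]
  have h := Complex.hasSum_re (Complex.hasSum_taylorSeries_neg_log hn)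
  rw [Complex.neg_re, Complex.log_re] at h
  refine h.congr_fun fun n => ?_
  rw [circleMap_zero_pow, Complex.div_natCast_re, circleMap_zero_re]
  ring

/-- Adding the series of `-log |1 - w|` at the angles `a ± b` diagonalizes the kernel with
nonnegative coefficients. The term `n = 0` vanishes by the convention for division by zero. -/
lemma hasSum_log_chordProduct {r : ℝ} (hr0 : 0 < r) (hr : r < 1) (a b : ℝ) :
    HasSum (fun n : ℕ => 2 * r ^ n / n * (Real.cos (n * a) * Real.cos (n * b)))
      (-Real.log (chordProduct r a b)) := by
  have h := (hasSum_log_norm_one_sub_circleMap hr0 hr (a + b)).add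
    (hasSum_log_norm_one_sub_circleMap hr0 hr (a - b))
  rw [← neg_add, ← Real.log_mul (norm_one_sub_circleMap_bounds hr0 hr _).1.ne'
    (norm_one_sub_circleMap_bounds hr0 hr _).1.ne'] at h
  refine h.congr_fun fun n => ?_
  rw [mul_add, mul_sub, Real.cos_add, Real.cos_sub]
  ring

/-- The Chebyshev moments of a measure on the segment `[-1, 1]`. -/
def chebyshevMoment (σ : Measure ℂ) (n : ℕ) : ℝ := ∫ z, Real.cos (n * Real.arccos z.re) ∂σ

/-- The regularized mutual logarithmic energy. -/
def regEnergy (r : ℝ) (σ τ : Measure ℂ) : ℝ :=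
  ∫ p, -Real.log (chordProduct r (Real.arccos p.1.re) (Real.arccos p.2.re)) ∂(σ.prod τ)

lemma measurable_arccos_re : Measurable fun z : ℂ => Real.arccos z.re :=
  Real.measurable_arccos.comp Complex.measurable_re

lemma measurable_cos_arccos (n : ℕ) : Measurable fun z : ℂ => Real.cos (n * Real.arccos z.re) :=
  Real.measurable_cos.comp (measurable_arccos_re.const_mul _)

lemma hasSum_regEnergy {r : ℝ} (hr0 : 0 < r) (hr : r < 1) (σ τ : Measure ℂ)
    [IsProbabilityMeasure σ] [IsProbabilityMeasure τ] :
    HasSum (fun n : ℕ => 2 * r ^ n / n * (chebyshevMoment σ n * chebyshevMoment τ n))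
      (regEnergy r σ τ) := by
  set F : ℕ → ℂ × ℂ → ℝ := fun n p => 2 * r ^ n / n *
    (Real.cos (n * Real.arccos p.1.re) * Real.cos (n * Real.arccos p.2.re)) with hF
  have hFm : ∀ n, AEStronglyMeasurable (F n) (σ.prod τ) := fun n =>
    ((((measurable_cos_arccos n).comp measurable_fst).mul
      ((measurable_cos_arccos n).comp measurable_snd)).const_mul _).aestronglyMeasurable
  have hFb : ∀ n p, ‖F n p‖ ≤ 2 * r ^ n := by
    intro n p
    have h1 : |Real.cos (n * Real.arccos p.1.re) * Real.cos (n * Real.arccos p.2.re)| ≤ 1 := by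
      rw [abs_mul]
      exact mul_le_one₀ (Real.abs_cos_le_one _) (abs_nonneg _) (Real.abs_cos_le_one _)
    have h2 : 2 * r ^ n / n ≤ 2 * r ^ n := by
      rcases n.eq_zero_or_pos with rfl | hn
      · simp
      · exact div_le_self (by positivity) (by exact_mod_cast hn)
    rw [Real.norm_eq_abs, hF, abs_mul, abs_of_nonneg (by positivity)]
    exact (mul_le_of_le_one_right (by positivity) h1).trans h2
  have hFi : ∀ n, Integrable (F n) (σ.prod τ) := fun n =>
    Integrable.of_bound (hFm n) _ (.of_forall (hFb n))
  have hsum : Summable fun n => ∫ p, ‖F n p‖ ∂(σ.prod τ) := by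
    refine Summable.of_nonneg_of_le (fun n => integral_nonneg fun _ => norm_nonneg _)
      (fun n => ?_) ((summable_geometric_of_lt_one hr0.le hr).mul_left 2)
    have := integral_mono (hFi n).norm (integrable_const (2 * r ^ n)) (hFb n)
    simpa using this
  have h := hasSum_integral_of_summable_integral_norm hFi hsum
  have e1 : ∫ p, ∑' n, F n p ∂(σ.prod τ) = regEnergy r σ τ :=
    integral_congr_ae (.of_forall fun p => (hasSum_log_chordProduct hr0 hr _ _).tsum_eq)
  rw [e1] at h
  refine h.congr_fun fun n => ?_
  simp only [hF]
  rw [integral_const_mul, integral_prod_mul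
    (fun z : ℂ => Real.cos (n * Real.arccos z.re)) (fun z : ℂ => Real.cos (n * Real.arccos z.re))]
  rfl

/-- The right side is the sum over all `n` of the nonnegative terms on the left. -/
lemma regEnergy_lower_bound {r : ℝ} (hr0 : 0 < r) (hr : r < 1) (σ τ : Measure ℂ)
    [IsProbabilityMeasure σ] [IsProbabilityMeasure τ] (n : ℕ) :
    2 * r ^ n / n * (chebyshevMoment σ n - chebyshevMoment τ n) ^ 2 ≤
      regEnergy r σ σ - 2 * regEnergy r σ τ + regEnergy r τ τ := by
  have h := ((hasSum_regEnergy hr0 hr σ σ).sub ((hasSum_regEnergy hr0 hr σ τ).mul_left 2)).add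
    (hasSum_regEnergy hr0 hr τ τ)
  have e : ∀ n : ℕ, 2 * r ^ n / n * (chebyshevMoment σ n * chebyshevMoment σ n) -
      2 * (2 * r ^ n / n * (chebyshevMoment σ n * chebyshevMoment τ n)) +
      2 * r ^ n / n * (chebyshevMoment τ n * chebyshevMoment τ n) =
      2 * r ^ n / n * (chebyshevMoment σ n - chebyshevMoment τ n) ^ 2 := fun n => by ring
  simp only [e] at h
  exact le_hasSum h n fun m _ => by positivity

/-- The mutual logarithmic energy of two measures, as a real number. -/
def logEnergy (σ τ : Measure ℂ) : ℝ := ∫ p, -Real.log ‖p.1 - p.2‖ ∂(σ.prod τ)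

lemma norm_sub_of_mem_unitSegment {z w : ℂ} (hz : z ∈ unitSegment) (hw : w ∈ unitSegment) :
    ‖z - w‖ = |Real.cos (Real.arccos z.re) - Real.cos (Real.arccos w.re)| := by
  obtain ⟨x, hx, rfl⟩ := hz
  obtain ⟨y, hy, rfl⟩ := hw
  simp only [Complex.ofReal_re]
  rw [Real.cos_arccos hx.1 hx.2, Real.cos_arccos hy.1 hy.2, ← Complex.ofReal_sub,
    Complex.norm_real, Real.norm_eq_abs]

lemma measurableSet_unitSegment : MeasurableSet unitSegment :=
  (isCompact_Icc.image Complex.continuous_ofReal).isClosed.measurableSet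

lemma ae_prod_mem {σ τ : Measure ℂ} [IsProbabilityMeasure σ] [IsProbabilityMeasure τ]
    (hσ : σ unitSegmentᶜ = 0) (hτ : τ unitSegmentᶜ = 0) :
    ∀ᵐ p ∂(σ.prod τ), p.1 ∈ unitSegment ∧ p.2 ∈ unitSegment := by
  have h1 : ∀ᵐ z ∂σ, z ∈ unitSegment := by rwa [ae_iff]
  have h2 : ∀ᵐ z ∂τ, z ∈ unitSegment := by rwa [ae_iff]
  exact (Measure.quasiMeasurePreserving_fst.ae h1).and (Measure.quasiMeasurePreserving_snd.ae h2)

lemma radius_mem (j : ℕ) : 0 < 1 - 1 / ((j : ℝ) + 2) ∧ 1 - 1 / ((j : ℝ) + 2) < 1 := by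
  have h1 : (0 : ℝ) < 1 / ((j : ℝ) + 2) := by positivity
  have h2 : 1 / ((j : ℝ) + 2) < 1 := by
    rw [div_lt_one (by positivity)]
    linarith [(Nat.cast_nonneg j : (0 : ℝ) ≤ j)]
  exact ⟨by linarith, by linarith⟩

lemma tendsto_radius : Tendsto (fun j : ℕ => 1 - 1 / ((j : ℝ) + 2)) atTop (𝓝 1) := by
  have h := (tendsto_one_div_add_atTop_nhds_zero_nat (𝕜 := ℝ)).comp (tendsto_add_atTop_nat 1)
  rw [show 𝓝 (1 : ℝ) = 𝓝 (1 - 0) by rw [sub_zero]]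
  refine (h.const_sub 1).congr fun j => ?_
  simp only [Function.comp]
  push_cast
  ring

lemma tendsto_regEnergy {σ τ : Measure ℂ} [IsProbabilityMeasure σ] [IsProbabilityMeasure τ]
    (hσ : σ unitSegmentᶜ = 0) (hτ : τ unitSegmentᶜ = 0)
    (hd : ∀ᵐ p ∂(σ.prod τ), p.1 ≠ p.2)
    (hi : Integrable (fun p : ℂ × ℂ => Real.log ‖p.1 - p.2‖) (σ.prod τ)) :
    Tendsto (fun j : ℕ => regEnergy (1 - 1 / ((j : ℝ) + 2)) σ τ) atTop
      (𝓝 (logEnergy σ τ - Real.log 2)) := by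
  have hlim : logEnergy σ τ - Real.log 2 =
      ∫ p, -(Real.log 2 + Real.log ‖p.1 - p.2‖) ∂(σ.prod τ) := by
    rw [integral_neg, integral_add (integrable_const _) hi, logEnergy, integral_neg]
    simp
    ring
  rw [hlim]
  have hmem := ae_prod_mem hσ hτ
  have hlog : ∀ᵐ p ∂(σ.prod τ), Real.cos (Real.arccos p.1.re) ≠ Real.cos (Real.arccos p.2.re) ∧
      Real.log (2 * |Real.cos (Real.arccos p.1.re) - Real.cos (Real.arccos p.2.re)|) =
        Real.log 2 + Real.log ‖p.1 - p.2‖ := by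
    filter_upwards [hmem, hd] with p hp hpd
    have h0 : 0 < ‖p.1 - p.2‖ := norm_pos_iff.mpr (sub_ne_zero.mpr hpd)
    rw [← norm_sub_of_mem_unitSegment hp.1 hp.2, Real.log_mul two_ne_zero h0.ne']
    rw [norm_sub_of_mem_unitSegment hp.1 hp.2] at h0
    exact ⟨sub_ne_zero.mp (abs_pos.mp h0), rfl⟩
  have hdom : Integrable (fun p : ℂ × ℂ => Real.log 4 + |Real.log 2 + Real.log ‖p.1 - p.2‖|)
      (σ.prod τ) := (integrable_const _).add ((integrable_const _).add hi).abs
  unfold regEnergy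
  refine tendsto_integral_of_dominated_convergence
    (fun p => Real.log 4 + |Real.log 2 + Real.log ‖p.1 - p.2‖|) (fun j => ?_)
    hdom (fun j => ?_) ?_
  · have hm : Measurable fun p : ℂ × ℂ =>
        ((1 - 1 / ((j : ℝ) + 2) : ℝ), Real.arccos p.1.re, Real.arccos p.2.re) :=
      measurable_const.prodMk ((measurable_arccos_re.comp measurable_fst).prodMk
        (measurable_arccos_re.comp measurable_snd))
    have hc := continuous_chordProduct.measurable.comp hm
    exact (Real.measurable_log.comp hc).neg.aestronglyMeasurable
  · filter_upwards [hlog] with p hp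
    rw [norm_neg, Real.norm_eq_abs, ← hp.2]
    exact abs_log_chordProduct_le (radius_mem j).1 (radius_mem j).2 hp.1
  · filter_upwards [hlog] with p hp
    rw [← hp.2, ← chordProduct_one]
    refine Tendsto.neg (Tendsto.log ?_ ?_)
    · have hc : Continuous fun r : ℝ =>
          chordProduct r (Real.arccos p.1.re) (Real.arccos p.2.re) :=
        continuous_chordProduct.comp (by fun_prop : Continuous fun r : ℝ =>
          (r, Real.arccos p.1.re, Real.arccos p.2.re))
      exact (hc.tendsto 1).comp tendsto_radius
    · rw [chordProduct_one]
      exact mul_ne_zero two_ne_zero (abs_ne_zero.mpr (sub_ne_zero.mpr hp.1))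

/-- The limit `r → 1` of the regularized bound; the constants `log 2` cancel since `1 - 2 + 1 = 0`.
-/
lemma logEnergy_lower_bound {σ τ : Measure ℂ} [IsProbabilityMeasure σ] [IsProbabilityMeasure τ]
    (hσ : σ unitSegmentᶜ = 0) (hτ : τ unitSegmentᶜ = 0)
    (hd1 : ∀ᵐ p ∂(σ.prod σ), p.1 ≠ p.2) (hd2 : ∀ᵐ p ∂(σ.prod τ), p.1 ≠ p.2)
    (hd3 : ∀ᵐ p ∂(τ.prod τ), p.1 ≠ p.2)
    (hi1 : Integrable (fun p : ℂ × ℂ => Real.log ‖p.1 - p.2‖) (σ.prod σ))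
    (hi2 : Integrable (fun p : ℂ × ℂ => Real.log ‖p.1 - p.2‖) (σ.prod τ))
    (hi3 : Integrable (fun p : ℂ × ℂ => Real.log ‖p.1 - p.2‖) (τ.prod τ)) (n : ℕ) :
    2 / n * (chebyshevMoment σ n - chebyshevMoment τ n) ^ 2 ≤
      logEnergy σ σ - 2 * logEnergy σ τ + logEnergy τ τ := by
  have h := ((tendsto_regEnergy hσ hσ hd1 hi1).sub
    ((tendsto_regEnergy hσ hτ hd2 hi2).const_mul 2)).add (tendsto_regEnergy hτ hτ hd3 hi3)
  have e : logEnergy σ σ - Real.log 2 - 2 * (logEnergy σ τ - Real.log 2) +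
      (logEnergy τ τ - Real.log 2) = logEnergy σ σ - 2 * logEnergy σ τ + logEnergy τ τ := by ring
  rw [e] at h
  have h2 : Tendsto (fun j : ℕ => 2 * (1 - 1 / ((j : ℝ) + 2)) ^ n / n *
      (chebyshevMoment σ n - chebyshevMoment τ n) ^ 2) atTop
      (𝓝 (2 * 1 ^ n / n * (chebyshevMoment σ n - chebyshevMoment τ n) ^ 2)) :=
    (((tendsto_radius.pow n).const_mul 2).div_const _).mul_const _
  rw [one_pow, mul_one] at h2
  refine le_of_tendsto_of_tendsto' h2 h fun j => ?_
  exact regEnergy_lower_bound (radius_mem j).1 (radius_mem j).2 σ τ n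

/-! ### The weighted equilibrium problem -/

/-- The limit law of the zeros of the polynomials `Btilde n`, as a measure on `ℂ`. -/
def equilibriumMeasure : Measure ℂ := equilibriumLaw.map fun x : ℝ => (x : ℂ)

instance : IsProbabilityMeasure equilibriumMeasure :=
  Measure.isProbabilityMeasure_map Complex.measurable_ofReal.aemeasurable

lemma equilibriumMeasure_compl : equilibriumMeasure unitSegmentᶜ = 0 := by
  have : ∀ᵐ z ∂equilibriumMeasure, z ∈ unitSegment :=
    (ae_map_iff Complex.measurable_ofReal.aemeasurable measurableSet_unitSegment).mpr
      (ae_equilibriumLaw_mem.mono fun x hx => ⟨x, hx, rfl⟩)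
  rwa [ae_iff] at this

lemma log_norm_sub_equilibriumMeasure (z : ℂ) :
    Integrable (fun w : ℂ => Real.log ‖z - w‖) equilibriumMeasure ∧
      ∫ w : ℂ, Real.log ‖z - w‖ ∂equilibriumMeasure =
        2 * Real.log (phi z) - 4 * Real.log (1 + √2) := by
  have hm : Measurable fun w : ℂ => Real.log ‖z - w‖ :=
    Real.measurable_log.comp (measurable_const.sub measurable_id).norm
  obtain ⟨i, v⟩ := log_norm_sub_equilibriumLaw z
  rw [equilibriumMeasure, integrable_map_measure hm.aestronglyMeasurable
    Complex.measurable_ofReal.aemeasurable, integral_map Complex.measurable_ofReal.aemeasurable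
    hm.aestronglyMeasurable]
  exact ⟨i, v⟩

lemma equilibriumMeasure_singleton (z : ℂ) : equilibriumMeasure {z} = 0 := by
  have h : ∀ᵐ w ∂equilibriumMeasure, w ≠ z :=
    (ae_map_iff Complex.measurable_ofReal.aemeasurable (measurableSet_singleton z).compl).mpr
      (ae_equilibriumLaw_ne z)
  simpa [ae_iff] using h

lemma measurable_complex_sqrt : Measurable Complex.sqrt := by
  unfold Complex.sqrt
  fun_prop

lemma measurable_phi : Measurable phi := by
  unfold phi
  have := measurable_complex_sqrt
  fun_prop

lemma norm_le_two {z : ℂ} (hz : z ∈ unitSegment) :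
    ‖z - 1‖ ≤ 2 ∧ ‖z + 1‖ ≤ 2 := by
  obtain ⟨x, hx, rfl⟩ := hz
  have h1 : ((x : ℂ) - 1) = ((x - 1 : ℝ) : ℂ) := by push_cast; rfl
  have h2 : ((x : ℂ) + 1) = ((x + 1 : ℝ) : ℂ) := by push_cast; rfl
  simp only [h1, h2, Complex.norm_real, Real.norm_eq_abs, abs_le]
  refine ⟨⟨?_, ?_⟩, ⟨?_, ?_⟩⟩ <;> linarith [hx.1, hx.2]

lemma phi_le {z : ℂ} (hz : z ∈ unitSegment) : phi z ≤ 10 := by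
  obtain ⟨h1, h2⟩ := norm_le_two hz
  obtain ⟨p, q, r, hp, hq, hr, hphi, -, -⟩ := phi_roots z
  rw [← hp, norm_pow] at h1
  rw [← hq, norm_pow] at h2
  have hp2 : ‖p‖ ≤ 2 := by nlinarith [norm_nonneg p]
  have hq2 : ‖q‖ ≤ 2 := by nlinarith [norm_nonneg q]
  have hr2 : ‖r‖ ≤ 2 := by
    have h := norm_add_le (p ^ 2) (p * q)
    rw [← hr, norm_pow, norm_pow, norm_mul] at h
    nlinarith [norm_nonneg p, norm_nonneg q, norm_nonneg r, sq_nonneg (‖p‖ - ‖q‖)]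
  rw [hphi]
  calc ‖q + 2 * p + 2 * r‖ ≤ ‖q‖ + ‖2 * p‖ + ‖2 * r‖ := norm_add₃_le
    _ = ‖q‖ + 2 * ‖p‖ + 2 * ‖r‖ := by simp
    _ ≤ 10 := by linarith

lemma integrable_log_phi {σ : Measure ℂ} [IsProbabilityMeasure σ] (hσ : σ unitSegmentᶜ = 0) :
    Integrable (fun z => Real.log (phi z)) σ := by
  have h1 : ∀ᵐ z ∂σ, z ∈ unitSegment := by rwa [ae_iff]
  refine Integrable.of_bound (Real.measurable_log.comp measurable_phi).aestronglyMeasurable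
    (Real.log 10) ?_
  filter_upwards [h1] with z hz
  have h2 : 1 ≤ phi z := by nlinarith [two_le_phi_sq z, phi_pos z]
  rw [Real.norm_of_nonneg (Real.log_nonneg h2)]
  exact Real.log_le_log (phi_pos z) (phi_le hz)

lemma norm_sub_le_two {z w : ℂ} (hz : z ∈ unitSegment) (hw : w ∈ unitSegment) : ‖z - w‖ ≤ 2 := by
  obtain ⟨x, hx, rfl⟩ := hz
  obtain ⟨y, hy, rfl⟩ := hw
  simp only [← Complex.ofReal_sub, Complex.norm_real, Real.norm_eq_abs, abs_le]
  constructor <;> linarith [hx.1, hx.2, hy.1, hy.2]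

lemma measurable_log_norm_sub_prod : Measurable fun p : ℂ × ℂ => Real.log ‖p.1 - p.2‖ :=
  Real.measurable_log.comp (measurable_fst.sub measurable_snd).norm

lemma measurableSet_diag : MeasurableSet {p : ℂ × ℂ | p.1 = p.2} :=
  measurableSet_eq_fun measurable_fst measurable_snd

lemma ae_prod_equilibriumMeasure_ne (σ : Measure ℂ) [IsProbabilityMeasure σ] :
    ∀ᵐ p ∂(σ.prod equilibriumMeasure), p.1 ≠ p.2 := by
  rw [ae_iff]
  simp only [ne_eq, not_not]
  rw [Measure.measure_prod_null measurableSet_diag]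
  refine .of_forall fun z => ?_
  have : Prod.mk z ⁻¹' {p : ℂ × ℂ | p.1 = p.2} = {z} := by
    ext w
    simp [eq_comm]
  simp only [this, equilibriumMeasure_singleton, Pi.zero_apply]

/-- On the segment `|log |z-w|| ≤ 2 log 2 - log |z-w|`, and integrating in `w` gives the explicit
potential, which is bounded in `z`. -/
lemma integrable_log_prod_equilibriumMeasure {σ : Measure ℂ} [IsProbabilityMeasure σ]
    (hσ : σ unitSegmentᶜ = 0) :
    Integrable (fun p : ℂ × ℂ => Real.log ‖p.1 - p.2‖) (σ.prod equilibriumMeasure) := by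
  have hm := measurable_log_norm_sub_prod
  rw [integrable_prod_iff hm.aestronglyMeasurable]
  refine ⟨.of_forall fun z => (log_norm_sub_equilibriumMeasure z).1, ?_⟩
  have hz : ∀ᵐ z ∂σ, z ∈ unitSegment := by rwa [ae_iff]
  have hw : ∀ᵐ w ∂equilibriumMeasure, w ∈ unitSegment := by
    rw [ae_iff]
    exact equilibriumMeasure_compl
  have hdom : Integrable (fun z => 2 * Real.log 2 -
      (2 * Real.log (phi z) - 4 * Real.log (1 + √2))) σ :=
    (integrable_const _).sub (((integrable_log_phi hσ).const_mul 2).sub (integrable_const _))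
  refine hdom.mono' hm.stronglyMeasurable.norm.integral_prod_right'.aestronglyMeasurable ?_
  filter_upwards [hz] with z hz
  obtain ⟨i, v⟩ := log_norm_sub_equilibriumMeasure z
  rw [Real.norm_of_nonneg (integral_nonneg fun _ => norm_nonneg _), ← v]
  have e : 2 * Real.log 2 - ∫ w, Real.log ‖z - w‖ ∂equilibriumMeasure =
      ∫ w, (2 * Real.log 2 - Real.log ‖z - w‖) ∂equilibriumMeasure := by
    rw [integral_sub (integrable_const _) i]
    simp
  rw [e]
  refine integral_mono_ae i.norm ((integrable_const _).sub i) ?_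
  filter_upwards [hw] with w hw
  exact abs_log_le _ _ (norm_nonneg _) one_le_two (norm_sub_le_two hz hw)

/-- The Frostman equality: the potential of the equilibrium measure plus the external field `2 log
φ` is constant. -/
lemma logEnergy_equilibriumMeasure {σ : Measure ℂ} [IsProbabilityMeasure σ]
    (hσ : σ unitSegmentᶜ = 0) :
    logEnergy σ equilibriumMeasure =
      4 * Real.log (1 + √2) - 2 * ∫ z, Real.log (phi z) ∂σ := by
  rw [logEnergy, integral_neg, integral_prod _ (integrable_log_prod_equilibriumMeasure hσ)]
  simp only [fun z => (log_norm_sub_equilibriumMeasure z).2]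
  rw [integral_sub ((integrable_log_phi hσ).const_mul 2) (integrable_const _),
    integral_const_mul]
  simp

lemma weight_pos (z : ℂ) : 0 < weight z := inv_pos.mpr (pow_pos (phi_pos z) 2)

lemma log_weight (z : ℂ) : Real.log (weight z) = -(2 * Real.log (phi z)) := by
  rw [weight, Real.log_inv, Real.log_pow]
  norm_num

lemma log_weighted_kernel {p : ℂ × ℂ} (hp : p.1 ≠ p.2) :
    -Real.log (‖p.1 - p.2‖ * weight p.1 * weight p.2) =
      -Real.log ‖p.1 - p.2‖ + 2 * Real.log (phi p.1) + 2 * Real.log (phi p.2) := by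
  have h0 : ‖p.1 - p.2‖ ≠ 0 := norm_ne_zero_iff.mpr (sub_ne_zero.mpr hp)
  rw [Real.log_mul (mul_ne_zero h0 (weight_pos _).ne') (weight_pos _).ne',
    Real.log_mul h0 (weight_pos _).ne', log_weight, log_weight]
  ring

/-- A unit measure of finite logarithmic energy has a finite weighted energy. -/
lemma weightedEnergy_of_integrable {σ : Measure ℂ} [IsProbabilityMeasure σ]
    (hσ : σ unitSegmentᶜ = 0) (hd : ∀ᵐ p ∂(σ.prod σ), p.1 ≠ p.2)
    (hi : Integrable (fun p : ℂ × ℂ => Real.log ‖p.1 - p.2‖) (σ.prod σ)) :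
    weightedEnergy weight σ =
      ((logEnergy σ σ + 4 * ∫ z, Real.log (phi z) ∂σ : ℝ) : EReal) := by
  have hphi := integrable_log_phi hσ
  have i1 : Integrable (fun p : ℂ × ℂ => 2 * Real.log (phi p.1)) (σ.prod σ) :=
    (hphi.comp_fst σ).const_mul 2
  have i2 : Integrable (fun p : ℂ × ℂ => 2 * Real.log (phi p.2)) (σ.prod σ) :=
    (hphi.comp_snd σ).const_mul 2
  have i0 : Integrable (fun p : ℂ × ℂ => -Real.log ‖p.1 - p.2‖) (σ.prod σ) := hi.neg
  have i01 : Integrable (fun p : ℂ × ℂ => -Real.log ‖p.1 - p.2‖ + 2 * Real.log (phi p.1))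
      (σ.prod σ) := i0.add i1
  have i3 : Integrable (fun p : ℂ × ℂ => -Real.log ‖p.1 - p.2‖ + 2 * Real.log (phi p.1) +
      2 * Real.log (phi p.2)) (σ.prod σ) := i01.add i2
  rw [weightedEnergy, extIntegral_of_integrable i3]
  · congr 1
    rw [integral_add i01 i2, integral_add i0 i1, logEnergy, integral_const_mul,
      integral_const_mul, integral_fun_fst (fun z => Real.log (phi z)),
      integral_fun_snd (fun z => Real.log (phi z))]
    simp
    ring
  · filter_upwards [hd] with p hp
    rw [log_inv_ofReal (mul_pos (mul_pos (norm_pos_iff.mpr (sub_ne_zero.mpr hp)) (weight_pos _))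
      (weight_pos _)), log_weighted_kernel hp]

/-- Makes the extended energy kernel nonnegative on the segment, so the energy is a plain Lebesgue
integral without a negative part. -/
lemma weighted_kernel_le_one {p : ℂ × ℂ} (h1 : p.1 ∈ unitSegment) (h2 : p.2 ∈ unitSegment) :
    ‖p.1 - p.2‖ * weight p.1 * weight p.2 ≤ 1 := by
  have hw : ∀ z, weight z ≤ 2⁻¹ := fun z => inv_anti₀ two_pos (two_le_phi_sq z)
  calc ‖p.1 - p.2‖ * weight p.1 * weight p.2 ≤ 2 * 2⁻¹ * 2⁻¹ :=
        mul_le_mul (mul_le_mul (norm_sub_le_two h1 h2) (hw _) (weight_pos _).le zero_le_two)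
          (hw _) (weight_pos _).le (by norm_num)
    _ ≤ 1 := by norm_num

/-- The kernel is nonnegative and equals `⊤` on the diagonal. If its integral is finite, the
diagonal is null and the kernel is integrable; `log φ` being bounded on the segment, so is `log
|z-w|`. -/
lemma weightedEnergy_eq_top_or {σ : Measure ℂ} [IsProbabilityMeasure σ]
    (hσ : σ unitSegmentᶜ = 0) :
    weightedEnergy weight σ = ⊤ ∨ ((∀ᵐ p ∂(σ.prod σ), p.1 ≠ p.2) ∧
      Integrable (fun p : ℂ × ℂ => Real.log ‖p.1 - p.2‖) (σ.prod σ)) := by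
  have hmem := ae_prod_mem hσ hσ
  set k : ℂ × ℂ → EReal := fun p =>
    ENNReal.log (ENNReal.ofReal (‖p.1 - p.2‖ * weight p.1 * weight p.2))⁻¹ with hk
  have hwm : Measurable weight := (measurable_phi.pow_const 2).inv
  have hkm' : Measurable fun p : ℂ × ℂ => ‖p.1 - p.2‖ * weight p.1 * weight p.2 :=
    ((measurable_fst.sub measurable_snd).norm.mul (hwm.comp measurable_fst)).mul
      (hwm.comp measurable_snd)
  have hkm : Measurable fun p => (k p).toENNReal :=
    measurable_ereal_toENNReal.comp (ENNReal.log_monotone.measurable.comp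
      (ENNReal.measurable_ofReal.comp hkm').inv)
  have hk0 : ∀ᵐ p ∂(σ.prod σ), 0 ≤ k p := by
    filter_upwards [hmem] with p hp
    rw [hk]
    dsimp only
    rw [ENNReal.zero_le_log_iff, ENNReal.one_le_inv]
    exact ENNReal.ofReal_le_one.mpr (weighted_kernel_le_one hp.1 hp.2)
  have hneg : ∫⁻ p, (-k p).toENNReal ∂(σ.prod σ) = 0 := by
    rw [lintegral_congr_ae (g := fun _ => 0) (hk0.mono fun p hp =>
      EReal.toENNReal_of_nonpos (by simpa using hp)), lintegral_zero]
  have hen : weightedEnergy weight σ = ((∫⁻ p, (k p).toENNReal ∂(σ.prod σ) : ℝ≥0∞) : EReal) := by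
    rw [weightedEnergy, extIntegral, hneg]
    simp only [EReal.coe_ennreal_zero, sub_zero]
    rfl
  by_cases htop : ∫⁻ p, (k p).toENNReal ∂(σ.prod σ) = ⊤
  · left
    rw [hen, htop]
    rfl
  · right
    have hd : ∀ᵐ p ∂(σ.prod σ), p.1 ≠ p.2 := by
      filter_upwards [ae_lt_top hkm htop] with p hp h
      rw [hk] at hp
      simp [h] at hp
    refine ⟨hd, ?_⟩
    have hkf : ∀ᵐ p ∂(σ.prod σ),
        k p = ((-Real.log (‖p.1 - p.2‖ * weight p.1 * weight p.2) : ℝ) : EReal) := by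
      filter_upwards [hd] with p hp
      exact log_inv_ofReal (mul_pos (mul_pos (norm_pos_iff.mpr (sub_ne_zero.mpr hp))
        (weight_pos _)) (weight_pos _))
    have hf0 : 0 ≤ᵐ[σ.prod σ] fun p =>
        -Real.log (‖p.1 - p.2‖ * weight p.1 * weight p.2) := by
      filter_upwards [hk0, hkf] with p h1 h2
      rw [h2] at h1
      exact_mod_cast h1
    have hfi : Integrable (fun p : ℂ × ℂ =>
        -Real.log (‖p.1 - p.2‖ * weight p.1 * weight p.2)) (σ.prod σ) := by
      refine (lintegral_ofReal_ne_top_iff_integrable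
        (Real.measurable_log.comp hkm').neg.aestronglyMeasurable hf0).mp ?_
      rw [lintegral_congr_ae (g := fun p => (k p).toENNReal)]
      · exact htop
      · filter_upwards [hkf] with p hp
        rw [hp, EReal.real_coe_toENNReal]
        rfl
    have hphi := integrable_log_phi hσ
    have i1 : Integrable (fun p : ℂ × ℂ => 2 * Real.log (phi p.1)) (σ.prod σ) :=
      (hphi.comp_fst σ).const_mul 2
    have i2 : Integrable (fun p : ℂ × ℂ => 2 * Real.log (phi p.2)) (σ.prod σ) :=
      (hphi.comp_snd σ).const_mul 2
    refine ((i1.add i2).sub hfi).congr ?_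
    filter_upwards [hd] with p hp
    simp only [Pi.sub_apply, Pi.add_apply]
    rw [log_weighted_kernel hp]
    ring

lemma weightedEnergy_equilibriumMeasure :
    weightedEnergy weight equilibriumMeasure =
      ((8 * Real.log (1 + √2) - logEnergy equilibriumMeasure equilibriumMeasure : ℝ) : EReal) := by
  rw [weightedEnergy_of_integrable equilibriumMeasure_compl (ae_prod_equilibriumMeasure_ne _)
    (integrable_log_prod_equilibriumMeasure equilibriumMeasure_compl)]
  have := logEnergy_equilibriumMeasure equilibriumMeasure_compl
  congr 1
  linarith

/-- The excess of the weighted energy over its minimum controls all Chebyshev moments. -/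
lemma weightedEnergy_lower_bound {σ : Measure ℂ} [IsProbabilityMeasure σ]
    (hσ : σ unitSegmentᶜ = 0) (n : ℕ) :
    weightedEnergy weight equilibriumMeasure + ((2 / n *
      (chebyshevMoment σ n - chebyshevMoment equilibriumMeasure n) ^ 2 : ℝ) : EReal) ≤
      weightedEnergy weight σ := by
  rcases weightedEnergy_eq_top_or hσ with h | ⟨hd, hi⟩
  · rw [h]
    exact le_top
  · rw [weightedEnergy_of_integrable hσ hd hi, weightedEnergy_equilibriumMeasure,
      ← EReal.coe_add, EReal.coe_le_coe_iff]
    -- The Frostman equality turns the excess energy into `E(σ,σ) - 2 E(σ,ν) + E(ν,ν)`, with `ν` the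
    -- equilibrium measure.
    have h1 := logEnergy_lower_bound hσ equilibriumMeasure_compl hd
      (ae_prod_equilibriumMeasure_ne σ) (ae_prod_equilibriumMeasure_ne _) hi
      (integrable_log_prod_equilibriumMeasure hσ)
      (integrable_log_prod_equilibriumMeasure equilibriumMeasure_compl) n
    have h2 := logEnergy_equilibriumMeasure hσ
    linarith

lemma isWeightedEquilibrium_equilibriumMeasure :
    IsWeightedEquilibrium unitSegment weight equilibriumMeasure := by
  refine ⟨⟨inferInstance, equilibriumMeasure_compl⟩, fun σ hσ => ?_⟩
  have := hσ.1
  -- For `n = 0` the correction is zero, as `2 / 0 = 0`.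
  have h := weightedEnergy_lower_bound hσ.2 0
  simpa using h

/-- Passes from Chebyshev to power moments (the case `n = 0`) by `2 cos x cos (n x) = cos ((n+1) x)
+ cos ((n-1) x)`. Integer `n` lets the induction step below zero. -/
lemma integral_cos_pow_mul_cos_eq {σ τ : Measure ℂ} [IsProbabilityMeasure σ]
    [IsProbabilityMeasure τ] (h : ∀ n, chebyshevMoment σ n = chebyshevMoment τ n) (k : ℕ) (n : ℤ) :
    ∫ z, Real.cos (Real.arccos z.re) ^ k * Real.cos (n * Real.arccos z.re) ∂σ =
      ∫ z, Real.cos (Real.arccos z.re) ^ k * Real.cos (n * Real.arccos z.re) ∂τ := by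
  induction k generalizing n with
  | zero =>
    have e : ∀ x : ℝ, Real.cos (n * x) = Real.cos (n.natAbs * x) := by
      intro x
      rcases Int.natAbs_eq n with hn | hn
      · conv_lhs => rw [hn]
        rw [Int.cast_natCast]
      · conv_lhs => rw [hn]
        rw [Int.cast_neg, Int.cast_natCast, neg_mul, Real.cos_neg]
    simp only [pow_zero, one_mul, e]
    exact h _
  | succ k ih =>
    have e : ∀ x : ℝ, Real.cos x ^ (k + 1) * Real.cos (n * x) =
        2⁻¹ * (Real.cos x ^ k * Real.cos (((n + 1 : ℤ) : ℝ) * x) +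
          Real.cos x ^ k * Real.cos (((n - 1 : ℤ) : ℝ) * x)) := by
      intro x
      push_cast
      rw [add_mul, sub_mul, one_mul, Real.cos_add, Real.cos_sub]
      ring
    have hi : ∀ (ρ : Measure ℂ) [IsProbabilityMeasure ρ] (m : ℤ), Integrable (fun z : ℂ =>
        Real.cos (Real.arccos z.re) ^ k * Real.cos (m * Real.arccos z.re)) ρ := by
      intro ρ _ m
      have hm := measurable_arccos_re
      refine Integrable.of_bound (((Real.measurable_cos.comp hm).pow_const k).mul
        (Real.measurable_cos.comp (hm.const_mul _))).aestronglyMeasurable 1 (.of_forall fun z => ?_)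
      rw [norm_mul, norm_pow, Real.norm_eq_abs, Real.norm_eq_abs]
      exact mul_le_one₀ (pow_le_one₀ (abs_nonneg _) (Real.abs_cos_le_one _)) (abs_nonneg _)
        (Real.abs_cos_le_one _)
    simp only [e]
    rw [integral_const_mul, integral_const_mul, integral_add (hi σ _) (hi σ _),
      integral_add (hi τ _) (hi τ _), ih, ih]

lemma eq_of_chebyshevMoment_eq {σ τ : Measure ℂ} [IsProbabilityMeasure σ]
    [IsProbabilityMeasure τ] (hσ : σ unitSegmentᶜ = 0) (hτ : τ unitSegmentᶜ = 0)
    (h : ∀ n, chebyshevMoment σ n = chebyshevMoment τ n) : σ = τ := by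
  have hre : ∀ (ρ : Measure ℂ) [IsProbabilityMeasure ρ], IsProbabilityMeasure (ρ.map Complex.re) :=
    fun ρ _ => Measure.isProbabilityMeasure_map Complex.measurable_re.aemeasurable
  have := hre σ
  have := hre τ
  have hae : ∀ {ρ : Measure ℂ}, ρ unitSegmentᶜ = 0 → ∀ᵐ z ∂ρ, z.re ∈ Set.Icc (-1 : ℝ) 1 ∧
      (z.re : ℂ) = z := by
    intro ρ hρ
    have h1 : ∀ᵐ z ∂ρ, z ∈ unitSegment := by rwa [ae_iff]
    filter_upwards [h1]
    rintro _ ⟨x, hx, rfl⟩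
    simpa using hx
  have hsupp : ∀ {ρ : Measure ℂ}, ρ unitSegmentᶜ = 0 →
      (ρ.map Complex.re) (Set.Icc (-1) 1)ᶜ = 0 := by
    intro ρ hρ
    have : ∀ᵐ x ∂(ρ.map Complex.re), x ∈ Set.Icc (-1 : ℝ) 1 :=
      (ae_map_iff Complex.measurable_re.aemeasurable measurableSet_Icc).mpr
        ((hae hρ).mono fun z hz => hz.1)
    rwa [ae_iff] at this
  have hmom : ∀ {ρ : Measure ℂ}, ρ unitSegmentᶜ = 0 → ∀ k : ℕ, ∫ x, x ^ k ∂(ρ.map Complex.re) =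
      ∫ z, Real.cos (Real.arccos z.re) ^ k * Real.cos (((0 : ℤ) : ℝ) * Real.arccos z.re) ∂ρ := by
    intro ρ hρ k
    rw [integral_map Complex.measurable_re.aemeasurable (by fun_prop)]
    refine integral_congr_ae ((hae hρ).mono fun z hz => ?_)
    simp only [Int.cast_zero, zero_mul, Real.cos_zero, mul_one]
    rw [Real.cos_arccos hz.1.1 hz.1.2]
  refine ext_of_forall_integral_eq_of_IsFiniteMeasure fun f => ?_
  have hf : Continuous fun x : ℝ => f (x : ℂ) := f.continuous.comp Complex.continuous_ofReal
  have hint : ∀ {ρ : Measure ℂ}, ρ unitSegmentᶜ = 0 →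
      ∫ z, f z ∂ρ = ∫ x : ℝ, f (x : ℂ) ∂(ρ.map Complex.re) := by
    intro ρ hρ
    rw [integral_map Complex.measurable_re.aemeasurable hf.measurable.aestronglyMeasurable]
    exact integral_congr_ae ((hae hρ).mono fun z hz => by simp only [hz.2])
  rw [hint hσ, hint hτ]
  -- A constant sequence of measures with the same moments: uniqueness of the limit equates the
  -- integrals.
  refine tendsto_nhds_unique (tendsto_const_nhds (f := (atTop : Filter ℕ)))
    (tendsto_integral_of_tendsto_moments (ρ := fun _ => σ.map Complex.re)
      (fun _ => hsupp hσ) (hsupp hτ) (fun k => ?_) hf.continuousOn)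
  rw [hmom hσ, hmom hτ, integral_cos_pow_mul_cos_eq h]
  exact tendsto_const_nhds

/-- A minimizer has no excess energy, so every squared difference of Chebyshev moments with `n ≥ 1`
vanishes; for `n = 0` both moments are `1`. -/
lemma eq_equilibriumMeasure {σ : Measure ℂ} (hσ : IsWeightedEquilibrium unitSegment weight σ) :
    σ = equilibriumMeasure := by
  have := hσ.1.1
  refine eq_of_chebyshevMoment_eq hσ.1.2 equilibriumMeasure_compl fun n => ?_
  rcases n.eq_zero_or_pos with rfl | hn
  · simp [chebyshevMoment]
  have h := (weightedEnergy_lower_bound hσ.1.2 n).trans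
    (hσ.2 _ isWeightedEquilibrium_equilibriumMeasure.1)
  rw [weightedEnergy_equilibriumMeasure, ← EReal.coe_add, EReal.coe_le_coe_iff] at h
  have hn' : (0 : ℝ) < 2 / n := by positivity
  have h2 : (chebyshevMoment σ n - chebyshevMoment equilibriumMeasure n) ^ 2 ≤ 0 := by
    by_contra! hc
    have := mul_pos hn' hc
    linarith
  exact sub_eq_zero.mp (pow_eq_zero_iff two_ne_zero |>.mp (le_antisymm h2 (sq_nonneg _)))

end Apery

end

theorem theorem4p3 :
    (∃ ν : Measure ℂ,
      Apery.IsUnitMeasureOn Apery.unitSegment ν ∧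
      Apery.WeakStarTendsto (fun n => Apery.zeroCountingMeasure (Apery.Btilde n)) ν ∧
      Apery.IsWeightedEquilibrium Apery.unitSegment Apery.weight ν ∧
      (∀ σ : Measure ℂ,
        Apery.IsWeightedEquilibrium Apery.unitSegment Apery.weight σ → σ = ν) ∧
      (∀ z : ℂ, Apery.logPotential ν z =
        ((Real.log ((1 + √2) ^ 4) - 2 * Real.log (Apery.phi z) : ℝ) : EReal)) ∧
      Apery.HasRealDensity ν (Set.Icc (-1) 1) Apery.nuDensity) ∧
    (∃ μ : Measure ℂ,
      Apery.IsUnitMeasureOn Apery.negHalfLine μ ∧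
      Apery.WeakStarTendsto (fun n => Apery.zeroCountingMeasure (Apery.B n)) μ ∧
      (∀ z : ℂ, Apery.logPotential μ z =
        ((4 * Real.log 2 - 2 * Real.log
          ‖1 + 2 * (Complex.sqrt z + Complex.sqrt (z + Complex.sqrt z))‖ : ℝ) : EReal)) ∧
      Apery.HasRealDensity μ (Set.Iic 0) Apery.muDensity) := by
  refine ⟨⟨Apery.equilibriumMeasure, ⟨inferInstance, Apery.equilibriumMeasure_compl⟩,
    Apery.weakStarTendsto_Btilde, Apery.isWeightedEquilibrium_equilibriumMeasure,
    fun σ hσ => Apery.eq_equilibriumMeasure hσ, Apery.logPotential_equilibriumLaw, ?_⟩,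
    ⟨Apery.limitLaw.map fun x : ℝ => (x : ℂ), ⟨?_, ?_⟩, Apery.weakStarTendsto_B,
      Apery.logPotential_limitLaw, ?_⟩⟩
  · rw [Apery.HasRealDensity, ← Apery.equilibriumLaw_eq, Apery.equilibriumMeasure]
  · exact Measure.isProbabilityMeasure_map Complex.measurable_ofReal.aemeasurable
  · refine measure_mono_null (fun z hz h => hz (Apery.mem_negHalfLine_iff.mpr h)) ?_
    exact ae_iff.mp ((ae_map_iff Complex.measurable_ofReal.aemeasurable
      ((measurableSet_Iic.preimage Complex.measurable_re).inter
        ((measurableSet_singleton 0).preimage Complex.measurable_im))).mpr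
      (Apery.ae_limitLaw_nonpos.mono fun x hx => ⟨hx, rfl⟩))
  · rw [Apery.HasRealDensity, ← Apery.limitLaw_eq]
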